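/- **Setting.** Let $D$ be a nonempty finite set and $k$ a positive semidefinite kernel on $D$ with $k(x,x)=1$ for all $x$. Let $f$ be a centred Gaussian process on $D$ with covariance $k$. At time $t=1,2,\dots$ a point $x_t\in D$ is queried at unit cost, and $y_t=f(x_t)+z_t$ is observed, with $z_t$ i.i.d. $N(0,\sigma^2)$, $\sigma>0$, independent of $f$. Let $\mu_t,\sigma_t^2$ be the Gaussian posterior mean and variance after time $t$, and let $\sigma^2_{t|S}$ be the posterior variance if a finite collection $S$ of points (repetitions allowed) is also observed. Assume that, for all selected points $x_1,\dots,x_t$ and every $x\in D$, the variance reduction $S\mapsto\sigma_t^2(x)-\sigma^2_{t|S}(x)$ is submodular. **Algorithm (TruVaR).** The parameters are $\bar\delta>0$, $r=\tfrac12$, $\eta_{(1)}=1$, $\eta_{(i)}=r^{i-1}\eta_{(1)}$, and $\beta_{(i)}>0$ for $i\ge1$. Start with epoch $i=1$, $M_0=D$, $H_0=L_0=\emptyset$. At time $t$: 1. Query $x_t\in D$ maximizing $\sum_{\bar x\in M_{t-1}}\max\{\beta_{(i)}\sigma_{t-1}^2(\bar x),\eta_{(i)}^2\}-\sum_{\bar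 x\in M_{t-1}}\max\{\beta_{(i)}\sigma_{t-1|x}^2(\bar x),\eta_{(i)}^2\}$ over $x\in D$, with ties broken by a rule depending only on past observations. 2. Put $u_t=\mu_t+\beta_{(i)}^{1/2}\sigma_t$ and $\ell_t=\mu_t-\beta_{(i)}^{1/2}\sigma_t$. For Bayesian optimization (BO), set $M_t=\{x\in M_{t-1}:u_t(x)\ge\max_{M_{t-1}}\ell_t\}$. For level-set estimation (LSE) with threshold $h$, set $M_t=\{x\in M_{t-1}:u_t(x)\ge h\ge\ell_t(x)\}$, $H_t=H_{t-1}\cup\{x\in M_{t-1}:\ell_t(x)>h\}$ and $L_t=L_{t-1}\cup\{x\in M_{t-1}:u_t(x)<h\}$. 3. While $M_t\neq\emptyset$ and $\max_{x\in M_t}\beta_{(i)}^{1/2}\sigma_t(x)\le(1+\bar\delta)\eta_{(i)}$, increase $i$ by one. **$\epsilon$-accuracy after time $t$.** For BO: $M_t$ contains every maximizer $x^*$ of $f$, and $f(x^*)-f(x)\le\epsilon$ for all $x\in M_t$. For LSE: $f>h$ on $H_t$, $f<h$ on $L_t$, and $|f-h|\le\epsilon/2$ on $M_t$. **Notation.**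 For integers $T\ge1$ put $\gamma_T=\max_{x_1,\dots,x_T\in D}\frac12\log\det\big(I+\sigma^{-2}[k(x_i,x_j)]_{i,j}\big)$, $\beta_T=2\log\frac{|D|T^2\pi^2}{6\delta}$ and $C_1=\frac1{\log(1+\sigma^{-2})}$. **Claim.** Let $0<\epsilon<4(1+\bar\delta)$ and $\delta\in(0,1)$. There is a sequence $(\beta_{(i)})$, bounded below by a positive constant and not depending on $T$, such that for BO and for LSE with any threshold $h$, with probability at least $1-\delta$, $\epsilon$-accuracy holds after time $T$ for every integer $T\ge1$ satisfying $$T\ \ge\ \Big(C_1\gamma_T\beta_T\frac{96(1+\bar\delta)^2}{\epsilon^2}+2\Big\lceil\log_2\frac{8(1+\bar\delta)}{\epsilon}\Big\rceil\Big)\log\frac{16(1+\bar\delta)^2|D|\beta_T}{\bar\delta^2\epsilon^2}.$$ This condition has the form $T\ge\Omega^*\big(\frac{C_1\gamma_T\beta_T}{\epsilon^2}+1\big)$, in the following sense. There is a constant $K>0$ depending only on $\bar\delta$ such that, for every integer $T\ge1$, the right-hand side is at most $K\big(\frac{C_1\gamma_T\beta_T}{\epsilon^2}+1\big)\big(1+\log^+\tfrac1\epsilon+\log|D|+\log^+\beta_T\big)^2$.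 Moreover, the right-hand side is at least $\frac{C_1\gamma_T\beta_T}{\epsilon^2}+1$ whenever its logarithmic factor $\log\frac{16(1+\bar\delta)^2|D|\beta_T}{\bar\delta^2\epsilon^2}$ is at least $1$. -/

import Mathlib

open MeasureTheory ProbabilityTheory
open scoped Matrix

noncomputable section

namespace TruVaR

/-! ### Gaussian process posteriors (homoscedastic noise of variance `s2`) -/

section Posterior

variable {D : Type*}

/-- Gram matrix `K = [k(x_i, x_j)]` of the points `x_1, …, x_t`. -/
def gram (k : D → D → ℝ) {t : ℕ} (X : Fin t → D) : Matrix (Fin t) (Fin t) ℝ :=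
  Matrix.of fun i j => k (X i) (X j)

/-- The vector `k_t(a) = [k(x_i, a)]`. -/
def kvec (k : D → D → ℝ) {t : ℕ} (X : Fin t → D) (a : D) : Fin t → ℝ :=
  fun i => k (X i) a

/-- Posterior mean at `a` after observing the values `y` at the points `X`. -/
def postMean (k : D → D → ℝ) (s2 : ℝ) {t : ℕ} (X : Fin t → D) (y : Fin t → ℝ) (a : D) : ℝ :=
  kvec k X a ⬝ᵥ ((gram k X + s2 • (1 : Matrix (Fin t) (Fin t) ℝ))⁻¹ *ᵥ y)

/-- Posterior variance at `a` after observing the points `X`. The posterior variance after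
observing further points `S` (duplicates allowed) is `postVar k s2 (Fin.append X S) a`. -/
def postVar (k : D → D → ℝ) (s2 : ℝ) {t : ℕ} (X : Fin t → D) (a : D) : ℝ :=
  k a a - kvec k X a ⬝ᵥ
    ((gram k X + s2 • (1 : Matrix (Fin t) (Fin t) ℝ))⁻¹ *ᵥ kvec k X a)

/-- Variance reduction `ψ(S) = σ_t²(a) - σ_{t|S}²(a)`, given the already selected points `X`. -/
def varReduction (k : D → D → ℝ) (s2 : ℝ) {t m : ℕ} (X : Fin t → D) (a : D) (S : Fin m → D) : ℝ :=
  postVar k s2 X a - postVar k s2 (Fin.append X S) a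

/-- Submodularity (diminishing returns) of the variance reduction, for all selected points `X` and
all query points `a`: adding `b` to a collection `S` gains at least as much as adding `b` to a
larger collection `S ∪ R`. Collections may contain duplicates. -/
def SubmodularVarReduction (k : D → D → ℝ) (s2 : ℝ) : Prop :=
  ∀ (t m n : ℕ) (X : Fin t → D) (a : D) (S : Fin m → D) (R : Fin n → D) (b : D),
    varReduction k s2 X a (Fin.append (Fin.append S R) ![b])
        - varReduction k s2 X a (Fin.append S R)
      ≤ varReduction k s2 X a (Fin.append S ![b]) - varReduction k s2 X a S

/-- Maximum mutual information `γ_T = max_{x_1, …, x_T} ½ log det (I + σ⁻² K_T)`. -/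
def gamma (k : D → D → ℝ) (s2 : ℝ) (T : ℕ) : ℝ :=
  ⨆ X : Fin T → D,
    (1 / 2) * Real.log (1 + s2⁻¹ • gram k X : Matrix (Fin T) (Fin T) ℝ).det

end Posterior

/-! ### The algorithm -/

/-- The two problems: Bayesian optimization, and level-set estimation with threshold `h`. -/
inductive Problem where
  | bo : Problem
  | lse (h : ℝ) : Problem

/-- Parameters of the algorithm: noise variance, `η₍₁₎`, `r`, `δ̄`, and `β₍ᵢ₎` for `i ≥ 1`. -/
structure Params where
  s2 : ℝ
  eta1 : ℝ
  r : ℝ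
  dbar : ℝ
  beta : ℕ → ℝ

/-- Target confidence `η₍ᵢ₎ = η₍₁₎ rⁱ⁻¹` of epoch `i ≥ 1`. -/
def Params.eta (p : Params) (i : ℕ) : ℝ := p.eta1 * p.r ^ (i - 1)

/-- State after some time step: the sets `M_t`, `H_t`, `L_t` (the last two are used only in
level-set estimation), and the number of the current epoch. -/
structure State (D : Type*) where
  M : Finset D
  H : Finset D
  L : Finset D
  epoch : ℕ

section Algorithm

variable {D : Type*}

/-- Upper confidence bound `μ + β^{1/2} σ`. -/
def ucb (k : D → D → ℝ) (s2 b : ℝ) {t : ℕ} (X : Fin t → D) (y : Fin t → ℝ) (a : D) : ℝ :=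
  postMean k s2 X y a + √b * √(postVar k s2 X a)

/-- Lower confidence bound `μ - β^{1/2} σ`. -/
def lcb (k : D → D → ℝ) (s2 b : ℝ) {t : ℕ} (X : Fin t → D) (y : Fin t → ℝ) (a : D) : ℝ :=
  postMean k s2 X y a - √b * √(postVar k s2 X a)

open Classical in
/-- The update of `(M, H, L)` from the selected points and observations, with the `β` of the current
epoch; the epoch number is left as it is. -/
def updateSets (pb : Problem) (k : D → D → ℝ) (p : Params) {t : ℕ} (X : Fin t → D) (y : Fin t → ℝ)
    (s : State D) : State D :=
  let u := ucb k p.s2 (p.beta s.epoch) X y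
  let l := lcb k p.s2 (p.beta s.epoch) X y
  match pb with
  | .bo => { s with M := {a ∈ s.M | ∀ c ∈ s.M, l c ≤ u a} }
  | .lse h =>
    { s with
      M := {a ∈ s.M | h ≤ u a ∧ l a ≤ h}
      H := s.H ∪ {a ∈ s.M | h < l a}
      L := s.L ∪ {a ∈ s.M | u a < h} }

/-- The condition of the `while` loop: `max_{a ∈ M_t} β₍ᵢ₎^{1/2} σ_t(a) ≤ (1 + δ̄) η₍ᵢ₎`. -/
def EpochDone (k : D → D → ℝ) (p : Params) {t : ℕ} (X : Fin t → D) (M : Finset D) (i : ℕ) : Prop :=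
  ∀ a ∈ M, √(p.beta i) * √(postVar k p.s2 X a) ≤ (1 + p.dbar) * p.eta i

open Classical in
/-- The epoch number when the `while` loop that is entered with epoch number `i` is left. (If `M_t`
is empty, every point is classified and nothing is left to do; the epoch number is then kept.) -/
def nextEpoch (k : D → D → ℝ) (p : Params) {t : ℕ} (X : Fin t → D) (M : Finset D) (i : ℕ) : ℕ :=
  if hj : ∃ j, i ≤ j ∧ ¬ EpochDone k p X M j then Nat.find hj else i

/-- The state after `t` time steps, when the queried points are `x 0, x 1, …` and the observed
values are `y 0, y 1, …` (entry `s` belongs to time step `s + 1`). -/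
def state [Fintype D] (pb : Problem) (k : D → D → ℝ) (p : Params) (x : ℕ → D) (y : ℕ → ℝ) :
    ℕ → State D
  | 0 => { M := Finset.univ, H := ∅, L := ∅, epoch := 1 }
  | t + 1 =>
    let X : Fin (t + 1) → D := fun i => x i
    let s := updateSets pb k p X (fun i => y i) (state pb k p x y t)
    { s with epoch := nextEpoch k p X s.M s.epoch }

/-- The acquisition function (unit costs) at `a`, when the points `X` have been queried and the
state is `s`: the reduction of the sum of truncated variances over `M` caused by querying `a`. -/
def acq (k : D → D → ℝ) (p : Params) {t : ℕ} (X : Fin t → D) (s : State D) (a : D) : ℝ :=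
  (∑ b ∈ s.M, max (p.beta s.epoch * postVar k p.s2 X b) (p.eta s.epoch ^ 2))
    - ∑ b ∈ s.M, max (p.beta s.epoch * postVar k p.s2 (Fin.append X ![a]) b) (p.eta s.epoch ^ 2)

/-- Accuracy of the sets in a state, for the function `f`. -/
def Accurate (pb : Problem) (ε : ℝ) (f : D → ℝ) (s : State D) : Prop :=
  match pb with
  | .bo => ∀ xs, (∀ c, f c ≤ f xs) → xs ∈ s.M ∧ ∀ a ∈ s.M, f xs - f a ≤ ε
  | .lse h => (∀ a ∈ s.H, h < f a) ∧ (∀ a ∈ s.L, f a < h) ∧ ∀ a ∈ s.M, |f a - h| ≤ ε / 2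

end Algorithm

/-! ### Random model -/

section Model

variable {D Ω : Type*} [MeasurableSpace Ω]

/-- `f` is a centred Gaussian process with kernel `k`, and the noise variables `z 0, z 1, …` are
i.i.d. `N(0, s2)` and independent of `f`. -/
structure IsModel (P : Measure Ω) (k : D → D → ℝ) (s2 : ℝ) (f : D → Ω → ℝ) (z : ℕ → Ω → ℝ) :
    Prop where
  measurable_f : ∀ a, Measurable (f a)
  measurable_z : ∀ t, Measurable (z t)
  gaussian_f : IsGaussianProcess f P
  mean_f : ∀ a, ∫ ω, f a ω ∂P = 0
  cov_f : ∀ a b, cov[f a, f b; P] = k a b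
  law_z : ∀ t, Measure.map (z t) P = gaussianReal 0 s2.toNNReal
  indep_z : iIndepFun z P
  indep_f_z : IndepFun (fun ω a => f a ω) (fun ω t => z t ω) P

/-- The noisy observation at time step `t + 1`. -/
def obs (f : D → Ω → ℝ) (z : ℕ → Ω → ℝ) (x : ℕ → Ω → D) (t : ℕ) (ω : Ω) : ℝ :=
  f (x t ω) ω + z t ω

/-- The state after `t` time steps, at the outcome `ω`. -/
def runState [Fintype D] (pb : Problem) (k : D → D → ℝ) (p : Params) (f : D → Ω → ℝ)
    (z : ℕ → Ω → ℝ) (x : ℕ → Ω → D) (ω : Ω) (t : ℕ) : State D :=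
  state pb k p (fun s => x s ω) (fun s => obs f z x s ω) t

/-- `x 0, x 1, …` are the points queried in a run of the algorithm: each maximizes the current
acquisition function, and ties are broken by any rule that uses only the past observations. -/
structure IsRun [Fintype D] (pb : Problem) (k : D → D → ℝ) (p : Params) (f : D → Ω → ℝ)
    (z : ℕ → Ω → ℝ) (x : ℕ → Ω → D) : Prop where
  greedy : ∀ t ω a,
    acq k p (fun i : Fin t => x i ω) (runState pb k p f z x ω t) a
      ≤ acq k p (fun i : Fin t => x i ω) (runState pb k p f z x ω t) (x t ω)
  nonanticipating : ∀ t d,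
    MeasurableSet[⨆ s : Fin t, MeasurableSpace.comap (obs f z x s) inferInstance] {ω | x t ω = d}

end Model

/-! ### The threshold on the time horizon -/

/-- `β_T = 2 log (|D| T² π² / (6 δ))`, where `n = |D|`. -/
def betaT (n : ℕ) (δ : ℝ) (T : ℕ) : ℝ :=
  2 * Real.log (n * (T : ℝ) ^ 2 * Real.pi ^ 2 / (6 * δ))

/-- `C₁ = 1 / log (1 + σ⁻²)`. -/
def C1 (σ : ℝ) : ℝ := 1 / Real.log (1 + (σ ^ 2)⁻¹)

/-- `log (16 (1 + δ̄)² |D| β_T / (δ̄² ε²))`. -/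
def logFactor (n : ℕ) (dbar ε δ : ℝ) (T : ℕ) : ℝ :=
  Real.log (16 * (1 + dbar) ^ 2 * n * betaT n δ T / (dbar ^ 2 * ε ^ 2))

/-- The right-hand side of the condition on `T`. -/
def threshold {D : Type*} [Fintype D] (k : D → D → ℝ) (σ dbar ε δ : ℝ) (T : ℕ) : ℝ :=
  (C1 σ * gamma k (σ ^ 2) T * betaT (Fintype.card D) δ T * (96 * (1 + dbar) ^ 2 / ε ^ 2)
      + 2 * (⌈Real.logb 2 (8 * (1 + dbar) / ε)⌉ : ℝ))
    * logFactor (Fintype.card D) dbar ε δ T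

/-- The rate `C₁ γ_T β_T / ε² + 1`. -/
def rate {D : Type*} [Fintype D] (k : D → D → ℝ) (σ ε δ : ℝ) (T : ℕ) : ℝ :=
  C1 σ * gamma k (σ ^ 2) T * betaT (Fintype.card D) δ T / ε ^ 2 + 1

end TruVaR

end

/-! Accuracy is not lost once reached: the sets `M_t` decrease, and with probability at least 1 - δ
the confidence intervals of all times hold simultaneously. So it suffices to choose β for the least
horizon `T` that satisfies the condition; if there is none, the claim is empty.

For this `T` put b = β_T and E = 16(1+δ̄)²/ε², and take the sequence `betaLadder` with B = κb, 1 ≤ κ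
≤ 2. Since η² = 4^{-(e-1)} in epoch e, all epochs with 4^{e-1} < E share the ratio β/η² = BE. Their
stopping conditions therefore coincide with that of epoch 1, which says 16Bσ_t² ≤ ε² on `M_t`. Epoch
1 does all the work and these epochs are skipped at once, so only one epoch length has to be
compared with the threshold. Later β grow like 4^{e-1}/(4E): slowly enough that the intervals stay
short whatever epoch the run has reached (`width_le_of_betaLadder`), fast enough that the failure
probabilities over infinite time are summable.

Length of epoch 1. Uncertainty sampling gives m points after which every posterior variance is at
most 2C₁γ_m/m (`exists_design`). By submodularity some point of this design, hence also the greedy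
query, removes at least the fraction 1/m of the total excess of βσ² over η². The excess thus decays
like e^{-n/m} (`excess_le_geometric`), while a single point violating the stopping condition
contributes more than ((1+δ̄)²-1)η² (`epoch_ends`). With m about 2BE·C₁γ_T, about m·log(|D|BE/δ̄²)
steps are enough, and the condition on `T` leaves room for them.

Confidence. At fixed query points the error of the posterior mean is Gaussian, with variance the
posterior variance, and independent of the observations. As the choice of the points depends only on
the observations, conditioning on that choice changes nothing (`IsModel.measure_not_confident_le`).
The union bound charges the first T-1 steps to B and every later epoch, whose length has a crude
deterministic bound, to its own larger β (`measure_not_confident_run_le`). The factor κ > 1 pays for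
these later epochs.

If Eb ≤ (1+δ̄)², the prior intervals are already short enough and another sequence is used. The
comparison of the threshold with the rate only needs that both the ceiling and the logarithmic
factor are linear in the logarithmic terms. -/

namespace TruVaR

/-! ### Posterior variance as the least mean squared error of a linear predictor. -/

section PosteriorVariance

variable {D : Type*} {k : D → D → ℝ} {s2 : ℝ}

/-- Mean squared error of the linear predictor of `f a` with weights `w`. -/
noncomputable def linMse (k : D → D → ℝ) (s2 : ℝ) {t : ℕ} (X : Fin t → D) (a : D)
    (w : Fin t → ℝ) : ℝ :=
  k a a - 2 * ∑ i, w i * k (X i) a + ∑ i, w i * ∑ j, w j * k (X i) (X j) + s2 * ∑ i, w i * w i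

/-- The weights of the posterior mean. -/
noncomputable def optWeights (k : D → D → ℝ) (s2 : ℝ) {t : ℕ} (X : Fin t → D) (a : D) :
    Fin t → ℝ :=
  (gram k X + s2 • (1 : Matrix (Fin t) (Fin t) ℝ))⁻¹ *ᵥ kvec k X a

theorem gram_posSemidef (hk : (Matrix.of k).PosSemidef) {t : ℕ} (X : Fin t → D) :
    (gram k X).PosSemidef :=
  hk.submatrix X

theorem noisyGram_posDef (hk : (Matrix.of k).PosSemidef) (hs : 0 < s2) {t : ℕ} (X : Fin t → D) :
    (gram k X + s2 • (1 : Matrix (Fin t) (Fin t) ℝ)).PosDef :=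
  Matrix.PosDef.posSemidef_add (gram_posSemidef hk X) (Matrix.PosDef.one.smul hs)

theorem kernel_symm (hk : (Matrix.of k).PosSemidef) (a b : D) : k a b = k b a := by
  simpa using hk.isHermitian.apply b a

theorem noisyGram_mulVec_optWeights (hk : (Matrix.of k).PosSemidef) (hs : 0 < s2) {t : ℕ}
    (X : Fin t → D) (a : D) :
    (gram k X + s2 • (1 : Matrix (Fin t) (Fin t) ℝ)) *ᵥ optWeights k s2 X a = kvec k X a := by
  rw [optWeights, Matrix.mulVec_mulVec, Matrix.mul_nonsing_inv, Matrix.one_mulVec]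
  exact (Matrix.isUnit_iff_isUnit_det _).1 (noisyGram_posDef hk hs X).isUnit

theorem optWeights_normal (hk : (Matrix.of k).PosSemidef) (hs : 0 < s2) {t : ℕ}
    (X : Fin t → D) (a : D) (i : Fin t) :
    ∑ j, optWeights k s2 X a j * k (X i) (X j) + s2 * optWeights k s2 X a i = k (X i) a := by
  have h := congrFun (noisyGram_mulVec_optWeights hk hs X a) i
  rw [Matrix.add_mulVec, Matrix.smul_mulVec, Matrix.one_mulVec] at h
  simp only [Pi.add_apply, Pi.smul_apply, smul_eq_mul, Matrix.mulVec, dotProduct, gram,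
    Matrix.of_apply, kvec] at h
  rw [← h]
  simp only [mul_comm]

theorem postVar_eq_sub (k : D → D → ℝ) (s2 : ℝ) {t : ℕ} (X : Fin t → D) (a : D) :
    postVar k s2 X a = k a a - ∑ i, optWeights k s2 X a i * k (X i) a := by
  simp only [postVar, optWeights, dotProduct, kvec, mul_comm]

theorem postMean_eq_sum (hk : (Matrix.of k).PosSemidef) {t : ℕ} (X : Fin t → D)
    (y : Fin t → ℝ) (a : D) :
    postMean k s2 X y a = ∑ i, optWeights k s2 X a i * y i := by
  have hsymm : ((gram k X + s2 • (1 : Matrix (Fin t) (Fin t) ℝ))⁻¹)ᵀ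
      = (gram k X + s2 • (1 : Matrix (Fin t) (Fin t) ℝ))⁻¹ := by
    rw [Matrix.transpose_nonsing_inv]
    congr 1
    ext i j
    simp [gram, kernel_symm hk (X i) (X j), Matrix.one_apply, eq_comm]
  rw [postMean, Matrix.dotProduct_mulVec, ← Matrix.mulVec_transpose, hsymm]
  rfl

/-- Completing the square: the normal equations remove the terms linear in the deviation from the
optimal weights. -/
theorem linMse_eq (hk : (Matrix.of k).PosSemidef) (hs : 0 < s2) {t : ℕ} (X : Fin t → D) (a : D)
    (w : Fin t → ℝ) :
    linMse k s2 X a w = postVar k s2 X a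
      + (∑ i, (w i - optWeights k s2 X a i) * ∑ j, (w j - optWeights k s2 X a j) * k (X i) (X j)
        + s2 * ∑ i, (w i - optWeights k s2 X a i) * (w i - optWeights k s2 X a i)) := by
  set v := optWeights k s2 X a
  have hn := optWeights_normal hk hs X a
  have h1 : ∑ i, w i * k (X i) a
      = ∑ i, w i * ∑ j, v j * k (X i) (X j) + s2 * ∑ i, w i * v i := by
    rw [Finset.mul_sum, ← Finset.sum_add_distrib]
    exact Finset.sum_congr rfl fun i _ => by rw [← hn i]; ring
  have h2 : ∑ i, v i * k (X i) a
      = ∑ i, v i * ∑ j, v j * k (X i) (X j) + s2 * ∑ i, v i * v i := by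
    rw [Finset.mul_sum, ← Finset.sum_add_distrib]
    exact Finset.sum_congr rfl fun i _ => by rw [← hn i]; ring
  have h3 : ∑ i, v i * ∑ j, w j * k (X i) (X j) = ∑ i, w i * ∑ j, v j * k (X i) (X j) := by
    simp only [Finset.mul_sum]
    rw [Finset.sum_comm]
    exact Finset.sum_congr rfl fun i _ => Finset.sum_congr rfl fun j _ => by
      rw [kernel_symm hk (X i) (X j)]; ring
  rw [linMse, postVar_eq_sub, h1, h2]
  simp only [sub_mul, mul_sub, Finset.sum_sub_distrib, h3]
  simp only [mul_comm (v _) (w _)]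
  ring

theorem sum_mul_kernel_nonneg (hk : (Matrix.of k).PosSemidef) {t : ℕ} (X : Fin t → D)
    (w : Fin t → ℝ) : 0 ≤ ∑ i, w i * ∑ j, w j * k (X i) (X j) := by
  have := (gram_posSemidef hk X).dotProduct_mulVec_nonneg w
  simpa [dotProduct, Matrix.mulVec, gram, mul_comm] using this

theorem postVar_le_linMse (hk : (Matrix.of k).PosSemidef) (hs : 0 < s2) {t : ℕ} (X : Fin t → D)
    (a : D) (w : Fin t → ℝ) : postVar k s2 X a ≤ linMse k s2 X a w := by
  rw [linMse_eq hk hs]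
  have h1 := sum_mul_kernel_nonneg hk X (fun i => w i - optWeights k s2 X a i)
  have h2 : 0 ≤ ∑ i, (w i - optWeights k s2 X a i) * (w i - optWeights k s2 X a i) :=
    Finset.sum_nonneg fun i _ => mul_self_nonneg _
  have := mul_nonneg hs.le h2
  linarith

theorem linMse_optWeights (hk : (Matrix.of k).PosSemidef) (hs : 0 < s2) {t : ℕ} (X : Fin t → D)
    (a : D) : linMse k s2 X a (optWeights k s2 X a) = postVar k s2 X a := by
  simp [linMse_eq hk hs]

/-- More data cannot hurt: a predictor based on `S` is one based on `X` with zero weight on the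
unused points. -/
theorem postVar_le_of_injective (hk : (Matrix.of k).PosSemidef) (hs : 0 < s2) {t m : ℕ}
    (X : Fin t → D) (S : Fin m → D) (g : Fin m → Fin t) (hg : g.Injective)
    (hS : ∀ i, X (g i) = S i) (a : D) : postVar k s2 X a ≤ postVar k s2 S a := by
  set w := optWeights k s2 S a
  have key : ∀ h : Fin t → ℝ, ∑ j, Function.extend g w 0 j * h j = ∑ i, w i * h (g i) := by
    intro h
    symm
    apply Fintype.sum_of_injective g hg
    · intro j hj
      rw [Function.extend_apply' _ _ _ (by simpa using hj)]
      simp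
    · intro i
      rw [hg.extend_apply]
  refine (postVar_le_linMse hk hs X a (Function.extend g w 0)).trans_eq ?_
  rw [← linMse_optWeights hk hs S a]
  simp only [linMse, key, hg.extend_apply, hS]
  rfl

theorem postVar_le_one (hk : (Matrix.of k).PosSemidef) (hs : 0 < s2) (h1 : ∀ a, k a a = 1)
    {t : ℕ} (X : Fin t → D) (a : D) : postVar k s2 X a ≤ 1 := by
  simpa [linMse, h1] using postVar_le_linMse hk hs X a 0

theorem postVar_pos (hk : (Matrix.of k).PosSemidef) (hs : 0 < s2) (h1 : ∀ a, k a a = 1)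
    {t : ℕ} (X : Fin t → D) (a : D) : 0 < postVar k s2 X a := by
  rw [← linMse_optWeights hk hs X a]
  set w := optWeights k s2 X a
  -- With weight -1 at `a`, the quadratic form is the noiseless part of the error. The noise part is
  -- positive unless `w = 0`, and then the error is `k a a = 1`.
  have h := sum_mul_kernel_nonneg hk (Fin.cons a X : Fin (t + 1) → D) (Fin.cons (-1) w)
  simp only [Fin.sum_univ_succ, Fin.cons_zero, Fin.cons_succ] at h
  have e : ∑ i, w i * (-1 * k (X i) a + ∑ j, w j * k (X i) (X j))
      = -∑ i, w i * k (X i) a + ∑ i, w i * ∑ j, w j * k (X i) (X j) := by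
    rw [← Finset.sum_neg_distrib, ← Finset.sum_add_distrib]
    exact Finset.sum_congr rfl fun i _ => by ring
  rw [e] at h
  simp only [kernel_symm hk a] at h
  unfold linMse
  by_cases hw : w = 0
  · simp [hw, h1]
  · have hpos : 0 < ∑ i, w i * w i := by
      obtain ⟨i, hi⟩ := Function.ne_iff.1 hw
      exact Finset.sum_pos' (fun i _ => mul_self_nonneg _)
        ⟨i, Finset.mem_univ _, mul_self_pos.2 hi⟩
    have := mul_pos hs hpos
    linarith

/-- The plain average of `m` noisy observations of `f a` already has this error. -/
theorem postVar_const_le (hk : (Matrix.of k).PosSemidef) (hs : 0 < s2) (h1 : ∀ a, k a a = 1)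
    {m : ℕ} (hm : 0 < m) (a : D) : postVar k s2 (fun _ : Fin m => a) a ≤ s2 / m := by
  refine (postVar_le_linMse hk hs _ a (fun _ => 1 / m)).trans_eq ?_
  have : (m : ℝ) ≠ 0 := by positivity
  simp only [linMse, h1, Finset.sum_const, Finset.card_univ, Fintype.card_fin, nsmul_eq_mul]
  field_simp
  ring

theorem postVar_append_le_left (hk : (Matrix.of k).PosSemidef) (hs : 0 < s2) {t m : ℕ}
    (X : Fin t → D) (S : Fin m → D) (a : D) :
    postVar k s2 (Fin.append X S) a ≤ postVar k s2 X a :=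
  postVar_le_of_injective hk hs _ _ (Fin.castAdd m) (Fin.castAdd_injective t m) (by simp) a

theorem postVar_append_le_right (hk : (Matrix.of k).PosSemidef) (hs : 0 < s2) {t m : ℕ}
    (X : Fin t → D) (S : Fin m → D) (a : D) :
    postVar k s2 (Fin.append X S) a ≤ postVar k s2 S a :=
  postVar_le_of_injective hk hs _ _ (Fin.natAdd t) (Fin.natAdd_injective m t) (by simp) a

end PosteriorVariance

/-! ### Information gain and designs with small posterior variance. -/

section InformationGain

variable {D : Type*} {k : D → D → ℝ} {s2 : ℝ}

/-- Twice the mutual information `½ log det (I + σ⁻² K)` of the points `X`. -/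
noncomputable def logDet (k : D → D → ℝ) (s2 : ℝ) {t : ℕ} (X : Fin t → D) : ℝ :=
  Real.log (1 + s2⁻¹ • gram k X : Matrix (Fin t) (Fin t) ℝ).det

theorem infoMatrix_posDef (hk : (Matrix.of k).PosSemidef) (hs : 0 < s2) {t : ℕ} (X : Fin t → D) :
    (1 + s2⁻¹ • gram k X : Matrix (Fin t) (Fin t) ℝ).PosDef :=
  Matrix.PosDef.one.add_posSemidef ((gram_posSemidef hk X).smul (inv_nonneg.2 hs.le))

theorem infoMatrix_eq (k : D → D → ℝ) (hs : 0 < s2) {t : ℕ} (X : Fin t → D) :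
    (1 + s2⁻¹ • gram k X : Matrix (Fin t) (Fin t) ℝ) = s2⁻¹ • (gram k X + s2 • 1) := by
  rw [smul_add, smul_smul, inv_mul_cancel₀ hs.ne', one_smul, add_comm]

/-- The Schur complement of the old block in the enlarged noisy Gram matrix is `s2` plus the
posterior variance of the new point. -/
theorem det_infoMatrix_append (hk : (Matrix.of k).PosSemidef) (hs : 0 < s2) {t : ℕ}
    (X : Fin t → D) (a : D) :
    (1 + s2⁻¹ • gram k (Fin.append X ![a]) : Matrix (Fin (t + 1)) (Fin (t + 1)) ℝ).det
      = (1 + s2⁻¹ • gram k X : Matrix (Fin t) (Fin t) ℝ).det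
        * (1 + s2⁻¹ * postVar k s2 X a) := by
  have hu : IsUnit (gram k X + s2 • (1 : Matrix (Fin t) (Fin t) ℝ)) :=
    (noisyGram_posDef hk hs X).isUnit
  have hdet : (gram k (Fin.append X ![a]) + s2 • (1 : Matrix (Fin (t + 1)) (Fin (t + 1)) ℝ)).det
      = (gram k X + s2 • (1 : Matrix (Fin t) (Fin t) ℝ)).det * (s2 + postVar k s2 X a) := by
    have hblock : (gram k (Fin.append X ![a])
          + s2 • (1 : Matrix (Fin (t + 1)) (Fin (t + 1)) ℝ)).submatrix finSumFinEquiv finSumFinEquiv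
        = Matrix.fromBlocks (gram k X + s2 • (1 : Matrix (Fin t) (Fin t) ℝ))
            (Matrix.replicateCol (Fin 1) (kvec k X a)) (Matrix.replicateRow (Fin 1) (kvec k X a))
            (Matrix.of fun _ _ => k a a + s2) := by
      ext i j
      rcases i with i | i <;> rcases j with j | j
      · simp [gram, Matrix.one_apply]
      · have h : Fin.castAdd 1 i ≠ Fin.natAdd t j := fun h => by
          have := congrArg Fin.val h
          simp at this
          omega
        simp [gram, kvec, h]
      · have h : Fin.natAdd t i ≠ Fin.castAdd 1 j := fun h => by
          have := congrArg Fin.val h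
          simp at this
          omega
        simp [gram, kvec, kernel_symm hk a, h]
      · simp [gram, Subsingleton.elim i j]
    rw [← Matrix.det_submatrix_equiv_self finSumFinEquiv, hblock]
    have := hu.invertible
    rw [Matrix.det_fromBlocks₁₁, Matrix.invOf_eq_nonsing_inv]
    congr 1
    rw [Matrix.det_unique]
    simp only [postVar, Matrix.sub_apply, Matrix.of_apply, Matrix.mul_assoc]
    simp only [Matrix.mul_apply, Matrix.mulVec, dotProduct, Matrix.replicateCol_apply,
      Matrix.replicateRow_apply]
    ring
  rw [infoMatrix_eq k hs, infoMatrix_eq k hs, Matrix.det_smul, Matrix.det_smul, hdet]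
  simp only [Fintype.card_fin, pow_succ]
  field_simp

theorem logDet_append (hk : (Matrix.of k).PosSemidef) (hs : 0 < s2) (h1 : ∀ a, k a a = 1) {t : ℕ}
    (X : Fin t → D) (a : D) :
    logDet k s2 (Fin.append X ![a]) = logDet k s2 X + Real.log (1 + s2⁻¹ * postVar k s2 X a) := by
  have hp := mul_pos (inv_pos.2 hs) (postVar_pos hk hs h1 X a)
  rw [logDet, det_infoMatrix_append hk hs, Real.log_mul, logDet]
  · exact (infoMatrix_posDef hk hs X).det_pos.ne'
  · linarith

theorem half_logDet_le_gamma [Finite D] (k : D → D → ℝ) (s2 : ℝ) {t : ℕ} (X : Fin t → D) :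
    1 / 2 * logDet k s2 X ≤ gamma k s2 t :=
  le_ciSup (f := fun X : Fin t → D =>
    (1 / 2) * Real.log (1 + s2⁻¹ • gram k X : Matrix (Fin t) (Fin t) ℝ).det)
    (Set.finite_range _).bddAbove X

theorem gamma_mono [Finite D] [Nonempty D] (hk : (Matrix.of k).PosSemidef) (hs : 0 < s2)
    (h1 : ∀ a, k a a = 1) : Monotone (gamma k s2) := by
  refine monotone_nat_of_le_succ fun t => ciSup_le fun X => ?_
  obtain ⟨a⟩ := ‹Nonempty D›
  have hp := mul_pos (inv_pos.2 hs) (postVar_pos hk hs h1 X a)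
  have h := half_logDet_le_gamma k s2 (Fin.append X ![a])
  rw [logDet_append hk hs h1] at h
  have : 0 ≤ Real.log (1 + s2⁻¹ * postVar k s2 X a) := Real.log_nonneg (by linarith)
  have e : logDet k s2 X = Real.log (1 + s2⁻¹ • gram k X : Matrix (Fin t) (Fin t) ℝ).det := rfl
  rw [← e]
  linarith

/-- Sampling the most uncertain point `m` times. -/
theorem exists_uncertainty_sampling [Finite D] [Nonempty D] (hk : (Matrix.of k).PosSemidef)
    (hs : 0 < s2) (h1 : ∀ a, k a a = 1) (m : ℕ) :
    ∃ X : Fin m → D, ∀ a, m * Real.log (1 + s2⁻¹ * postVar k s2 X a) ≤ logDet k s2 X := by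
  induction m with
  | zero => exact ⟨Fin.elim0, fun a => by simp [logDet]⟩
  | succ m ih =>
    obtain ⟨X, hX⟩ := ih
    -- Variances only decrease, so the gain at the current maximizer `c` dominates the gain at any
    -- point afterwards; each of the gains summed so far dominates the final one.
    obtain ⟨c, hc⟩ := Finite.exists_max (postVar k s2 X)
    refine ⟨Fin.append X ![c], fun a => ?_⟩
    rw [logDet_append hk hs h1]
    have hpos := mul_pos (inv_pos.2 hs) (postVar_pos hk hs h1 (Fin.append X ![c]) a)
    have hle : Real.log (1 + s2⁻¹ * postVar k s2 (Fin.append X ![c]) a)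
        ≤ Real.log (1 + s2⁻¹ * postVar k s2 X c) := by
      apply Real.log_le_log (by linarith)
      have := (postVar_append_le_left hk hs X ![c] a).trans (hc a)
      have := mul_le_mul_of_nonneg_left this (inv_nonneg.2 hs.le)
      linarith
    have hm : (0 : ℝ) ≤ m := by positivity
    have := hX c
    push_cast
    nlinarith

/-- Bernoulli's inequality, i.e. concavity of the logarithm. It turns information gain into variance
and is the source of the constant C₁. -/
theorem mul_log_le_log (hs : 0 < s2) {p : ℝ} (h0 : 0 ≤ p) (h1 : p ≤ 1) :
    p * Real.log (1 + s2⁻¹) ≤ Real.log (1 + s2⁻¹ * p) := by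
  have hi := inv_pos.2 hs
  rw [← Real.log_rpow (by linarith)]
  apply Real.log_le_log (by positivity)
  rw [mul_comm s2⁻¹ p]
  exact rpow_one_add_le_one_add_mul_self (by linarith) h0 h1

/-- A design of `m` points that reduces all posterior variances to `2 C₁ γ_m / m`. -/
theorem exists_design [Finite D] [Nonempty D] {σ : ℝ} (hk : (Matrix.of k).PosSemidef)
    (hσ : 0 < σ) (h1 : ∀ a, k a a = 1) (m : ℕ) :
    ∃ X : Fin m → D, ∀ a,
      m * postVar k (σ ^ 2) X a ≤ 2 * (C1 σ * gamma k (σ ^ 2) m) := by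
  have hs : 0 < σ ^ 2 := by positivity
  obtain ⟨X, hX⟩ := exists_uncertainty_sampling hk hs h1 m
  refine ⟨X, fun a => ?_⟩
  have hl : 0 < Real.log (1 + (σ ^ 2)⁻¹) := Real.log_pos (by have := inv_pos.2 hs; linarith)
  have h2 := mul_log_le_log hs (postVar_pos hk hs h1 X a).le (postVar_le_one hk hs h1 X a)
  have h3 := half_logDet_le_gamma k (σ ^ 2) X
  have h4 := mul_le_mul_of_nonneg_left h2 (Nat.cast_nonneg (α := ℝ) m)
  rw [C1, one_div, inv_mul_eq_div, ← mul_div_assoc, le_div_iff₀ hl]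
  have := hX a
  nlinarith

/-- Repeating one point makes the Gram matrix of rank one, with an explicit determinant. This is the
only lower bound on γ that is needed. -/
theorem half_log_le_gamma [Finite D] [Nonempty D] (h1 : ∀ a, k a a = 1) (t : ℕ) :
    1 / 2 * Real.log (1 + t / s2) ≤ gamma k s2 t := by
  obtain ⟨a⟩ := ‹Nonempty D›
  refine le_of_eq_of_le ?_ (half_logDet_le_gamma k s2 (fun _ : Fin t => a))
  have : (s2⁻¹ • gram k fun _ : Fin t => a)
      = Matrix.replicateCol Unit (fun _ : Fin t => s2⁻¹)
        * Matrix.replicateRow Unit (fun _ : Fin t => (1 : ℝ)) := by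
    ext i j
    simp [gram, h1, Matrix.mul_apply]
  rw [logDet, this, Matrix.det_one_add_replicateCol_mul_replicateRow]
  simp [dotProduct, div_eq_mul_inv]

end InformationGain

/-! ### Submodularity and the gain of one greedy step. -/

section Greedy

variable {D : Type*} {k : D → D → ℝ} {s2 : ℝ}

theorem varReduction_congr {t m n : ℕ} (h : m = n) (X : Fin t → D) (a : D) (S : Fin m → D)
    (R : Fin n → D) (hR : ∀ i, R (Fin.cast h i) = S i) :
    varReduction k s2 X a R = varReduction k s2 X a S := by
  subst h
  have : R = S := funext hR
  rw [this]

theorem varReduction_elim0 {t : ℕ} (X : Fin t → D) (a : D) :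
    varReduction k s2 X a Fin.elim0 = 0 := by
  rw [varReduction, Fin.append_elim0, sub_eq_zero]
  rfl

/-- Subadditivity, from diminishing returns compared with the empty collection; the points of `S`
are peeled off from the end. -/
theorem varReduction_le_sum (hsub : SubmodularVarReduction k s2) {t m : ℕ} (X : Fin t → D) (a : D)
    (S : Fin m → D) : varReduction k s2 X a S ≤ ∑ i, varReduction k s2 X a ![S i] := by
  induction m with
  | zero =>
    have : S = Fin.elim0 := funext fun i => i.elim0
    rw [this, varReduction_elim0]
    simp
  | succ m ih =>
    have h := hsub t 0 m X a Fin.elim0 (Fin.init S) (S (Fin.last m))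
    have e1 := varReduction_congr (k := k) (s2 := s2) (m := m) (n := 0 + m) (by omega) X a
      (Fin.init S) (Fin.append Fin.elim0 (Fin.init S)) (fun i => by
        rw [Fin.elim0_append]
        rfl)
    have e2 := varReduction_congr (k := k) (s2 := s2) (m := 1) (n := 0 + 1) (by omega) X a
      ![S (Fin.last m)] (Fin.append Fin.elim0 ![S (Fin.last m)]) (fun i => by
        rw [Fin.elim0_append]
        rfl)
    have e3 := varReduction_congr (k := k) (s2 := s2) (m := m + 1) (n := 0 + m + 1) (by omega) X a
      S (Fin.append (Fin.append Fin.elim0 (Fin.init S)) ![S (Fin.last m)]) (fun i => by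
        rw [Fin.append_right_eq_snoc, Fin.elim0_append]
        refine Fin.lastCases ?_ (fun i => ?_) i
        · rw [show Fin.cast (by omega : m + 1 = 0 + m + 1) (Fin.last m) = Fin.last (0 + m) from
            Fin.ext (by simp)]
          simp
        · rw [show Fin.cast (by omega : m + 1 = 0 + m + 1) i.castSucc
            = Fin.castSucc (Fin.cast (by omega : m = 0 + m) i) from Fin.ext (by simp)]
          simp [Fin.init])
    rw [e1, e2, e3, varReduction_elim0] at h
    rw [Fin.sum_univ_castSucc]
    have := ih (Fin.init S)
    simp only [Fin.init] at this h ⊢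
    linarith

/-- Truncation keeps subadditivity: above the level `h`, the truncated reduction is the minimum of
`b * (v - v')` and the constant `b * v - h`. Either one summand reaches that constant by itself, or
no summand is truncated. -/
theorem max_sub_max_le_sum {m : ℕ} {b h v v' : ℝ} (hb : 0 ≤ b) (u : Fin m → ℝ)
    (hu : ∀ i, u i ≤ v) (hv : v - v' ≤ ∑ i, (v - u i)) :
    max (b * v) h - max (b * v') h ≤ ∑ i, (max (b * v) h - max (b * u i) h) := by
  have hmono : ∀ i, b * u i ≤ b * v := fun i => mul_le_mul_of_nonneg_left (hu i) hb
  have hnn : ∀ i, 0 ≤ max (b * v) h - max (b * u i) h := fun i =>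
    sub_nonneg.2 (max_le_max_right h (hmono i))
  have hsum := Finset.sum_nonneg fun i (_ : i ∈ Finset.univ) => hnn i
  rcases le_total (b * v) h with hvh | hvh
  · rw [max_eq_right hvh] at hsum ⊢
    have := le_max_right (b * v') h
    linarith
  by_cases hex : ∃ i, b * u i ≤ h
  · obtain ⟨i, hi⟩ := hex
    have h1 := Finset.single_le_sum (fun j _ => hnn j) (Finset.mem_univ i)
    rw [max_eq_right hi] at h1
    have := le_max_right (b * v') h
    linarith
  · push Not at hex
    have e : ∀ i, max (b * v) h - max (b * u i) h = b * (v - u i) := fun i => by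
      rw [max_eq_left hvh, max_eq_left (hex i).le, mul_sub]
    simp only [e, ← Finset.mul_sum]
    have := mul_le_mul_of_nonneg_left hv hb
    have := le_max_left (b * v') h
    rw [max_eq_left hvh]
    linarith

/-- Total excess over `h` of the scaled posterior variances `b σ²` on `M`. -/
noncomputable def excess (k : D → D → ℝ) (s2 b h : ℝ) {t : ℕ} (X : Fin t → D) (M : Finset D) : ℝ :=
  ∑ a ∈ M, (max (b * postVar k s2 X a) h - h)

theorem excess_nonneg (b h : ℝ) {t : ℕ} (X : Fin t → D) (M : Finset D) :
    0 ≤ excess k s2 b h X M :=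
  Finset.sum_nonneg fun _ _ => sub_nonneg.2 (le_max_right _ _)

theorem excess_mono (b h : ℝ) {t : ℕ} (X : Fin t → D) {M N : Finset D} (hMN : M ⊆ N) :
    excess k s2 b h X M ≤ excess k s2 b h X N :=
  Finset.sum_le_sum_of_subset_of_nonneg hMN fun _ _ _ => sub_nonneg.2 (le_max_right _ _)

theorem acq_eq_excess_sub (p : Params) {t : ℕ} (X : Fin t → D) (s : State D) (a : D) :
    acq k p X s a = excess k p.s2 (p.beta s.epoch) (p.eta s.epoch ^ 2) X s.M
      - excess k p.s2 (p.beta s.epoch) (p.eta s.epoch ^ 2) (Fin.append X ![a]) s.M := by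
  simp only [acq, excess, Finset.sum_sub_distrib]
  ring

/-- If a design `S` brings the scaled variances below `h`, some point of `S` removes at least the
average share of the excess. -/
theorem excess_le_sum_gain (hk : (Matrix.of k).PosSemidef) (hs : 0 < s2)
    (hsub : SubmodularVarReduction k s2) {b h : ℝ} (hb : 0 ≤ b) {t m : ℕ} (X : Fin t → D)
    (S : Fin m → D) (hS : ∀ a, b * postVar k s2 S a ≤ h) (M : Finset D) :
    excess k s2 b h X M
      ≤ ∑ i, (excess k s2 b h X M - excess k s2 b h (Fin.append X ![S i]) M) := by
  simp only [excess, ← Finset.sum_sub_distrib]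
  rw [Finset.sum_comm]
  refine Finset.sum_le_sum fun a _ => ?_
  have hle : b * postVar k s2 (Fin.append X S) a ≤ h :=
    (mul_le_mul_of_nonneg_left (postVar_append_le_right hk hs X S a) hb).trans (hS a)
  have := max_sub_max_le_sum (h := h) hb (fun i => postVar k s2 (Fin.append X ![S i]) a)
    (fun i => postVar_append_le_left hk hs X ![S i] a) (varReduction_le_sum hsub X a S)
  rw [max_eq_right hle] at this
  refine this.trans_eq (Finset.sum_congr rfl fun i _ => by ring)

theorem append_singleton_eq (x : ℕ → D) (t : ℕ) :
    Fin.append (fun i : Fin t => x i) ![x t] = fun i : Fin (t + 1) => x i := by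
  rw [Fin.append_right_eq_snoc]
  ext i
  refine Fin.lastCases ?_ (fun i => ?_) i <;> simp

end Greedy

/-! ### Epochs of a run and their length. -/

section Run

variable {D : Type*} {k : D → D → ℝ} {p : Params}

theorem updateSets_M_subset (pb : Problem) {t : ℕ} (X : Fin t → D) (y : Fin t → ℝ) (s : State D) :
    (updateSets pb k p X y s).M ⊆ s.M := by
  cases pb <;> exact Finset.filter_subset _ _

theorem updateSets_epoch (pb : Problem) {t : ℕ} (X : Fin t → D) (y : Fin t → ℝ) (s : State D) :
    (updateSets pb k p X y s).epoch = s.epoch := by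
  cases pb <;> rfl

theorem EpochDone.mono (hk : (Matrix.of k).PosSemidef) (hs : 0 < p.s2) {t m : ℕ} {X : Fin t → D}
    {S : Fin m → D} {M N : Finset D} {i : ℕ} (h : EpochDone k p X M i) (hNM : N ⊆ M) :
    EpochDone k p (Fin.append X S) N i := fun a ha =>
  (mul_le_mul_of_nonneg_left (Real.sqrt_le_sqrt (postVar_append_le_left hk hs X S a))
    (Real.sqrt_nonneg _)).trans (h a (hNM ha))

/-- Assumptions on the parameters under which every epoch ends. -/
structure Params.Regular (p : Params) : Prop where
  s2_pos : 0 < p.s2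
  dbar_pos : 0 < p.dbar
  eta_pos : ∀ i, 0 < p.eta i
  eta_tendsto : Filter.Tendsto p.eta Filter.atTop (nhds 0)
  beta_bdd : ∃ b, 0 < b ∧ ∀ i, b ≤ p.beta i

theorem Params.Regular.beta_pos (hp : p.Regular) (i : ℕ) : 0 < p.beta i := by
  obtain ⟨b, hb, h⟩ := hp.beta_bdd
  exact hb.trans_le (h i)

/-- The `while` loop terminates as long as `M` is nonempty: the targets tend to zero, but posterior
variances are positive and β is bounded below. -/
theorem exists_not_epochDone (hk : (Matrix.of k).PosSemidef) (h1 : ∀ a, k a a = 1)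
    (hp : p.Regular) {t : ℕ} (X : Fin t → D) {M : Finset D} (hM : M.Nonempty) (i : ℕ) :
    ∃ j, i ≤ j ∧ ¬ EpochDone k p X M j := by
  obtain ⟨a, ha⟩ := hM
  obtain ⟨b, hb, hbi⟩ := hp.beta_bdd
  have hv := postVar_pos hk hp.s2_pos h1 X a
  have hpos : 0 < √b * √(postVar k p.s2 X a) :=
    mul_pos (Real.sqrt_pos.2 hb) (Real.sqrt_pos.2 hv)
  have ht : Filter.Tendsto (fun j => (1 + p.dbar) * p.eta j) Filter.atTop (nhds 0) := by
    simpa using hp.eta_tendsto.const_mul (1 + p.dbar)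
  obtain ⟨j, hij, hj⟩ := ((Filter.eventually_ge_atTop i).and (ht.eventually_lt_const hpos)).exists
  refine ⟨j, hij, fun h => ?_⟩
  have h2 := h a ha
  have h3 := mul_le_mul_of_nonneg_right (Real.sqrt_le_sqrt (hbi j))
    (Real.sqrt_nonneg (postVar k p.s2 X a))
  linarith

theorem le_nextEpoch {t : ℕ} (X : Fin t → D) (M : Finset D) (i : ℕ) :
    i ≤ nextEpoch k p X M i := by
  classical
  unfold nextEpoch
  split_ifs with h
  · exact (Nat.find_spec h).1
  · exact le_rfl

theorem not_epochDone_nextEpoch (hk : (Matrix.of k).PosSemidef) (h1 : ∀ a, k a a = 1)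
    (hp : p.Regular) {t : ℕ} (X : Fin t → D) {M : Finset D} (hM : M.Nonempty) (i : ℕ) :
    ¬ EpochDone k p X M (nextEpoch k p X M i) := by
  classical
  have h := exists_not_epochDone hk h1 hp X hM i
  unfold nextEpoch
  rw [dif_pos h]
  exact (Nat.find_spec h).2

theorem epochDone_of_lt_nextEpoch {t : ℕ} (X : Fin t → D) (M : Finset D) {i j : ℕ} (hij : i ≤ j)
    (hj : j < nextEpoch k p X M i) : EpochDone k p X M j := by
  classical
  unfold nextEpoch at hj
  split_ifs at hj with h
  · by_contra hd
    exact Nat.find_min h hj ⟨hij, hd⟩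
  · omega

variable [Fintype D] {pb : Problem} {x : ℕ → D} {y : ℕ → ℝ}

theorem state_succ_M (t : ℕ) :
    (state pb k p x y (t + 1)).M = (updateSets pb k p (fun i : Fin (t + 1) => x i)
      (fun i => y i) (state pb k p x y t)).M := rfl

theorem state_succ_epoch (t : ℕ) :
    (state pb k p x y (t + 1)).epoch = nextEpoch k p (fun i : Fin (t + 1) => x i)
      (state pb k p x y (t + 1)).M (state pb k p x y t).epoch := by
  change nextEpoch k p _ (updateSets pb k p _ _ (state pb k p x y t)).M
    (updateSets pb k p _ _ (state pb k p x y t)).epoch = _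
  rw [updateSets_epoch]
  rfl

theorem state_M_antitone : Antitone fun t => (state pb k p x y t).M :=
  antitone_nat_of_succ_le fun t => by
    rw [state_succ_M]
    exact updateSets_M_subset _ _ _ _

theorem state_epoch_monotone : Monotone fun t => (state pb k p x y t).epoch :=
  monotone_nat_of_le_succ fun t => by
    rw [state_succ_epoch]
    exact le_nextEpoch _ _ _

theorem one_le_state_epoch (t : ℕ) : 1 ≤ (state pb k p x y t).epoch :=
  state_epoch_monotone (Nat.zero_le t)

/-- A stopping condition, once met, persists, because both the set `M` and the variances shrink.
Thus the current epoch number certifies the conditions of all earlier epochs. -/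
theorem epochDone_of_lt_epoch (hk : (Matrix.of k).PosSemidef) (hs : 0 < p.s2) (t : ℕ) {j : ℕ}
    (hj : 1 ≤ j) (hjt : j < (state pb k p x y t).epoch) :
    EpochDone k p (fun i : Fin t => x i) (state pb k p x y t).M j := by
  induction t with
  | zero => exact absurd hjt (by simp only [state]; omega)
  | succ t ih =>
    by_cases h : j < (state pb k p x y t).epoch
    · rw [← append_singleton_eq]
      exact (ih h).mono hk hs (state_M_antitone (Nat.le_succ t))
    · rw [state_succ_epoch] at hjt
      exact epochDone_of_lt_nextEpoch _ _ (not_lt.1 h) hjt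

/-- Time 0 is excluded, since the initial state has not passed through the `while` loop. -/
theorem not_epochDone_epoch (hk : (Matrix.of k).PosSemidef) (h1 : ∀ a, k a a = 1)
    (hp : p.Regular) {t : ℕ} (ht : 1 ≤ t) (hM : (state pb k p x y t).M.Nonempty) :
    ¬ EpochDone k p (fun i : Fin t => x i) (state pb k p x y t).M (state pb k p x y t).epoch := by
  obtain ⟨t, rfl⟩ := Nat.exists_eq_add_of_le' ht
  rw [state_succ_epoch]
  exact not_epochDone_nextEpoch hk h1 hp _ hM _

theorem sqrt_mul_sqrt_le_iff {b v c : ℝ} (hb : 0 ≤ b) (hc : 0 ≤ c) :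
    √b * √v ≤ c ↔ b * v ≤ c ^ 2 := by
  rw [← Real.sqrt_mul hb, Real.sqrt_le_left hc]

/-- The greedy rule shrinks the excess geometrically during an epoch. -/
theorem excess_le_geometric (hk : (Matrix.of k).PosSemidef) (hsub : SubmodularVarReduction k p.s2)
    (hp : p.Regular)
    (hgr : ∀ t a, acq k p (fun i : Fin t => x i) (state pb k p x y t) a
      ≤ acq k p (fun i : Fin t => x i) (state pb k p x y t) (x t))
    {e m : ℕ} (hm : 0 < m) (S : Fin m → D)
    (hS : ∀ a, p.beta e * postVar k p.s2 S a ≤ p.eta e ^ 2) (t n : ℕ)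
    (hte : (state pb k p x y t).epoch = e) (hne : (state pb k p x y (t + n)).epoch = e) :
    excess k p.s2 (p.beta e) (p.eta e ^ 2) (fun i : Fin (t + n) => x i)
        (state pb k p x y (t + n)).M
      ≤ (1 - 1 / m) ^ n * excess k p.s2 (p.beta e) (p.eta e ^ 2) (fun i : Fin t => x i)
        (state pb k p x y t).M := by
  induction n with
  | zero => simp
  | succ n ih =>
    have hn : (state pb k p x y (t + n)).epoch = e := by
      have h1 := state_epoch_monotone (pb := pb) (k := k) (p := p) (x := x) (y := y)
        (Nat.le_add_right t n)
      have h2 := state_epoch_monotone (pb := pb) (k := k) (p := p) (x := x) (y := y)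
        (Nat.le_succ (t + n))
      simp only [Nat.succ_eq_add_one, ← add_assoc] at h1 h2 hne
      omega
    have hm' : (0 : ℝ) < m := by exact_mod_cast hm
    have hm1 : (0 : ℝ) ≤ 1 - 1 / m := by
      rw [sub_nonneg, div_le_one hm']
      exact_mod_cast hm
    -- The gains of the `m` design points add up to at least the whole excess, and the greedy query
    -- gains at least as much as each of them.
    have hsum := excess_le_sum_gain hk hp.s2_pos hsub (hp.beta_pos e).le
      (fun i : Fin (t + n) => x i) S hS (state pb k p x y (t + n)).M
    have hstep : ∀ i, excess k p.s2 (p.beta e) (p.eta e ^ 2) (fun i : Fin (t + n) => x i)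
          (state pb k p x y (t + n)).M
        - excess k p.s2 (p.beta e) (p.eta e ^ 2)
          (Fin.append (fun i : Fin (t + n) => x i) ![S i]) (state pb k p x y (t + n)).M
        ≤ excess k p.s2 (p.beta e) (p.eta e ^ 2) (fun i : Fin (t + n) => x i)
          (state pb k p x y (t + n)).M
        - excess k p.s2 (p.beta e) (p.eta e ^ 2) (fun i : Fin (t + n + 1) => x i)
          (state pb k p x y (t + n)).M := by
      intro i
      have := hgr (t + n) (S i)
      rwa [acq_eq_excess_sub, acq_eq_excess_sub, hn, append_singleton_eq] at this
    have hsum2 := hsum.trans (Finset.sum_le_sum fun i _ => hstep i)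
    rw [Finset.sum_const, Finset.card_univ, Fintype.card_fin, nsmul_eq_mul] at hsum2
    have hshrink := excess_mono (k := k) (s2 := p.s2) (p.beta e) (p.eta e ^ 2)
      (fun i : Fin (t + n + 1) => x i)
      (state_M_antitone (pb := pb) (k := k) (p := p) (x := x) (y := y) (Nat.le_succ (t + n)))
    set A := excess k p.s2 (p.beta e) (p.eta e ^ 2) (fun i : Fin (t + n) => x i)
          (state pb k p x y (t + n)).M
    have hB : excess k p.s2 (p.beta e) (p.eta e ^ 2) (fun i : Fin (t + n + 1) => x i)
        (state pb k p x y (t + n)).M ≤ (1 - 1 / m) * A := by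
      rw [one_sub_mul, one_div, inv_mul_eq_div]
      have : A / m ≤ A - excess k p.s2 (p.beta e) (p.eta e ^ 2) (fun i : Fin (t + n + 1) => x i)
          (state pb k p x y (t + n)).M := by
        rw [div_le_iff₀ hm']
        linarith
      linarith
    refine (hshrink.trans hB).trans ?_
    rw [pow_succ', mul_assoc]
    exact mul_le_mul_of_nonneg_left (ih hn) hm1

/-- Upper bound on the length of an epoch. -/
theorem epoch_ends (hk : (Matrix.of k).PosSemidef) (h1 : ∀ a, k a a = 1)
    (hsub : SubmodularVarReduction k p.s2) (hp : p.Regular)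
    (hgr : ∀ t a, acq k p (fun i : Fin t => x i) (state pb k p x y t) a
      ≤ acq k p (fun i : Fin t => x i) (state pb k p x y t) (x t))
    {e m n : ℕ} (hm : 0 < m) (S : Fin m → D)
    (hS : ∀ a, p.beta e * postVar k p.s2 S a ≤ p.eta e ^ 2)
    (hn : Fintype.card D * p.beta e * Real.exp (-(n / m)) ≤ ((1 + p.dbar) ^ 2 - 1) * p.eta e ^ 2)
    {t t' : ℕ} (ht : e ≤ (state pb k p x y t).epoch) (htn : 1 ≤ t + n) (ht' : t + n ≤ t')
    (hM : (state pb k p x y t').M.Nonempty) : e + 1 ≤ (state pb k p x y t').epoch := by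
  refine le_trans ?_ (state_epoch_monotone ht')
  have hM' : (state pb k p x y (t + n)).M.Nonempty := hM.mono (state_M_antitone ht')
  by_contra hcon
  have hmono := state_epoch_monotone (pb := pb) (k := k) (p := p) (x := x) (y := y)
    (Nat.le_add_right t n)
  simp only at hmono hcon
  have hte : (state pb k p x y t).epoch = e := by omega
  have hne : (state pb k p x y (t + n)).epoch = e := by omega
  have hgeo := excess_le_geometric hk hsub hp hgr hm S hS t n hte hne
  have hnot := not_epochDone_epoch hk h1 hp htn hM'
  rw [hne] at hnot
  simp only [EpochDone] at hnot
  push Not at hnot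
  obtain ⟨a, ha, hlt⟩ := hnot
  have hη := hp.eta_pos e
  have hβ := hp.beta_pos e
  have hd := hp.dbar_pos
  have hlt2 : ((1 + p.dbar) * p.eta e) ^ 2
      < p.beta e * postVar k p.s2 (fun i : Fin (t + n) => x i) a := by
    rw [← not_le, ← sqrt_mul_sqrt_le_iff hβ.le (by positivity)]
    exact not_le.2 hlt
  -- The slack δ̄ is used here: one violating point alone forces an excess bounded away from zero.
  have hlow : ((1 + p.dbar) ^ 2 - 1) * p.eta e ^ 2 < excess k p.s2 (p.beta e) (p.eta e ^ 2)
      (fun i : Fin (t + n) => x i) (state pb k p x y (t + n)).M := by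
    refine lt_of_lt_of_le ?_ (Finset.single_le_sum
      (f := fun a => max (p.beta e * postVar k p.s2 (fun i : Fin (t + n) => x i) a) (p.eta e ^ 2)
        - p.eta e ^ 2) (fun b _ => sub_nonneg.2 (le_max_right _ _)) ha)
    have := le_max_left (p.beta e * postVar k p.s2 (fun i : Fin (t + n) => x i) a) (p.eta e ^ 2)
    nlinarith
  have hup : excess k p.s2 (p.beta e) (p.eta e ^ 2) (fun i : Fin t => x i)
      (state pb k p x y t).M ≤ Fintype.card D * p.beta e := by
    refine (excess_mono _ _ _ (Finset.subset_univ _)).trans ?_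
    refine (Finset.sum_le_card_nsmul _ _ (p.beta e) fun a _ => ?_).trans_eq (by simp)
    have h2 := mul_le_mul_of_nonneg_left (postVar_le_one hk hp.s2_pos h1 (fun i : Fin t => x i) a)
      hβ.le
    rw [sub_le_iff_le_add, max_le_iff]
    constructor <;> nlinarith [sq_nonneg (p.eta e)]
  have hm' : (0 : ℝ) < m := by exact_mod_cast hm
  have hm1 : (0 : ℝ) ≤ 1 - 1 / m := by
    rw [sub_nonneg, div_le_one hm']
    exact_mod_cast hm
  have hexp : (1 - 1 / m : ℝ) ^ n ≤ Real.exp (-(n / m)) := by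
    rw [show -((n : ℝ) / m) = n * (-(1 / m)) by ring, Real.exp_nat_mul]
    exact pow_le_pow_left₀ hm1 (by linarith [Real.add_one_le_exp (-(1 / (m : ℝ)))]) n
  have := mul_le_mul hexp hup (excess_nonneg _ _ _ _) (Real.exp_pos _).le
  linarith

end Run

/-! ### Accuracy from short valid confidence intervals. -/

section Accuracy

variable {D : Type*} [Fintype D] {k : D → D → ℝ} {p : Params} {pb : Problem} {x : ℕ → D}
  {y : ℕ → ℝ} {f : D → ℝ}

/-- All confidence intervals used by a run contain the values of `f`. -/
def Confident (pb : Problem) (k : D → D → ℝ) (p : Params) (x : ℕ → D) (y : ℕ → ℝ) (f : D → ℝ) :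
    Prop :=
  ∀ t, (state pb k p x y t).M.Nonempty → ∀ a,
    |f a - postMean k p.s2 (fun i : Fin (t + 1) => x i) (fun i => y i) a|
      ≤ √(p.beta (state pb k p x y t).epoch)
        * √(postVar k p.s2 (fun i : Fin (t + 1) => x i) a)

theorem mem_state_M_of_isMax (hc : Confident .bo k p x y f) {c : D} (hmax : ∀ a, f a ≤ f c)
    (t : ℕ) : c ∈ (state .bo k p x y t).M := by
  induction t with
  | zero => exact Finset.mem_univ c
  | succ t ih =>
    have hb := hc t ⟨c, ih⟩
    rw [state_succ_M]
    simp only [updateSets, Finset.mem_filter]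
    refine ⟨ih, fun a _ => ?_⟩
    have h1 := (abs_le.1 (hb a)).1
    have h2 := (abs_le.1 (hb c)).2
    have h3 := hmax a
    unfold lcb ucb
    linarith

theorem lt_of_mem_state_H {h : ℝ} (hc : Confident (.lse h) k p x y f) (t : ℕ) :
    ∀ a ∈ (state (.lse h) k p x y t).H, h < f a := by
  induction t with
  | zero => simp [state]
  | succ t ih =>
    intro a ha
    simp only [state, updateSets, Finset.mem_union, Finset.mem_filter] at ha
    rcases ha with ha | ⟨ha, hl⟩
    · exact ih a ha
    · have h1 := (abs_le.1 (hc t ⟨a, ha⟩ a)).1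
      unfold lcb at hl
      linarith

theorem lt_of_mem_state_L {h : ℝ} (hc : Confident (.lse h) k p x y f) (t : ℕ) :
    ∀ a ∈ (state (.lse h) k p x y t).L, f a < h := by
  induction t with
  | zero => simp [state]
  | succ t ih =>
    intro a ha
    simp only [state, updateSets, Finset.mem_union, Finset.mem_filter] at ha
    rcases ha with ha | ⟨ha, hl⟩
    · exact ih a ha
    · have h1 := (abs_le.1 (hc t ⟨a, ha⟩ a)).2
      unfold ucb at hl
      linarith

/-- With half-widths at most ε/4: a maximizer is never discarded, and any survivor has an interval
overlapping its interval, at a cost of two full widths. In level-set estimation the interval of a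
survivor contains `h`, at a cost of one full width. Later sets `M` are smaller, so this step settles
all later times. -/
theorem accurate_of_width_le (hc : Confident pb k p x y f) {ε : ℝ} {t T : ℕ} (htT : t + 1 ≤ T)
    (hw : ∀ a ∈ (state pb k p x y t).M, 4 * (√(p.beta (state pb k p x y t).epoch)
      * √(postVar k p.s2 (fun i : Fin (t + 1) => x i) a)) ≤ ε) :
    Accurate pb ε f (state pb k p x y T) := by
  cases pb with
  | bo =>
    intro c hmax
    refine ⟨mem_state_M_of_isMax hc hmax T, fun a ha => ?_⟩
    have hct := mem_state_M_of_isMax hc hmax t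
    have ha' := state_M_antitone htT ha
    simp only [state_succ_M, updateSets, Finset.mem_filter] at ha'
    obtain ⟨hat, hcmp⟩ := ha'
    have h0 := hcmp c hct
    unfold lcb ucb at h0
    have h1 := (abs_le.1 (hc t ⟨c, hct⟩ a)).1
    have h2 := (abs_le.1 (hc t ⟨c, hct⟩ c)).2
    have h3 := hw a hat
    have h4 := hw c hct
    linarith
  | lse h =>
    refine ⟨lt_of_mem_state_H hc T, lt_of_mem_state_L hc T, fun a ha => ?_⟩
    have ha' := state_M_antitone htT ha
    simp only [state_succ_M, updateSets, Finset.mem_filter] at ha'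
    obtain ⟨hat, hu, hl⟩ := ha'
    unfold ucb at hu
    unfold lcb at hl
    have h1 := abs_le.1 (hc t ⟨a, hat⟩ a)
    have h3 := hw a hat
    rw [abs_le]
    constructor <;> linarith [h1.1, h1.2]

end Accuracy

/-! ### Gaussian tail bound. -/

section GaussianTail

open scoped NNReal ENNReal

/-- Shifting by `s` multiplies the density on the positive half-line by at most the exponential
factor. Keeping the mass of the half-line makes the two-sided bound free of a factor 2. -/
theorem gaussianReal_Ioi_le {v : ℝ≥0} (hv : v ≠ 0) {s : ℝ} (hs : 0 ≤ s) :
    gaussianReal 0 v (Set.Ioi s)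
      ≤ ENNReal.ofReal (Real.exp (-(s ^ 2 / (2 * v)))) * gaussianReal 0 v (Set.Ioi 0) := by
  have hv' : (0 : ℝ) < v := by exact_mod_cast pos_iff_ne_zero.2 hv
  have hshift : gaussianReal 0 v (Set.Ioi s) = gaussianReal (0 - s) v (Set.Ioi 0) := by
    rw [← gaussianReal_map_sub_const s, Measure.map_apply (by fun_prop) measurableSet_Ioi]
    congr 1
    ext x
    simp
  rw [hshift, gaussianReal_apply _ hv, gaussianReal_apply _ hv,
    ← lintegral_const_mul _ (measurable_gaussianPDF _ _)]
  refine setLIntegral_mono ((measurable_gaussianPDF _ _).const_mul _) fun x hx => ?_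
  have hx' : 0 < x := hx
  rw [gaussianPDF, gaussianPDF, ← ENNReal.ofReal_mul (Real.exp_pos _).le]
  apply ENNReal.ofReal_le_ofReal
  rw [gaussianPDFReal, gaussianPDFReal, mul_left_comm, ← Real.exp_add]
  refine mul_le_mul_of_nonneg_left (Real.exp_le_exp.2 ?_) (by positivity)
  rw [← neg_div, ← add_div]
  apply div_le_div_of_nonneg_right _ (by positivity)
  nlinarith

/-- Two-sided Gaussian tail bound. -/
theorem gaussianReal_abs_gt_le {v : ℝ≥0} (hv : v ≠ 0) {s : ℝ} (hs : 0 ≤ s) :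
    gaussianReal 0 v {x | s < |x|} ≤ ENNReal.ofReal (Real.exp (-(s ^ 2 / (2 * v)))) := by
  have hneg : ∀ u : ℝ, gaussianReal 0 v (Set.Iio (-u)) = gaussianReal 0 v (Set.Ioi u) := by
    intro u
    have h : (gaussianReal 0 v).map (fun x => -x) = gaussianReal 0 v := by
      rw [gaussianReal_map_neg, neg_zero]
    conv_lhs => rw [← h]
    rw [Measure.map_apply measurable_neg measurableSet_Iio]
    congr 1
    ext x
    simp
  have hone : 2 * gaussianReal 0 v (Set.Ioi 0) ≤ 1 := by
    have hd : Disjoint (Set.Ioi (0 : ℝ)) (Set.Iio 0) :=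
      Set.disjoint_left.2 fun x h1 h2 => lt_asymm (Set.mem_Ioi.1 h1) (Set.mem_Iio.1 h2)
    rw [two_mul]
    nth_rewrite 2 [← hneg 0]
    rw [neg_zero, ← measure_union hd measurableSet_Iio]
    exact prob_le_one
  have hsub : {x : ℝ | s < |x|} ⊆ Set.Ioi s ∪ Set.Iio (-s) := by
    intro x hx
    rcases lt_abs.1 (show s < |x| from hx) with h | h
    · exact Or.inl h
    · exact Or.inr (lt_neg.1 h)
  calc gaussianReal 0 v {x | s < |x|}
      ≤ gaussianReal 0 v (Set.Ioi s) + gaussianReal 0 v (Set.Iio (-s)) :=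
        (measure_mono hsub).trans (measure_union_le _ _)
    _ = 2 * gaussianReal 0 v (Set.Ioi s) := by rw [hneg, two_mul]
    _ ≤ 2 * (ENNReal.ofReal (Real.exp (-(s ^ 2 / (2 * v)))) * gaussianReal 0 v (Set.Ioi 0)) := by
        gcongr
        exact gaussianReal_Ioi_le hv hs
    _ = ENNReal.ofReal (Real.exp (-(s ^ 2 / (2 * v)))) * (2 * gaussianReal 0 v (Set.Ioi 0)) := by
        ring
    _ ≤ _ := mul_le_of_le_one_right' hone

end GaussianTail

/-! ### Prediction error at fixed query points. -/

section Residual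

set_option linter.unusedSectionVars false

variable {D Ω : Type*} [Fintype D] [MeasurableSpace Ω] {P : Measure Ω} [IsProbabilityMeasure P]
  {k : D → D → ℝ} {s2 : ℝ} {f : D → Ω → ℝ} {z : ℕ → Ω → ℝ}

/-- Observations at fixed points. -/
def fixedObs (f : D → Ω → ℝ) (z : ℕ → Ω → ℝ) {t : ℕ} (X : Fin t → D) (i : Fin t) (ω : Ω) : ℝ :=
  f (X i) ω + z i ω

/-- Error of the posterior mean at fixed points. -/
noncomputable def residual (k : D → D → ℝ) (s2 : ℝ) (f : D → Ω → ℝ) (z : ℕ → Ω → ℝ) {t : ℕ}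
    (X : Fin t → D) (a : D) (ω : Ω) : ℝ :=
  f a ω - ∑ i, optWeights k s2 X a i * fixedObs f z X i ω

theorem IsModel.hasGaussianLaw_pair (h : IsModel P k s2 f z) (t : ℕ) :
    HasGaussianLaw (fun ω => ((fun a => f a ω), (fun i : Fin t => z i ω))) P := by
  have hf : HasGaussianLaw (fun ω a => f a ω) P := by
    have := (h.gaussian_f.hasGaussianLaw Finset.univ).map
      (ContinuousLinearMap.pi fun a : D => ContinuousLinearMap.proj (R := ℝ)
        (φ := fun _ : (Finset.univ : Finset D) => ℝ) ⟨a, Finset.mem_univ a⟩)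
    exact this
  have hz : HasGaussianLaw (fun ω (i : Fin t) => z i ω) P := by
    apply iIndepFun.hasGaussianLaw
    · intro i
      have : IsGaussian (P.map (z i)) := by
        rw [h.law_z]
        infer_instance
      exact IsGaussian.hasGaussianLaw
    · exact h.indep_z.precomp Fin.val_injective
  have hind : IndepFun (fun ω a => f a ω) (fun ω (i : Fin t) => z i ω) P :=
    h.indep_f_z.comp (φ := id) (ψ := fun (y : ℕ → ℝ) (i : Fin t) => y i) measurable_id
      (by fun_prop)
  exact hind.hasGaussianLaw hf hz

theorem IsModel.memLp_f (h : IsModel P k s2 f z) (a : D) : MemLp (f a) 2 P :=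
  (h.gaussian_f.hasGaussianLaw_eval a).memLp_two

theorem IsModel.hasGaussianLaw_z (h : IsModel P k s2 f z) (i : ℕ) : HasGaussianLaw (z i) P := by
  have : IsGaussian (P.map (z i)) := by
    rw [h.law_z]
    infer_instance
  exact IsGaussian.hasGaussianLaw

theorem IsModel.memLp_z (h : IsModel P k s2 f z) (i : ℕ) : MemLp (z i) 2 P :=
  (h.hasGaussianLaw_z i).memLp_two

theorem IsModel.cov_f_z (h : IsModel P k s2 f z) (a : D) (i : ℕ) : cov[f a, z i; P] = 0 := by
  have : IndepFun (f a) (z i) P :=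
    h.indep_f_z.comp (φ := fun g : D → ℝ => g a) (ψ := fun y : ℕ → ℝ => y i)
      (by fun_prop) (by fun_prop)
  exact this.covariance_eq_zero (h.memLp_f a) (h.memLp_z i)

theorem IsModel.cov_z_z (h : IsModel P k s2 f z) (hs : 0 ≤ s2) (i j : ℕ) :
    cov[z i, z j; P] = if i = j then s2 else 0 := by
  split_ifs with hij
  · subst hij
    rw [covariance_self (h.measurable_z i).aemeasurable]
    have := variance_map (μ := P) (X := id) (Y := z i) aemeasurable_id
      (h.measurable_z i).aemeasurable
    rw [h.law_z, variance_id_gaussianReal, Real.coe_toNNReal _ hs] at this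
    exact this.symm
  · exact (h.indep_z.indepFun hij).covariance_eq_zero (h.memLp_z i) (h.memLp_z j)

theorem IsModel.integral_z (h : IsModel P k s2 f z) (i : ℕ) : ∫ ω, z i ω ∂P = 0 := by
  have := integral_map (μ := P) (φ := z i) (f := fun x : ℝ => x) (h.measurable_z i).aemeasurable
    (by fun_prop)
  rw [h.law_z, integral_id_gaussianReal] at this
  exact this.symm

theorem IsModel.memLp_fixedObs (h : IsModel P k s2 f z) {t : ℕ} (X : Fin t → D) (i : Fin t) :
    MemLp (fixedObs f z X i) 2 P :=
  (h.memLp_f (X i)).add (h.memLp_z i)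

theorem IsModel.cov_f_fixedObs (h : IsModel P k s2 f z) {t : ℕ} (X : Fin t → D) (i : Fin t)
    (a : D) : cov[f a, fixedObs f z X i; P] = k a (X i) := by
  have := covariance_add_right (h.memLp_f a) (h.memLp_f (X i)) (h.memLp_z i)
  rw [h.cov_f_z, h.cov_f, add_zero] at this
  exact this

theorem IsModel.cov_fixedObs (h : IsModel P k s2 f z) (hs : 0 ≤ s2) {t : ℕ} (X : Fin t → D)
    (i j : Fin t) :
    cov[fixedObs f z X i, fixedObs f z X j; P] = k (X i) (X j) + if i = j then s2 else 0 := by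
  have h1 := covariance_add_left (h.memLp_f (X i)) (h.memLp_z i) (h.memLp_fixedObs X j)
  have h2 := covariance_add_right (h.memLp_z i) (h.memLp_f (X j)) (h.memLp_z j)
  rw [covariance_comm (z i) (f (X j)), h.cov_f_z, h.cov_z_z hs, zero_add] at h2
  have h3 : cov[z i, fixedObs f z X j; P] = if (i : ℕ) = j then s2 else 0 := h2
  rw [h.cov_f_fixedObs, h3] at h1
  simp only [Fin.val_inj] at h1
  exact h1

theorem IsModel.memLp_smul_fixedObs (h : IsModel P k s2 f z) {t : ℕ} (X : Fin t → D)
    (w : Fin t → ℝ) (i : Fin t) : MemLp (fun ω => w i * fixedObs f z X i ω) 2 P :=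
  (h.memLp_fixedObs X i).const_mul (w i)

theorem IsModel.memLp_sum_fixedObs (h : IsModel P k s2 f z) {t : ℕ} (X : Fin t → D)
    (w : Fin t → ℝ) : MemLp (fun ω => ∑ i, w i * fixedObs f z X i ω) 2 P :=
  memLp_finsetSum _ fun i _ => h.memLp_smul_fixedObs X w i

theorem IsModel.memLp_residual (h : IsModel P k s2 f z) {t : ℕ} (X : Fin t → D) (a : D) :
    MemLp (residual k s2 f z X a) 2 P :=
  (h.memLp_f a).sub (h.memLp_sum_fixedObs X _)

/-- Orthogonality of the error to the data, which is exactly the system of normal equations. -/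
theorem IsModel.cov_residual_fixedObs (h : IsModel P k s2 f z) (hk : (Matrix.of k).PosSemidef)
    (hs : 0 < s2) {t : ℕ} (X : Fin t → D) (a : D) (j : Fin t) :
    cov[residual k s2 f z X a, fixedObs f z X j; P] = 0 := by
  have h1 := covariance_fun_sub_left (h.memLp_f a) (h.memLp_sum_fixedObs X (optWeights k s2 X a))
    (h.memLp_fixedObs X j)
  rw [covariance_fun_sum_left (fun i => h.memLp_smul_fixedObs X _ i) (h.memLp_fixedObs X j)] at h1
  simp only [covariance_const_mul_left, h.cov_fixedObs hs.le, h.cov_f_fixedObs] at h1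
  refine h1.trans ?_
  rw [kernel_symm hk, ← optWeights_normal hk hs X a j]
  simp only [mul_add, Finset.sum_add_distrib, mul_ite, mul_zero, Finset.sum_ite_eq',
    Finset.mem_univ, if_true]
  rw [Finset.sum_congr rfl fun i _ => by rw [kernel_symm hk (X j) (X i)]]
  ring

theorem IsModel.variance_residual (h : IsModel P k s2 f z) (hk : (Matrix.of k).PosSemidef)
    (hs : 0 < s2) {t : ℕ} (X : Fin t → D) (a : D) :
    Var[residual k s2 f z X a; P] = postVar k s2 X a := by
  have hR := h.memLp_residual X a
  rw [← covariance_self hR.aestronglyMeasurable.aemeasurable]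
  have h1 := covariance_fun_sub_right hR (h.memLp_f a)
    (h.memLp_sum_fixedObs X (optWeights k s2 X a))
  rw [covariance_fun_sum_right (fun i => h.memLp_smul_fixedObs X _ i) hR] at h1
  simp only [covariance_const_mul_right, h.cov_residual_fixedObs hk hs, mul_zero,
    Finset.sum_const_zero, sub_zero] at h1
  refine h1.trans ?_
  have h2 := covariance_fun_sub_left (h.memLp_f a)
    (h.memLp_sum_fixedObs X (optWeights k s2 X a)) (h.memLp_f a)
  rw [covariance_fun_sum_left (fun i => h.memLp_smul_fixedObs X _ i) (h.memLp_f a)] at h2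
  simp only [covariance_const_mul_left, h.cov_f] at h2
  refine h2.trans ?_
  rw [postVar_eq_sub]
  congr 1
  exact Finset.sum_congr rfl fun i _ => by
    rw [covariance_comm, h.cov_f_fixedObs, kernel_symm hk]

theorem IsModel.integral_residual (h : IsModel P k s2 f z) {t : ℕ} (X : Fin t → D) (a : D) :
    ∫ ω, residual k s2 f z X a ω ∂P = 0 := by
  unfold residual
  rw [integral_sub ((h.memLp_f a).integrable one_le_two)
    ((h.memLp_sum_fixedObs X _).integrable one_le_two), h.mean_f,
    integral_finsetSum _ fun i _ => (h.memLp_smul_fixedObs X _ i).integrable one_le_two]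
  simp only [integral_const_mul]
  have : ∀ i, ∫ ω, fixedObs f z X i ω ∂P = 0 := fun i => by
    unfold fixedObs
    rw [integral_add ((h.memLp_f _).integrable one_le_two) ((h.memLp_z _).integrable one_le_two),
      h.mean_f, h.integral_z, add_zero]
  simp [this]

theorem IsModel.hasGaussianLaw_residual_fixedObs (h : IsModel P k s2 f z) {t : ℕ} (X : Fin t → D)
    (a : D) : HasGaussianLaw (fun ω => ((fun _ : Unit => residual k s2 f z X a ω),
      (fun i => fixedObs f z X i ω))) P := by
  let L : ((D → ℝ) × (Fin t → ℝ)) →ₗ[ℝ] ((Unit → ℝ) × (Fin t → ℝ)) :=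
    { toFun := fun q => ((fun _ => q.1 a - ∑ i, optWeights k s2 X a i * (q.1 (X i) + q.2 i)),
        (fun i => q.1 (X i) + q.2 i))
      map_add' := fun q r => by
        ext i
        · simp only [Prod.fst_add, Prod.snd_add, Pi.add_apply, mul_add, Finset.sum_add_distrib]
          ring
        · simp only [Prod.fst_add, Prod.snd_add, Pi.add_apply]
          ring
      map_smul' := fun c q => by
        ext i
        · simp only [Prod.smul_fst, Prod.smul_snd, Pi.smul_apply, smul_eq_mul, mul_add,
            Finset.sum_add_distrib, RingHom.id_apply, mul_sub, Finset.mul_sum]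
          simp only [mul_left_comm c]
        · simp only [Prod.smul_fst, Prod.smul_snd, Pi.smul_apply, smul_eq_mul, mul_add,
            RingHom.id_apply] }
  exact (h.hasGaussianLaw_pair t).map (LinearMap.toContinuousLinearMap L)

/-- Error and observations are jointly Gaussian, as linear images of (f, z), so zero covariance
gives independence. -/
theorem IsModel.indepFun_residual (h : IsModel P k s2 f z) (hk : (Matrix.of k).PosSemidef)
    (hs : 0 < s2) {t : ℕ} (X : Fin t → D) (a : D) :
    IndepFun (residual k s2 f z X a) (fun ω i => fixedObs f z X i ω) P := by
  have := (h.hasGaussianLaw_residual_fixedObs X a).indepFun_of_covariance_eval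
    (fun _ j => h.cov_residual_fixedObs hk hs X a j)
  exact this.comp (φ := fun g : Unit → ℝ => g ()) (ψ := id) (by fun_prop) measurable_id

theorem IsModel.measure_residual_gt_le (h : IsModel P k s2 f z) (hk : (Matrix.of k).PosSemidef)
    (h1 : ∀ a, k a a = 1) (hs : 0 < s2) {t : ℕ} (X : Fin t → D) (a : D) {c : ℝ} (hc : 0 ≤ c) :
    P {ω | √c * √(postVar k s2 X a) < |residual k s2 f z X a ω|}
      ≤ ENNReal.ofReal (Real.exp (-(c / 2))) := by
  have hg : HasGaussianLaw (residual k s2 f z X a) P :=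
    (h.hasGaussianLaw_residual_fixedObs X a).fst.map
      (ContinuousLinearMap.proj (R := ℝ) (φ := fun _ : Unit => ℝ) ())
  have hlaw := hg.map_eq_gaussianReal
  rw [h.integral_residual, h.variance_residual hk hs] at hlaw
  have hv := postVar_pos hk hs h1 X a
  have hset : MeasurableSet {x : ℝ | √c * √(postVar k s2 X a) < |x|} :=
    measurableSet_lt measurable_const (by fun_prop)
  have hm := Measure.map_apply_of_aemeasurable hg.aemeasurable hset
  have hb := gaussianReal_abs_gt_le (v := (postVar k s2 X a).toNNReal)
    (by simpa using hv) (s := √c * √(postVar k s2 X a)) (by positivity)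
  rw [← hlaw, hm] at hb
  refine hb.trans_eq ?_
  rw [mul_pow, Real.sq_sqrt hc, Real.sq_sqrt hv.le, Real.coe_toNNReal _ hv.le]
  congr 3
  field_simp

end Residual

/-! ### Confidence for adaptively chosen points. -/

section Adaptive

set_option linter.unusedSectionVars false

variable {D Ω : Type*} [MeasurableSpace Ω] {P : Measure Ω}
  {k : D → D → ℝ} {s2 : ℝ} {f : D → Ω → ℝ} {z : ℕ → Ω → ℝ} {x : ℕ → Ω → D}

/-- By induction: as long as the queries have followed `X`, the actual observations equal those at
the fixed points, so the next choice is also a function of the latter. -/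
theorem exists_preimage_of_nonanticipating
    (hx : ∀ t d, MeasurableSet[⨆ s : Fin t, MeasurableSpace.comap (obs f z x s) inferInstance]
      {ω | x t ω = d}) (t : ℕ) (X : Fin t → D) :
    ∃ B : Set (Fin t → ℝ), MeasurableSet B ∧
      {ω | ∀ i : Fin t, x i ω = X i} = (fun ω i => fixedObs f z X i ω) ⁻¹' B := by
  induction t with
  | zero => exact ⟨Set.univ, MeasurableSet.univ, by ext; simp⟩
  | succ t ih =>
    obtain ⟨B₀, hB₀, h₀⟩ := ih fun i => X i.castSucc
    have h₁ := hx t (X (Fin.last t))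
    have hcomap : (⨆ s : Fin t, MeasurableSpace.comap (obs f z x s) inferInstance)
        = MeasurableSpace.comap (fun ω (s : Fin t) => obs f z x s ω) MeasurableSpace.pi := by
      rw [MeasurableSpace.pi, MeasurableSpace.comap_iSup]
      simp only [MeasurableSpace.comap_comp]
      rfl
    rw [hcomap] at h₁
    obtain ⟨B₁, hB₁, h₁⟩ := h₁
    refine ⟨(fun v i => v i.castSucc) ⁻¹' (B₀ ∩ B₁),
      (hB₀.inter hB₁).preimage (by fun_prop), ?_⟩
    ext ω
    have e₀ : (∀ i : Fin t, x i ω = X i.castSucc)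
        ↔ (fun i : Fin t => fixedObs f z (fun i => X i.castSucc) i ω) ∈ B₀ :=
      Set.ext_iff.1 h₀ ω
    have e₁ : (fun s : Fin t => obs f z x s ω) ∈ B₁ ↔ x t ω = X (Fin.last t) :=
      Set.ext_iff.1 h₁ ω
    simp only [Set.mem_ofPred_eq, Set.mem_preimage, Set.mem_inter_iff, Fin.forall_fin_succ',
      Fin.val_castSucc, Fin.val_last]
    have e₂ : (fun i : Fin t => fixedObs f z X i.castSucc ω)
        = fun i : Fin t => fixedObs f z (fun i => X i.castSucc) i ω := rfl
    rw [e₂, e₀]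
    refine and_congr_right fun hB => ?_
    have hobs : (fun s : Fin t => obs f z x s ω)
        = fun i : Fin t => fixedObs f z (fun i => X i.castSucc) i ω := by
      ext s
      simp only [obs, fixedObs, e₀.2 hB s]
    rw [← e₁, hobs]

variable [Fintype D] [IsProbabilityMeasure P]

/-- Confidence bound for adaptively chosen points: all intervals of one time step contain `f`,
except with probability at most `|D| exp (-c / 2)`. -/
theorem IsModel.measure_not_confident_le (h : IsModel P k s2 f z) (hk : (Matrix.of k).PosSemidef)
    (h1 : ∀ a, k a a = 1) (hs : 0 < s2)
    (hx : ∀ t d, MeasurableSet[⨆ s : Fin t, MeasurableSpace.comap (obs f z x s) inferInstance]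
      {ω | x t ω = d}) (t : ℕ) {c : ℝ} (hc : 0 ≤ c) :
    P {ω | ∃ a, √c * √(postVar k s2 (fun i : Fin t => x i ω) a)
        < |f a ω - postMean k s2 (fun i : Fin t => x i ω) (fun i => obs f z x i ω) a|}
      ≤ ENNReal.ofReal (Fintype.card D * Real.exp (-(c / 2))) := by
  classical
  set A : (Fin t → D) → Set Ω := fun X => {ω | ∀ i : Fin t, x i ω = X i} with hA
  set R : (Fin t → D) → D → Set Ω := fun X a =>
    {ω | √c * √(postVar k s2 X a) < |residual k s2 f z X a ω|} with hR
  have hmeas : ∀ X, Measurable fun ω (i : Fin t) => fixedObs f z X i ω := fun X =>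
    measurable_pi_lambda _ fun i => (h.measurable_f _).add (h.measurable_z _)
  have hAm : ∀ X, MeasurableSet (A X) := fun X => by
    obtain ⟨B, hB, he⟩ := exists_preimage_of_nonanticipating hx t X
    simp only [hA]
    rw [he]
    exact hmeas X hB
  -- The event that the queries are `X` depends on the observations at `X` only, hence is
  -- independent of the error there. The events `A X` are disjoint, so summing over `X` costs
  -- nothing.
  have hAR : ∀ X a, P (A X ∩ R X a) ≤ P (A X) * ENNReal.ofReal (Real.exp (-(c / 2))) := by
    intro X a
    obtain ⟨B, hB, he⟩ := exists_preimage_of_nonanticipating hx t X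
    have hset : MeasurableSet {u : ℝ | √c * √(postVar k s2 X a) < |u|} :=
      measurableSet_lt measurable_const (by fun_prop)
    have hind := (h.indepFun_residual hk hs X a).symm.measure_inter_preimage_eq_mul _ _ hB hset
    rw [← he] at hind
    exact hind.trans_le (mul_le_mul_right (h.measure_residual_gt_le hk h1 hs X a hc) _)
  have hsub : {ω | ∃ a, √c * √(postVar k s2 (fun i : Fin t => x i ω) a)
        < |f a ω - postMean k s2 (fun i : Fin t => x i ω) (fun i => obs f z x i ω) a|}
      ⊆ ⋃ a ∈ (Finset.univ : Finset D), ⋃ X ∈ (Finset.univ : Finset (Fin t → D)), A X ∩ R X a := by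
    rintro ω ⟨a, ha⟩
    simp only [Finset.mem_univ, Set.iUnion_true, Set.mem_iUnion]
    refine ⟨a, fun i => x i ω, fun i => rfl, ?_⟩
    rw [postMean_eq_sum hk] at ha
    exact ha
  have hdisj : ∑ X, P (A X) ≤ 1 := by
    have := sum_measure_le_measure_univ (μ := P) (s := Finset.univ) (t := A)
      (fun X _ => (hAm X).nullMeasurableSet) (fun X _ Y _ hXY => Disjoint.aedisjoint
        (Set.disjoint_left.2 fun ω hX hY => hXY (funext fun i => (hX i).symm.trans (hY i))))
    simpa using this
  calc P _ ≤ ∑ a : D, ∑ X : Fin t → D, P (A X ∩ R X a) :=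
        (measure_mono hsub).trans ((measure_biUnion_finset_le _ _).trans
          (Finset.sum_le_sum fun a _ => measure_biUnion_finset_le _ _))
    _ ≤ ∑ _a : D, ENNReal.ofReal (Real.exp (-(c / 2))) := by
        refine Finset.sum_le_sum fun a _ => (Finset.sum_le_sum fun X _ => hAR X a).trans ?_
        rw [← Finset.sum_mul]
        exact mul_le_of_le_one_left' hdisj
    _ = ENNReal.ofReal (Fintype.card D * Real.exp (-(c / 2))) := by
        rw [Finset.sum_const, Finset.card_univ, nsmul_eq_mul, ENNReal.ofReal_mul (by positivity),
          ENNReal.ofReal_natCast]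

end Adaptive

/-! ### Union bound over an infinite run. -/

section Schedule

variable {D : Type*} [Fintype D] {k : D → D → ℝ} {p : Params} {pb : Problem}

/-- In a run, epoch `e` ends within `n` steps. -/
def EpochBound (k : D → D → ℝ) (p : Params) (e n : ℕ) : Prop :=
  ∃ m : ℕ, 0 < m ∧ ∃ S : Fin m → D, (∀ a, p.beta e * postVar k p.s2 S a ≤ p.eta e ^ 2) ∧
    Fintype.card D * p.beta e * Real.exp (-(n / m)) ≤ ((1 + p.dbar) ^ 2 - 1) * p.eta e ^ 2

/-- If all epochs before `i₀` are over at time `N₀`, the epochs before `i₀ + j` are over at time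
`N₀ + n i₀ + ⋯ + n (i₀ + j - 1)`. -/
theorem le_epoch_of_sum_le (hk : (Matrix.of k).PosSemidef) (h1 : ∀ a, k a a = 1)
    (hsub : SubmodularVarReduction k p.s2) (hp : p.Regular) {x : ℕ → D} {y : ℕ → ℝ}
    (hgr : ∀ t a, acq k p (fun i : Fin t => x i) (state pb k p x y t) a
      ≤ acq k p (fun i : Fin t => x i) (state pb k p x y t) (x t))
    {i₀ N₀ : ℕ} {n : ℕ → ℕ} (hN₀ : 1 ≤ N₀) (hn : ∀ e, i₀ ≤ e → EpochBound k p e (n e))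
    (hphase : ∀ t, N₀ ≤ t → (state pb k p x y t).M.Nonempty → i₀ ≤ (state pb k p x y t).epoch)
    (j t : ℕ) (ht : N₀ + ∑ i ∈ Finset.range j, n (i₀ + i) ≤ t)
    (hM : (state pb k p x y t).M.Nonempty) : i₀ + j ≤ (state pb k p x y t).epoch := by
  induction j generalizing t with
  | zero => exact hphase t (by simpa using ht) hM
  | succ j ih =>
    rw [Finset.sum_range_succ, ← add_assoc] at ht
    obtain ⟨m, hm, S, hS, hexp⟩ := hn (i₀ + j) (Nat.le_add_right _ _)
    have hM' := hM.mono (state_M_antitone (pb := pb) (k := k) (p := p) (x := x) (y := y)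
      ((Nat.le_add_right _ _).trans ht))
    exact epoch_ends hk h1 hsub hp hgr hm S hS hexp (ih _ le_rfl hM') (by omega) ht hM

variable {Ω : Type*} [MeasurableSpace Ω] {P : Measure Ω} [IsProbabilityMeasure P]
  {f : D → Ω → ℝ} {z : ℕ → Ω → ℝ} {x : ℕ → Ω → D}

/-- Some confidence interval with parameter `c` at time `t + 1` misses the value of `f`. -/
def missSet (k : D → D → ℝ) (s2 : ℝ) (f : D → Ω → ℝ) (z : ℕ → Ω → ℝ) (x : ℕ → Ω → D) (t : ℕ)
    (c : ℝ) : Set Ω :=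
  {ω | ∃ a, √c * √(postVar k s2 (fun i : Fin (t + 1) => x i ω) a)
    < |f a ω - postMean k s2 (fun i : Fin (t + 1) => x i ω) (fun i => obs f z x i ω) a|}

/-- The epoch at a given time is random, but it is at least a deterministic one. Steps in `[N j, N
(j + 1))` can therefore be charged to the fixed parameter of epoch `i₀ + j`, and larger β only widen
the intervals. The geometric bounds add up to `4 * Q`. -/
theorem measure_not_confident_run_le (hk : (Matrix.of k).PosSemidef) (h1 : ∀ a, k a a = 1)
    (hsub : SubmodularVarReduction k p.s2) (hp : p.Regular) (hmodel : IsModel P k p.s2 f z)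
    (hrun : IsRun pb k p f z x) {i₀ N₀ : ℕ} {n : ℕ → ℕ} (hN₀ : 1 ≤ N₀)
    (hn : ∀ e, i₀ ≤ e → EpochBound k p e (n e))
    (hphase : ∀ ω t, N₀ ≤ t → (runState pb k p f z x ω t).M.Nonempty →
      i₀ ≤ (runState pb k p f z x ω t).epoch)
    {c₀ : ℝ} (hc₀ : 0 ≤ c₀) (hβ₀ : ∀ e, 1 ≤ e → c₀ ≤ p.beta e)
    (hmono : ∀ e, i₀ ≤ e → p.beta e ≤ p.beta (e + 1)) {Q δ : ℝ} (hQ : 0 ≤ Q)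
    (hbound : ∀ j, n (i₀ + j) * Real.exp (-(p.beta (i₀ + j) / 2)) ≤ Q * (2 * (1 / 2) ^ j))
    (hδ : Fintype.card D * (N₀ * Real.exp (-(c₀ / 2)) + 4 * Q) ≤ δ) :
    P {ω | ¬ Confident pb k p (fun s => x s ω) (fun s => obs f z x s ω) (fun a => f a ω)}
      ≤ ENNReal.ofReal δ := by
  set N : ℕ → ℕ := fun j => N₀ + ∑ i ∈ Finset.range j, n (i₀ + i) with hN
  have hmiss : ∀ t c, 0 ≤ c → P (missSet k p.s2 f z x t c)
      ≤ ENNReal.ofReal (Fintype.card D * Real.exp (-(c / 2))) := fun t c hc =>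
    hmodel.measure_not_confident_le hk h1 hp.s2_pos hrun.nonanticipating (t + 1) hc
  have hmono' : ∀ e e', i₀ ≤ e → e ≤ e' → p.beta e ≤ p.beta e' := fun e e' he hee' => by
    induction e', hee' using Nat.le_induction with
    | base => exact le_rfl
    | succ e' hle ih => exact ih.trans (hmono e' (he.trans hle))
  have hsubset : {ω | ¬ Confident pb k p (fun s => x s ω) (fun s => obs f z x s ω)
        (fun a => f a ω)}
      ⊆ (⋃ t ∈ Finset.range N₀, missSet k p.s2 f z x t c₀)
        ∪ ⋃ j, ⋃ t ∈ Finset.Ico (N j) (N (j + 1)),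
          missSet k p.s2 f z x t (p.beta (i₀ + j)) := by
    intro ω hω
    by_contra hnot
    simp only [Set.mem_union, Set.mem_iUnion, not_or, not_exists] at hnot
    refine hω fun t hM a => ?_
    have hle : ∀ c, ω ∉ missSet k p.s2 f z x t c →
        c ≤ p.beta (runState pb k p f z x ω t).epoch →
        |f a ω - postMean k p.s2 (fun i : Fin (t + 1) => x i ω) (fun i => obs f z x i ω) a|
          ≤ √(p.beta (runState pb k p f z x ω t).epoch)
            * √(postVar k p.s2 (fun i : Fin (t + 1) => x i ω) a) := by
      intro c hc hcβ
      have hc' : ¬ _ := fun h => hc ⟨a, h⟩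
      exact (not_lt.1 hc').trans (mul_le_mul_of_nonneg_right (Real.sqrt_le_sqrt hcβ)
        (Real.sqrt_nonneg _))
    by_cases htN : t < N₀
    · exact hle c₀ (hnot.1 t (Finset.mem_range.2 htN)) (hβ₀ _ (one_le_state_epoch t))
    · have hep := fun j (hj : N j ≤ t) =>
        le_epoch_of_sum_le hk h1 hsub hp (fun t a => hrun.greedy t ω a) hN₀ hn (hphase ω) j t hj hM
      -- Otherwise the epoch number at the single time `t` would exceed every bound.
      have hex : ∃ j, t < N j := by
        by_contra hcon
        push Not at hcon
        have h2 := hep _ (hcon ((state pb k p (fun s => x s ω) (fun s => obs f z x s ω) t).epoch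
          + 1))
        omega
      obtain ⟨j, hj, hmin⟩ : ∃ j, t < N (j + 1) ∧ N j ≤ t := by
        classical
        have h2 := Nat.find_spec hex
        have h3 : Nat.find hex ≠ 0 := fun h0 => by
          rw [h0] at h2
          exact htN (by simpa [hN] using h2)
        obtain ⟨j, hj⟩ := Nat.exists_eq_succ_of_ne_zero h3
        rw [hj] at h2
        exact ⟨j, h2, not_lt.1 (Nat.find_min hex (by omega))⟩
      exact hle _ (hnot.2 j t (Finset.mem_Ico.2 ⟨hmin, hj⟩))
        (hmono' _ _ (Nat.le_add_right _ _) (hep j hmin))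
  have hfirst : P (⋃ t ∈ Finset.range N₀, missSet k p.s2 f z x t c₀)
      ≤ ENNReal.ofReal (Fintype.card D * (N₀ * Real.exp (-(c₀ / 2)))) := by
    refine (measure_biUnion_finset_le _ _).trans
      ((Finset.sum_le_sum fun t _ => hmiss t c₀ hc₀).trans_eq ?_)
    rw [Finset.sum_const, Finset.card_range, nsmul_eq_mul, ← ENNReal.ofReal_natCast,
      ← ENNReal.ofReal_mul (by positivity), mul_left_comm]
  have hepoch : ∀ j, P (⋃ t ∈ Finset.Ico (N j) (N (j + 1)),
      missSet k p.s2 f z x t (p.beta (i₀ + j)))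
      ≤ ENNReal.ofReal (Fintype.card D * (Q * (2 * (1 / 2) ^ j))) := by
    intro j
    refine (measure_biUnion_finset_le _ _).trans
      ((Finset.sum_le_sum fun t _ => hmiss t _ (hp.beta_pos _).le).trans ?_)
    have hcard : N (j + 1) - N j = n (i₀ + j) := by
      simp only [hN, Finset.sum_range_succ]
      omega
    rw [Finset.sum_const, Nat.card_Ico, hcard, nsmul_eq_mul, ← ENNReal.ofReal_natCast,
      ← ENNReal.ofReal_mul (by positivity), mul_left_comm]
    exact ENNReal.ofReal_le_ofReal (mul_le_mul_of_nonneg_left (hbound j) (by positivity))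
  have hsum : ∑' j : ℕ, ENNReal.ofReal (Fintype.card D * (Q * (2 * (1 / 2) ^ j)))
      = ENNReal.ofReal (Fintype.card D * (4 * Q)) := by
    rw [← ENNReal.ofReal_tsum_of_nonneg (fun j => by positivity)
      (((summable_geometric_two.mul_left 2).mul_left Q).mul_left _)]
    rw [tsum_mul_left, tsum_mul_left, tsum_mul_left, tsum_geometric_two]
    ring_nf
  calc P _ ≤ ENNReal.ofReal (Fintype.card D * (N₀ * Real.exp (-(c₀ / 2))))
        + ∑' j : ℕ, ENNReal.ofReal (Fintype.card D * (Q * (2 * (1 / 2) ^ j))) :=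
        (measure_mono hsubset).trans ((measure_union_le _ _).trans
          (add_le_add hfirst ((measure_iUnion_le _).trans (ENNReal.tsum_le_tsum hepoch))))
    _ ≤ ENNReal.ofReal δ := by
        rw [hsum, ← ENNReal.ofReal_add (by positivity) (by positivity), ← mul_add]
        exact ENNReal.ofReal_le_ofReal hδ

end Schedule

/-! ### Deterministic epoch lengths for growing parameters. -/

section EpochLength

variable {D : Type*} [Fintype D] [Nonempty D] {k : D → D → ℝ} {p : Params} {pb : Problem}

/-- Querying every point equally often bounds the length of an epoch. -/
theorem exists_epochBound (hk : (Matrix.of k).PosSemidef) (h1 : ∀ a, k a a = 1)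
    (hp : p.Regular) (e : ℕ) {A : ℝ} (hA : 0 ≤ A)
    (hlog : Real.log (Fintype.card D * p.beta e / (((1 + p.dbar) ^ 2 - 1) * p.eta e ^ 2)) ≤ A) :
    ∃ n : ℕ, EpochBound k p e n ∧
      n ≤ Fintype.card D * (p.s2 * (p.beta e / p.eta e ^ 2) + 1) * A + 1 := by
  have hη := hp.eta_pos e
  have hβ := hp.beta_pos e
  have hs := hp.s2_pos
  have hd := hp.dbar_pos
  have hcard : 0 < Fintype.card D := Fintype.card_pos
  have hcard' : (0 : ℝ) < Fintype.card D := by exact_mod_cast hcard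
  -- Enough repetitions of each point that `β * s2 / m ≤ η²`. The design has `|D| * m` points, and
  -- its logarithmic multiple bounds the epoch length.
  set m := ⌈p.s2 * (p.beta e / p.eta e ^ 2)⌉₊ with hm
  have hmpos : 0 < m := Nat.ceil_pos.2 (by positivity)
  have hm' : (0 : ℝ) < m := by exact_mod_cast hmpos
  have hmle : p.s2 * (p.beta e / p.eta e ^ 2) ≤ m := Nat.le_ceil _
  have hmlt : (m : ℝ) < p.s2 * (p.beta e / p.eta e ^ 2) + 1 := Nat.ceil_lt_add_one (by positivity)
  have hKpos : (0 : ℝ) < (Fintype.card D * m : ℕ) := by positivity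
  refine ⟨⌈((Fintype.card D * m : ℕ) : ℝ) * A⌉₊, ⟨Fintype.card D * m, by positivity,
    fun i => (Fintype.equivFin D).symm (finProdFinEquiv.symm i).1, fun a => ?_, ?_⟩, ?_⟩
  · have h2 := postVar_le_of_injective hk hs
      (fun i : Fin (Fintype.card D * m) => (Fintype.equivFin D).symm (finProdFinEquiv.symm i).1)
      (fun _ : Fin m => a) (fun j => finProdFinEquiv (Fintype.equivFin D a, j))
      (fun j j' h => by simpa using h) (by simp) a
    have h3 := mul_le_mul_of_nonneg_left (h2.trans (postVar_const_le hk hs h1 hmpos a)) hβ.le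
    refine h3.trans ?_
    rw [← mul_div_assoc, div_le_iff₀ hm']
    have h4 := mul_le_mul_of_nonneg_left hmle (sq_nonneg (p.eta e))
    refine le_trans (le_of_eq ?_) h4
    field_simp
  · have hq : 0 < (1 + p.dbar) ^ 2 - 1 := by nlinarith
    have hr : 0 < Fintype.card D * p.beta e / (((1 + p.dbar) ^ 2 - 1) * p.eta e ^ 2) := by
      positivity
    have hexp : Real.exp (-((⌈((Fintype.card D * m : ℕ) : ℝ) * A⌉₊ : ℝ)
        / ((Fintype.card D * m : ℕ) : ℝ)))
        ≤ (Fintype.card D * p.beta e / (((1 + p.dbar) ^ 2 - 1) * p.eta e ^ 2))⁻¹ := by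
      rw [← Real.exp_log hr, ← Real.exp_neg]
      refine Real.exp_le_exp.2 (neg_le_neg (hlog.trans ?_))
      rw [le_div_iff₀ hKpos, mul_comm]
      exact Nat.le_ceil _
    refine (mul_le_mul_of_nonneg_left hexp (by positivity)).trans_eq ?_
    field_simp
  · refine (Nat.ceil_lt_add_one (by positivity)).le.trans ?_
    push_cast
    gcongr

/-- Failure probability of an epoch with `β = Λ u`, up to the factor `|D|`. -/
theorem exists_epochBound_mul_exp_le (hk : (Matrix.of k).PosSemidef) (h1 : ∀ a, k a a = 1)
    (hp : p.Regular) (e : ℕ) {Λ u C A : ℝ} (hΛ : 8 ≤ Λ) (hu : 1 ≤ u) (hβ : p.beta e = Λ * u)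
    (hη : 1 ≤ C * u * p.eta e ^ 2) (hA : 2 ≤ A)
    (hlog : Real.log (Fintype.card D * Λ * C / ((1 + p.dbar) ^ 2 - 1)) ≤ A) :
    ∃ n : ℕ, EpochBound k p e n ∧ n * Real.exp (-(p.beta e / 2))
      ≤ (Fintype.card D * (p.s2 * Λ * C + 1) * A + 1) * Real.exp (-(Λ / 2)) * u⁻¹ := by
  have hηp := hp.eta_pos e
  have hs := hp.s2_pos
  have hd := hp.dbar_pos
  have hu0 : 0 < u := by linarith
  have hΛ0 : 0 < Λ := by linarith
  have hC : 0 < C := by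
    by_contra hC
    have : C * u * p.eta e ^ 2 ≤ 0 :=
      mul_nonpos_of_nonpos_of_nonneg (mul_nonpos_of_nonpos_of_nonneg (not_lt.1 hC) hu0.le)
        (sq_nonneg _)
    linarith
  have hq : 0 < (1 + p.dbar) ^ 2 - 1 := by nlinarith
  have hcard' : (0 : ℝ) < Fintype.card D := by exact_mod_cast Fintype.card_pos
  have hratio : p.beta e / p.eta e ^ 2 ≤ Λ * C * u ^ 2 := by
    rw [hβ, div_le_iff₀ (by positivity)]
    have := mul_le_mul_of_nonneg_left hη (mul_pos hΛ0 hu0).le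
    nlinarith
  -- The ratio grows like `u ^ 2`, so the logarithm is at most `A + 2 * log u ≤ A + 2 * (u - 1)`;
  -- this is where `2 ≤ A` is used.
  obtain ⟨n, hn, hnle⟩ := exists_epochBound hk h1 hp e (A := A * u) (by positivity) (by
    have h2 : Fintype.card D * p.beta e / (((1 + p.dbar) ^ 2 - 1) * p.eta e ^ 2)
        ≤ Fintype.card D * Λ * C / ((1 + p.dbar) ^ 2 - 1) * u ^ 2 := by
      calc Fintype.card D * p.beta e / (((1 + p.dbar) ^ 2 - 1) * p.eta e ^ 2)
          = Fintype.card D / ((1 + p.dbar) ^ 2 - 1) * (p.beta e / p.eta e ^ 2) := by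
            field_simp
        _ ≤ Fintype.card D / ((1 + p.dbar) ^ 2 - 1) * (Λ * C * u ^ 2) := by gcongr
        _ = _ := by ring
    have hβ0 := hp.beta_pos e
    refine (Real.log_le_log (by positivity) h2).trans ?_
    rw [Real.log_mul (by positivity) (by positivity), Real.log_pow]
    have := Real.log_le_sub_one_of_pos hu0
    push_cast
    nlinarith)
  refine ⟨n, hn, ?_⟩
  have hn2 : (n : ℝ) ≤ (Fintype.card D * (p.s2 * Λ * C + 1) * A + 1) * u ^ 3 := by
    have hu2 : 1 ≤ u ^ 2 := one_le_pow₀ hu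
    have hu3 : 1 ≤ u ^ 3 := one_le_pow₀ hu
    calc (n : ℝ) ≤ Fintype.card D * (p.s2 * (p.beta e / p.eta e ^ 2) + 1) * (A * u) + 1 := hnle
      _ ≤ Fintype.card D * (p.s2 * (Λ * C * u ^ 2) + 1 * u ^ 2) * (A * u) + 1 * u ^ 3 := by
          gcongr <;> linarith
      _ = _ := by ring
  have hexp : u ^ 3 * Real.exp (-(p.beta e / 2)) ≤ Real.exp (-(Λ / 2)) * u⁻¹ := by
    have h3 : u ≤ Real.exp (u - 1) := by
      have := Real.add_one_le_exp (u - 1)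
      linarith
    -- The length grows like `u ^ 3`; a further factor `u` is kept for summability. `8 ≤ Λ` is what
    -- absorbs this fourth power.
    have h4 : u ^ 4 ≤ Real.exp (Λ / 2 * (u - 1)) := by
      calc u ^ 4 ≤ Real.exp (u - 1) ^ 4 := by gcongr
        _ = Real.exp (4 * (u - 1)) := by rw [← Real.exp_nat_mul]; norm_num
        _ ≤ _ := Real.exp_le_exp.2 (by nlinarith)
    rw [← div_eq_mul_inv, le_div_iff₀ hu0]
    calc u ^ 3 * Real.exp (-(p.beta e / 2)) * u = u ^ 4 * Real.exp (-(p.beta e / 2)) := by ring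
      _ ≤ Real.exp (Λ / 2 * (u - 1)) * Real.exp (-(p.beta e / 2)) := by gcongr
      _ = Real.exp (-(Λ / 2)) := by
          rw [← Real.exp_add, hβ]
          congr 1
          ring
  calc n * Real.exp (-(p.beta e / 2))
      ≤ (Fintype.card D * (p.s2 * Λ * C + 1) * A + 1) * u ^ 3 * Real.exp (-(p.beta e / 2)) := by
        gcongr
    _ = (Fintype.card D * (p.s2 * Λ * C + 1) * A + 1) * (u ^ 3 * Real.exp (-(p.beta e / 2))) := by
        ring
    _ ≤ (Fintype.card D * (p.s2 * Λ * C + 1) * A + 1) * (Real.exp (-(Λ / 2)) * u⁻¹) := by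
        gcongr
    _ = _ := by ring

variable {Ω : Type*} [MeasurableSpace Ω] {P : Measure Ω} [IsProbabilityMeasure P]
  {f : D → Ω → ℝ} {z : ℕ → Ω → ℝ} {x : ℕ → Ω → D}

/-- Confidence of a run whose later epochs have growing parameters `β = Λ u`. -/
theorem measure_not_confident_run_le_of_growth (hk : (Matrix.of k).PosSemidef)
    (h1 : ∀ a, k a a = 1) (hsub : SubmodularVarReduction k p.s2) (hp : p.Regular)
    (hmodel : IsModel P k p.s2 f z) (hrun : IsRun pb k p f z x) {i₀ N₀ : ℕ} (hN₀ : 1 ≤ N₀)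
    (hphase : ∀ ω t, N₀ ≤ t → (runState pb k p f z x ω t).M.Nonempty →
      i₀ ≤ (runState pb k p f z x ω t).epoch)
    {c₀ : ℝ} (hc₀ : 0 ≤ c₀) (hβ₀ : ∀ e, 1 ≤ e → c₀ ≤ p.beta e)
    {Λ C A : ℝ} {u : ℕ → ℝ} (hΛ : 8 ≤ Λ) (hu : ∀ e, i₀ ≤ e → 1 ≤ u e)
    (hβ : ∀ e, i₀ ≤ e → p.beta e = Λ * u e)
    (hη : ∀ e, i₀ ≤ e → 1 ≤ C * u e * p.eta e ^ 2)
    (hmono : ∀ e, i₀ ≤ e → u e ≤ u (e + 1)) (hgrow : ∀ j, 2 ^ j ≤ 2 * u (i₀ + j))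
    (hC : 0 ≤ C) (hA : 2 ≤ A)
    (hlog : Real.log (Fintype.card D * Λ * C / ((1 + p.dbar) ^ 2 - 1)) ≤ A) {δ : ℝ}
    (hδ : Fintype.card D * (N₀ * Real.exp (-(c₀ / 2))
      + 4 * ((Fintype.card D * (p.s2 * Λ * C + 1) * A + 1) * Real.exp (-(Λ / 2)))) ≤ δ) :
    P {ω | ¬ Confident pb k p (fun s => x s ω) (fun s => obs f z x s ω) (fun a => f a ω)}
      ≤ ENNReal.ofReal δ := by
  have hs := hp.s2_pos
  have hex := fun e : ℕ => fun he : i₀ ≤ e => exists_epochBound_mul_exp_le hk h1 hp e hΛ (hu e he)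
    (hβ e he) (hη e he) hA hlog
  choose! n hn hnle using hex
  refine measure_not_confident_run_le hk h1 hsub hp hmodel hrun hN₀ hn hphase hc₀ hβ₀
    (fun e he => ?_) (by positivity) (fun j => ?_) hδ
  · rw [hβ e he, hβ (e + 1) (by omega)]
    have := hmono e he
    gcongr
  · refine (hnle (i₀ + j) (Nat.le_add_right _ _)).trans ?_
    refine mul_le_mul_of_nonneg_left ?_ (by positivity)
    have h2 := hgrow j
    have hpos : (0 : ℝ) < 2 ^ j := by positivity
    have hu0 : 0 < u (i₀ + j) := by linarith
    rw [one_div, inv_pow, inv_le_iff_one_le_mul₀ hu0]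
    field_simp
    linarith

end EpochLength

/-! ### The parameters with r = 1/2, and the case of a sufficiently accurate prior. -/

section HalvingParams

variable {D : Type*} [Fintype D] [Nonempty D] {k : D → D → ℝ} {σ dbar ε δ : ℝ}

theorem eta_halving (σ dbar : ℝ) (β : ℕ → ℝ) (e : ℕ) :
    (Params.mk (σ ^ 2) 1 (1 / 2) dbar β).eta e = (1 / 2) ^ (e - 1) := by
  simp [Params.eta]

theorem eta_halving_sq (σ dbar : ℝ) (β : ℕ → ℝ) (e : ℕ) :
    (Params.mk (σ ^ 2) 1 (1 / 2) dbar β).eta e ^ 2 = (4 ^ (e - 1))⁻¹ := by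
  rw [eta_halving, ← pow_mul, mul_comm, pow_mul, ← inv_pow]
  norm_num

theorem regular_halving (hσ : 0 < σ) (hd : 0 < dbar) {β : ℕ → ℝ}
    (hβ : ∃ b, 0 < b ∧ ∀ i, b ≤ β i) : (Params.mk (σ ^ 2) 1 (1 / 2) dbar β).Regular where
  s2_pos := by positivity
  dbar_pos := hd
  eta_pos e := by rw [eta_halving]; positivity
  eta_tendsto := by
    rw [← Filter.tendsto_add_atTop_iff_nat 1]
    simp only [eta_halving, Nat.add_sub_cancel]
    exact tendsto_pow_atTop_nhds_zero_of_lt_one (by norm_num) (by norm_num)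
  beta_bdd := hβ

theorem one_sub_le_measureReal {Ω : Type*} [MeasurableSpace Ω] {P : Measure Ω}
    [IsProbabilityMeasure P] {φ ψ : Ω → Prop} (hδ : 0 ≤ δ) (h : P {ω | ¬ φ ω} ≤ ENNReal.ofReal δ)
    (hφψ : ∀ ω, φ ω → ψ ω) : 1 - δ ≤ P.real {ω | ψ ω} := by
  have h1 : (1 : ENNReal) ≤ P {ω | ψ ω} + P {ω | ¬ φ ω} := by
    rw [← measure_univ (μ := P)]
    refine (measure_mono fun ω _ => ?_).trans (measure_union_le _ _)
    by_cases hω : φ ω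
    · exact Or.inl (hφψ ω hω)
    · exact Or.inr hω
  have h2 := ENNReal.toReal_mono (by finiteness) (h1.trans (add_le_add_right h _))
  rw [ENNReal.toReal_one, ENNReal.toReal_add (by finiteness) (by finiteness),
    ENNReal.toReal_ofReal hδ] at h2
  rw [Measure.real]
  linarith

theorem tendsto_quadratic_mul_exp_neg (n s q : ℝ) :
    Filter.Tendsto (fun Λ : ℝ => n * (4 * ((n * (s * Λ * 1 + 1)
      * (2 + n * Λ * 1 / q) + 1) * Real.exp (-(Λ / 2))))) Filter.atTop (nhds 0) := by
  have hp := fun j => (Real.tendsto_pow_mul_exp_neg_atTop_nhds_zero j).comp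
    (Filter.tendsto_id.atTop_div_const (zero_lt_two' ℝ))
  have h := (((hp 2).const_mul (4 * n * (n * s * (n / q)) * 4)).add
    ((hp 1).const_mul (4 * n * (2 * (n * s * 2 + n * (n / q)))))).add
    ((hp 0).const_mul (4 * n * (2 * n + 1)))
  simp only [mul_zero, add_zero] at h
  refine h.congr fun Λ => ?_
  simp only [Function.comp, id]
  ring

/-- If the prior intervals already have width at most `ε / 2`, the algorithm is accurate after one
step. -/
theorem exists_beta_of_prior_accurate (hk : (Matrix.of k).PosSemidef) (h1 : ∀ a, k a a = 1)
    (hσ : 0 < σ) (hsub : SubmodularVarReduction k (σ ^ 2)) (hd : 0 < dbar)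
    (hε : 0 < ε) (hε' : ε < 4 * (1 + dbar)) (hδ : 0 < δ) {b : ℝ} (hb : 0 < b)
    (hbε : 16 * b ≤ ε ^ 2) (hbδ : Fintype.card D * Real.exp (-(b / 2)) ≤ 2 / 3 * δ) :
    ∃ β : ℕ → ℝ, (∃ b, 0 < b ∧ ∀ i, b ≤ β i) ∧
      ∀ (pb : Problem) (Ω : Type*) [MeasurableSpace Ω] (P : Measure Ω)
        [IsProbabilityMeasure P] (f : D → Ω → ℝ) (z : ℕ → Ω → ℝ) (x : ℕ → Ω → D),
        IsModel P k (σ ^ 2) f z → IsRun pb k ⟨σ ^ 2, 1, 1 / 2, dbar, β⟩ f z x →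
        1 - δ ≤ P.real {ω | ∀ T : ℕ, 1 ≤ T → Accurate pb ε (fun a => f a ω)
          (runState pb k ⟨σ ^ 2, 1, 1 / 2, dbar, β⟩ f z x ω T)} := by
  have hs : 0 < σ ^ 2 := by positivity
  have hq : 0 < (1 + dbar) ^ 2 - 1 := by nlinarith
  set n : ℝ := (Fintype.card D : ℝ) with hndef
  have hn : 0 < n := by
    have := Fintype.card_pos (α := D)
    simp only [n]
    exact_mod_cast this
  have htend := tendsto_quadratic_mul_exp_neg n (σ ^ 2) ((1 + dbar) ^ 2 - 1)
  -- The first step may fail with probability 2δ/3; all later epochs get δ/3, which is possible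
  -- because nothing prevents taking Λ huge.
  obtain ⟨Λ, hΛ, hΛδ⟩ := ((Filter.eventually_ge_atTop (max 8 b)).and
    (htend.eventually_le_const (show (0 : ℝ) < δ / 3 by positivity))).exists
  have hΛ8 : 8 ≤ Λ := (le_max_left _ _).trans hΛ
  have hΛb : b ≤ Λ := (le_max_right _ _).trans hΛ
  obtain ⟨β, hβ1, hβ2⟩ : ∃ β : ℕ → ℝ, (∀ e, e ≤ 1 → β e = b) ∧
      ∀ e, 2 ≤ e → β e = Λ * 4 ^ (e - 1) :=
    ⟨fun e => if e ≤ 1 then b else Λ * 4 ^ (e - 1), fun e he => by simp [he],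
      fun e he => if_neg (by omega)⟩
  have hβb : ∀ e, b ≤ β e := fun e => by
    by_cases he : e ≤ 1
    · exact (hβ1 e he).ge
    · rw [hβ2 e (by omega)]
      have : (1 : ℝ) ≤ 4 ^ (e - 1) := one_le_pow₀ (by norm_num)
      nlinarith
  have hbdd : ∃ b, 0 < b ∧ ∀ i, b ≤ β i := ⟨b, hb, hβb⟩
  refine ⟨β, hbdd, fun pb Ω _ P _ f z x hmodel hrun => ?_⟩
  set p : Params := ⟨σ ^ 2, 1, 1 / 2, dbar, β⟩ with hpdef
  have hp : p.Regular := regular_halving hσ hd hbdd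
  -- Used twice: `c = ε / 4` gives accuracy after one step, and `c = (1 + δ̄) * η₁` shows that epoch
  -- 1 is over by then.
  have hv : ∀ {t : ℕ} (X : Fin t → D) (a : D) (c : ℝ), 0 ≤ c → 16 * b ≤ (4 * c) ^ 2 →
      √(p.beta 1) * √(postVar k p.s2 X a) ≤ c := by
    intro t X a c hc hbc
    rw [show p.beta 1 = b from hβ1 1 le_rfl, sqrt_mul_sqrt_le_iff hb.le hc]
    have := mul_le_mul_of_nonneg_left (postVar_le_one hk hp.s2_pos h1 X a) hb.le
    nlinarith
  have hprob := measure_not_confident_run_le_of_growth (p := p) (i₀ := 2) (N₀ := 1) (c₀ := b) (Λ := Λ)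
    (C := 1) (A := 2 + n * Λ * 1 / ((1 + dbar) ^ 2 - 1)) (u := fun e => 4 ^ (e - 1)) (δ := δ)
    hk h1 hsub hp hmodel hrun le_rfl ?_ hb.le (fun e _ => hβb e) hΛ8 ?_ (fun e he => hβ2 e he)
    ?_ ?_ ?_ zero_le_one ?_ ?_ ?_
  · refine one_sub_le_measureReal hδ.le hprob fun ω hconf T hT => ?_
    refine accurate_of_width_le (t := 0) hconf hT fun a _ => ?_
    have := hv (fun i : Fin (0 + 1) => x i ω) a (ε / 4) (by positivity) (by linarith)
    change 4 * (√(p.beta 1) * _) ≤ ε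
    linarith
  · intro ω t ht hM
    have h0 := one_le_state_epoch (pb := pb) (k := k) (p := p) (x := fun s => x s ω)
      (y := fun s => obs f z x s ω) t
    by_contra hcon
    have hnot := not_epochDone_epoch hk h1 hp ht hM
    have he : (state pb k p (fun s => x s ω) (fun s => obs f z x s ω) t).epoch = 1 := by
      change ¬ 2 ≤ (state pb k p (fun s => x s ω) (fun s => obs f z x s ω) t).epoch at hcon
      omega
    rw [he] at hnot
    refine hnot fun a _ => hv _ _ _ ?_ ?_
    · rw [hpdef, eta_halving]
      simp
      positivity
    · rw [hpdef, eta_halving]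
      simp only [Nat.sub_self, pow_zero, mul_one]
      nlinarith
  · exact fun e _ => one_le_pow₀ (by norm_num)
  · intro e _
    rw [hpdef, eta_halving_sq, one_mul, mul_inv_cancel₀ (by positivity)]
  · exact fun e _ => pow_le_pow_right₀ (by norm_num) (by omega)
  · intro j
    have h2 : (2 : ℝ) ^ j ≤ 4 ^ j := by gcongr; norm_num
    have h3 : (4 : ℝ) ^ j ≤ 4 ^ (2 + j - 1) := pow_le_pow_right₀ (by norm_num) (by omega)
    have : (0 : ℝ) < 4 ^ (2 + j - 1) := by positivity
    linarith
  · have : 0 < n * Λ * 1 / ((1 + dbar) ^ 2 - 1) := by positivity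
    linarith
  · have h2 : 0 < n * Λ * 1 / ((1 + dbar) ^ 2 - 1) := by positivity
    have := Real.log_le_sub_one_of_pos h2
    simp only [hpdef, n] at this ⊢
    linarith
  · rw [Nat.cast_one, one_mul, mul_add]
    have h2 := hΛδ
    simp only [hpdef, n] at h2 hbδ ⊢
    linarith

end HalvingParams

/-! ### Ladder parameters: one epoch does the work. -/

section Ladder

/-- Confidence parameters for which epoch `1` has the target of the last relevant epoch, and the
parameters of later epochs grow. -/
noncomputable def betaLadder (B E : ℝ) (e : ℕ) : ℝ := B * max (max (E / 4 ^ (e - 1)) 1) (4 ^ (e - 1) / (4 * E))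

theorem le_betaLadder {B E : ℝ} (hB : 0 ≤ B) (e : ℕ) : B ≤ betaLadder B E e :=
  le_mul_of_one_le_right hB ((le_max_right _ _).trans (le_max_left _ _))

theorem betaLadder_one {B E : ℝ} (hE : 1 ≤ E) : betaLadder B E 1 = B * E := by
  have h2 : 1 / (4 * E) ≤ E := by
    rw [div_le_iff₀ (by positivity)]
    nlinarith
  simp only [betaLadder, Nat.sub_self, pow_zero, div_one]
  rw [max_eq_left hE, max_eq_left h2]

theorem betaLadder_of_lt {B E : ℝ} {e : ℕ} (h : (4 : ℝ) ^ (e - 1) < E) :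
    betaLadder B E e = B * (E / 4 ^ (e - 1)) := by
  have h4 : (0 : ℝ) < 4 ^ (e - 1) := by positivity
  have h1 : 1 ≤ E / 4 ^ (e - 1) := by
    rw [le_div_iff₀ h4]
    linarith
  have h2 : (4 : ℝ) ^ (e - 1) / (4 * E) ≤ 1 := by
    rw [div_le_one (by linarith)]
    linarith
  rw [betaLadder, max_eq_left h1, max_eq_left (h2.trans h1)]

theorem betaLadder_of_le {B E : ℝ} {e : ℕ} (h : E ≤ (4 : ℝ) ^ (e - 1)) :
    betaLadder B E e = B * max 1 (4 ^ (e - 1) / (4 * E)) := by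
  rw [betaLadder, max_eq_right ((div_le_one (by positivity)).2 h)]

variable {D : Type*} [Fintype D] {k : D → D → ℝ} {σ dbar ε δ B E : ℝ}

/-- The epochs before the last relevant one are skipped. -/
theorem le_epoch_of_betaLadder (hk : (Matrix.of k).PosSemidef) (h1 : ∀ a, k a a = 1)
    (hσ : 0 < σ) (hd : 0 < dbar) (hB : 0 < B) {pb : Problem} {x : ℕ → D} {y : ℕ → ℝ} {i₀ t : ℕ}
    (hE : 1 ≤ E) (hi₀ : ∀ e, 1 ≤ e → e < i₀ → (4 : ℝ) ^ (e - 1) < E) (ht : 1 ≤ t)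
    (hM : (state pb k ⟨σ ^ 2, 1, 1 / 2, dbar, betaLadder B E⟩ x y t).M.Nonempty)
    (h2 : 2 ≤ (state pb k ⟨σ ^ 2, 1, 1 / 2, dbar, betaLadder B E⟩ x y t).epoch) :
    i₀ ≤ (state pb k ⟨σ ^ 2, 1, 1 / 2, dbar, betaLadder B E⟩ x y t).epoch := by
  set p : Params := ⟨σ ^ 2, 1, 1 / 2, dbar, betaLadder B E⟩ with hpdef
  have hp : p.Regular := regular_halving hσ hd ⟨B, hB, le_betaLadder hB.le⟩
  by_contra hcon
  refine not_epochDone_epoch hk h1 hp ht hM fun a ha => ?_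
  have hd1 := epochDone_of_lt_epoch (p := p) hk hp.s2_pos t le_rfl h2 a ha
  set e := (state pb k p x y t).epoch
  have hη := hp.eta_pos e
  have hη1 := hp.eta_pos 1
  rw [sqrt_mul_sqrt_le_iff (hp.beta_pos _).le (by positivity), mul_pow, hpdef,
    eta_halving_sq] at hd1 ⊢
  simp only at hd1 ⊢
  rw [betaLadder_one hE] at hd1
  rw [betaLadder_of_lt (hi₀ e (by omega) (by omega))]
  have h4 : (0 : ℝ) < 4 ^ (e - 1) := by positivity
  -- Dividing the stopping condition of epoch 1 by `4 ^ (e - 1)` gives that of epoch `e`,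
  -- contradicting that `e` is still current.
  have := mul_le_mul_of_nonneg_left hd1 (inv_pos.2 h4).le
  refine le_trans (le_of_eq ?_) (this.trans_eq ?_)
  · field_simp
  · simp
    ring

/-- Once the epochs before the last relevant one are over, the confidence intervals are short. -/
theorem width_le_of_betaLadder (hk : (Matrix.of k).PosSemidef) (h1 : ∀ a, k a a = 1)
    (hσ : 0 < σ) (hd : 0 < dbar) (hB : 0 < B) {pb : Problem} {x : ℕ → D} {y : ℕ → ℝ} {t : ℕ}
    (hE : 1 ≤ E) (hε : 0 < ε) (hEε : 16 * (1 + dbar) ^ 2 = E * ε ^ 2)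
    (he : E ≤ 4 ^ ((state pb k ⟨σ ^ 2, 1, 1 / 2, dbar, betaLadder B E⟩ x y t).epoch - 1))
    (h2 : 2 ≤ (state pb k ⟨σ ^ 2, 1, 1 / 2, dbar, betaLadder B E⟩ x y t).epoch) {a : D}
    (ha : a ∈ (state pb k ⟨σ ^ 2, 1, 1 / 2, dbar, betaLadder B E⟩ x y t).M) :
    4 * (√(betaLadder B E (state pb k ⟨σ ^ 2, 1, 1 / 2, dbar, betaLadder B E⟩ x y t).epoch)
      * √(postVar k (σ ^ 2) (fun i : Fin (t + 1) => x i) a)) ≤ ε := by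
  set p : Params := ⟨σ ^ 2, 1, 1 / 2, dbar, betaLadder B E⟩ with hpdef
  have hp : p.Regular := regular_halving hσ hd ⟨B, hB, le_betaLadder hB.le⟩
  have hd1 := epochDone_of_lt_epoch (p := p) hk hp.s2_pos t le_rfl h2 a ha
  obtain ⟨e, hee⟩ : ∃ e, (state pb k p x y t).epoch = e + 2 := ⟨_, (Nat.sub_add_cancel h2).symm⟩
  -- Two finished epochs are combined: epoch 1 bounds `B * v * E`, the previous epoch bounds `B * v
  -- * 4 ^ e`. Their maximum is what the current parameter requires; the 4 in the denominator of
  -- `betaLadder` compensates for the index shift.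
  have hd2 := epochDone_of_lt_epoch (p := p) hk hp.s2_pos t (j := e + 1) (by omega) (by omega) a ha
  rw [hee] at he ⊢
  have hη := hp.eta_pos (e + 1)
  have hη1 := hp.eta_pos 1
  have hv := postVar_append_le_left hk hp.s2_pos (fun i : Fin t => x i) ![x t] a
  rw [append_singleton_eq] at hv
  have hvpos := postVar_pos hk hp.s2_pos h1 (fun i : Fin (t + 1) => x i) a
  rw [sqrt_mul_sqrt_le_iff (hp.beta_pos _).le (by positivity), mul_pow, hpdef,
    eta_halving_sq] at hd1 hd2
  simp only at hd1 hd2 hv hvpos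
  rw [betaLadder_one hE] at hd1
  set v := postVar k (σ ^ 2) (fun i : Fin t => x i) a
  set v' := postVar k (σ ^ 2) (fun i : Fin (t + 1) => x i) a
  have h4 : (0 : ℝ) < 4 ^ e := by positivity
  have hgoal : √(betaLadder B E (e + 2)) * √v' ≤ ε / 4 := by
    rw [sqrt_mul_sqrt_le_iff (hB.le.trans (le_betaLadder hB.le _)) (by positivity),
      betaLadder_of_le he]
    have hE0 : 0 < E := by linarith
    have hBv' : B * v' ≤ B * v := mul_le_mul_of_nonneg_left hv hB.le
    have hBv : B * v * E ≤ (1 + dbar) ^ 2 := by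
      simp at hd1
      linarith
    have hBv2 : B * v * 4 ^ e ≤ (1 + dbar) ^ 2 := by
      have h5 := (mul_le_mul_of_nonneg_right (le_betaLadder (E := E) hB.le (e + 1))
        (hvpos.le.trans hv)).trans hd2
      rw [Nat.add_sub_cancel, ← div_eq_mul_inv, le_div_iff₀ h4] at h5
      exact h5
    have hmax : max 1 ((4 : ℝ) ^ (e + 2 - 1) / (4 * E)) * E = max E (4 ^ e) := by
      rw [max_mul_of_nonneg _ _ hE0.le, one_mul, show e + 2 - 1 = e + 1 by omega, pow_succ]
      congr 1
      field_simp
    have hle : B * v * max E (4 ^ e) ≤ (1 + dbar) ^ 2 := by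
      rcases max_cases E ((4 : ℝ) ^ e) with h | h <;> rw [h.1]
      · exact hBv
      · exact hBv2
    have hm0 : 0 < max E ((4 : ℝ) ^ e) := lt_max_of_lt_left hE0
    have hlast : B * max 1 ((4 : ℝ) ^ (e + 2 - 1) / (4 * E)) * v' * E ≤ (ε / 4) ^ 2 * E := by
      calc B * max 1 ((4 : ℝ) ^ (e + 2 - 1) / (4 * E)) * v' * E
          = B * v' * (max 1 ((4 : ℝ) ^ (e + 2 - 1) / (4 * E)) * E) := by ring
        _ ≤ B * v * max E (4 ^ e) := by rw [hmax]; gcongr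
        _ ≤ (1 + dbar) ^ 2 := hle
        _ = (ε / 4) ^ 2 * E := by linarith
    exact le_of_mul_le_mul_right hlast hE0
  linarith

/-- If the first epoch is over at time `N₀`, the algorithm is accurate from then on. -/
theorem accurate_of_first_epoch [Nonempty D] (hk : (Matrix.of k).PosSemidef) (h1 : ∀ a, k a a = 1)
    (hσ : 0 < σ) (hsub : SubmodularVarReduction k (σ ^ 2)) (hd : 0 < dbar)
    (hε : 0 < ε) (hδ : 0 < δ) (hB : 8 ≤ B) (hE : 1 < E) (hEε : 16 * (1 + dbar) ^ 2 = E * ε ^ 2)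
    {N₀ : ℕ} (hN₀ : 1 ≤ N₀) {A : ℝ} (hA : 2 ≤ A)
    (hlog : Real.log (Fintype.card D * B * (4 * E) / ((1 + dbar) ^ 2 - 1)) ≤ A)
    (hbudget : Fintype.card D * (N₀ * Real.exp (-(B / 2))
      + 4 * ((Fintype.card D * (σ ^ 2 * B * (4 * E) + 1) * A + 1) * Real.exp (-(B / 2)))) ≤ δ)
    {Ω : Type*} [MeasurableSpace Ω] {P : Measure Ω} [IsProbabilityMeasure P] {pb : Problem}
    {f : D → Ω → ℝ} {z : ℕ → Ω → ℝ} {x : ℕ → Ω → D} (hmodel : IsModel P k (σ ^ 2) f z)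
    (hrun : IsRun pb k ⟨σ ^ 2, 1, 1 / 2, dbar, betaLadder B E⟩ f z x)
    (hfirst : ∀ ω t, N₀ ≤ t →
      (runState pb k ⟨σ ^ 2, 1, 1 / 2, dbar, betaLadder B E⟩ f z x ω t).M.Nonempty →
      2 ≤ (runState pb k ⟨σ ^ 2, 1, 1 / 2, dbar, betaLadder B E⟩ f z x ω t).epoch) :
    1 - δ ≤ P.real {ω | ∀ T : ℕ, N₀ + 1 ≤ T → Accurate pb ε (fun a => f a ω)
      (runState pb k ⟨σ ^ 2, 1, 1 / 2, dbar, betaLadder B E⟩ f z x ω T)} := by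
  have hB0 : 0 < B := by linarith
  have hE0 : 0 < E := by linarith
  set p : Params := ⟨σ ^ 2, 1, 1 / 2, dbar, betaLadder B E⟩ with hpdef
  have hp : p.Regular := regular_halving hσ hd ⟨B, hB0, le_betaLadder hB0.le⟩
  -- The first epoch at which the ladder has left its descending branch.
  obtain ⟨i₀, hi₁, hi₀, hi₀'⟩ : ∃ i₀ : ℕ, 1 ≤ i₀ ∧ (∀ e, i₀ ≤ e → E ≤ (4 : ℝ) ^ (e - 1)) ∧
      ∀ e, 1 ≤ e → e < i₀ → (4 : ℝ) ^ (e - 1) < E := by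
    have hex : ∃ j : ℕ, E ≤ (4 : ℝ) ^ j := by
      obtain ⟨j, hj⟩ := pow_unbounded_of_one_lt E (show (1 : ℝ) < 4 by norm_num)
      exact ⟨j, hj.le⟩
    classical
    refine ⟨Nat.find hex + 1, by omega, fun e he => (Nat.find_spec hex).trans
      (pow_le_pow_right₀ (by norm_num) (by omega)), fun e he he' => ?_⟩
    exact not_le.1 (Nat.find_min hex (by omega))
  have hphase : ∀ ω t, N₀ ≤ t → (runState pb k p f z x ω t).M.Nonempty →
      i₀ ≤ (runState pb k p f z x ω t).epoch := fun ω t ht hM =>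
    le_epoch_of_betaLadder hk h1 hσ hd hB0 hE.le hi₀' (hN₀.trans ht) hM (hfirst ω t ht hM)
  have hprob := measure_not_confident_run_le_of_growth (p := p) (i₀ := i₀) (N₀ := N₀) (c₀ := B)
    (Λ := B) (C := 4 * E) (A := A) (u := fun e => max 1 (4 ^ (e - 1) / (4 * E))) (δ := δ)
    hk h1 hsub hp hmodel hrun hN₀ hphase hB0.le (fun e _ => le_betaLadder hB0.le e) hB
    (fun e _ => le_max_left _ _) (fun e he => betaLadder_of_le (hi₀ e he))
    ?_ ?_ ?_ (by positivity) hA hlog hbudget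
  · refine one_sub_le_measureReal hδ.le hprob fun ω hconf T hT => ?_
    refine accurate_of_width_le (t := N₀) hconf hT fun a ha => ?_
    exact width_le_of_betaLadder hk h1 hσ hd hB0 hE.le hε hEε
      (hi₀ _ (hphase ω N₀ le_rfl ⟨a, ha⟩)) (hfirst ω N₀ le_rfl ⟨a, ha⟩) ha
  · intro e _
    have h4 : (0 : ℝ) < 4 ^ (e - 1) := by positivity
    rw [hpdef, eta_halving_sq, ← div_eq_mul_inv, le_div_iff₀ h4, one_mul, mul_comm]
    exact (div_le_iff₀ (by positivity)).1 (le_max_right _ _)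
  · intro e _
    refine max_le_max le_rfl ?_
    gcongr
    · norm_num
    · omega
  · intro j
    rcases j with _ | j
    · have := le_max_left 1 ((4 : ℝ) ^ (i₀ + 0 - 1) / (4 * E))
      linarith
    · have h4 : E * 4 ^ j ≤ (4 : ℝ) ^ (i₀ + (j + 1) - 1) / 4 := by
        have h5 : E ≤ (4 : ℝ) ^ (i₀ - 1) := hi₀ i₀ le_rfl
        have h6 : (4 : ℝ) ^ (i₀ - 1) * 4 ^ (j + 1) ≤ 4 ^ (i₀ + (j + 1) - 1) := by
          rw [← pow_add]
          exact pow_le_pow_right₀ (by norm_num) (by omega)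
        have h7 := mul_le_mul_of_nonneg_right h5 (show (0 : ℝ) ≤ 4 ^ (j + 1) by positivity)
        rw [pow_succ] at h6 h7
        linarith
      have h5 : (4 : ℝ) ^ j ≤ 4 ^ (i₀ + (j + 1) - 1) / (4 * E) := by
        rw [le_div_iff₀ (by positivity)]
        linarith
      have h6 : (2 : ℝ) ^ j ≤ 4 ^ j := by gcongr; norm_num
      have h7 := le_max_right 1 ((4 : ℝ) ^ (i₀ + (j + 1) - 1) / (4 * E))
      rw [pow_succ]
      linarith

end Ladder

/-! ### Numerical consequences of the condition on the horizon. -/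

section Horizon

theorem betaT_pos {n : ℕ} (hn : 1 ≤ n) {δ : ℝ} (hδ : 0 < δ) (hδ1 : δ < 1) {T : ℕ} (hT : 1 ≤ T) :
    0 < betaT n δ T := by
  have hn' : (1 : ℝ) ≤ n := by exact_mod_cast hn
  have hT' : (1 : ℝ) ≤ T := by exact_mod_cast hT
  have hT2 : (1 : ℝ) ≤ (T : ℝ) ^ 2 := one_le_pow₀ hT'
  have hπ : (9 : ℝ) < Real.pi ^ 2 := by nlinarith [Real.pi_gt_three]
  refine mul_pos two_pos (Real.log_pos ?_)
  rw [lt_div_iff₀ (by positivity)]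
  have : (1 : ℝ) ≤ n * (T : ℝ) ^ 2 := one_le_mul_of_one_le_of_one_le hn' hT2
  nlinarith

theorem exp_neg_betaT {n : ℕ} (hn : 1 ≤ n) {δ : ℝ} (hδ : 0 < δ) {T : ℕ} (hT : 1 ≤ T) :
    n * Real.exp (-(betaT n δ T / 2)) ≤ 2 / 3 * δ / (T : ℝ) ^ 2 := by
  have hn' : (1 : ℝ) ≤ n := by exact_mod_cast hn
  have hT' : (1 : ℝ) ≤ T := by exact_mod_cast hT
  have hπ : (9 : ℝ) < Real.pi ^ 2 := by nlinarith [Real.pi_gt_three]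
  have hπ0 := Real.pi_pos
  rw [betaT, mul_div_cancel_left₀ _ two_ne_zero, Real.exp_neg, Real.exp_log (by positivity),
    inv_div]
  have : (n : ℝ) * (6 * δ / (n * (T : ℝ) ^ 2 * Real.pi ^ 2))
      = 6 * δ / (T : ℝ) ^ 2 / Real.pi ^ 2 := by
    field_simp
  rw [this, div_le_iff₀ (by positivity)]
  have h6 : 0 < δ / (T : ℝ) ^ 2 := by positivity
  have := mul_le_mul_of_nonneg_left hπ.le h6.le
  calc 6 * δ / (T : ℝ) ^ 2 = δ / (T : ℝ) ^ 2 * 9 * (2 / 3) := by ring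
    _ ≤ δ / (T : ℝ) ^ 2 * Real.pi ^ 2 * (2 / 3) := by gcongr
    _ = _ := by ring

/-- Supplies the constant 8 that the union bound over later epochs demands; it reduces to e⁴ ≤ 60
and 49·9 ≥ 360. -/
theorem eight_le_betaT {n : ℕ} (hn : 1 ≤ n) {δ : ℝ} (hδ : 0 < δ) (hδ1 : δ < 1) {T : ℕ}
    (hT : 7 ≤ T) : 8 ≤ betaT n δ T := by
  have hn' : (1 : ℝ) ≤ n := by exact_mod_cast hn
  have hT' : (7 : ℝ) ≤ T := by exact_mod_cast hT
  have hT2 : (49 : ℝ) ≤ (T : ℝ) ^ 2 := by nlinarith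
  have hπ : (9 : ℝ) < Real.pi ^ 2 := by nlinarith [Real.pi_gt_three]
  have hπ0 := Real.pi_pos
  have h4 : (4 : ℝ) ≤ Real.log (n * (T : ℝ) ^ 2 * Real.pi ^ 2 / (6 * δ)) := by
    rw [Real.le_log_iff_exp_le (by positivity), le_div_iff₀ (by positivity)]
    have he : Real.exp 4 ≤ 60 := by
      have := Real.exp_one_lt_d9
      calc Real.exp 4 = Real.exp 1 ^ 4 := by rw [← Real.exp_nat_mul]; norm_num
        _ ≤ 2.75 ^ 4 := by gcongr; linarith
        _ ≤ 60 := by norm_num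
    have h1 : (49 : ℝ) ≤ n * (T : ℝ) ^ 2 := by nlinarith
    have h2 : Real.exp 4 * (6 * δ) ≤ 60 * 6 := by
      have := Real.exp_pos 4
      nlinarith
    nlinarith
  unfold betaT
  linarith

/-- Elementary consequences of the condition on the time horizon. -/
theorem horizon_bounds {n d Y L : ℝ} (hn : 1 ≤ n) (hd : 0 < d) (hY : (1 + d) ^ 2 < Y)
    (hL : L = Real.log (n * Y / d ^ 2)) : 2 ≤ L * (1 + d) ∧ Real.log n ≤ L := by
  have hd2 : 0 < d ^ 2 := by positivity
  have hr : (1 + 1 / d) ^ 2 ≤ Y / d ^ 2 := by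
    rw [le_div_iff₀ hd2]
    refine le_trans (le_of_eq ?_) hY.le
    field_simp
    ring
  have hpos : 0 < 1 / d := by positivity
  have hY0 : 0 < Y := hY.trans_le' (by positivity)
  have hlog : Real.log n + 2 * Real.log (1 + 1 / d) ≤ L := by
    rw [hL, mul_div_assoc, Real.log_mul (by positivity) (by positivity)]
    have := Real.log_le_log (by positivity) hr
    rw [Real.log_pow] at this
    push_cast at this
    linarith
  have h1 : 0 ≤ Real.log (1 + 1 / d) := Real.log_nonneg (by linarith)
  have h2 := Real.one_sub_inv_le_log_of_pos (show 0 < 1 + 1 / d by positivity)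
  have h3 : (1 - (1 + 1 / d)⁻¹) * (1 + d) = 1 := by
    field_simp
    ring
  have h4 : 0 ≤ Real.log n := Real.log_nonneg hn
  refine ⟨?_, by linarith⟩
  have h5 := mul_le_mul_of_nonneg_right (h2.trans (show _ ≤ L / 2 by linarith))
    (show (0 : ℝ) ≤ 1 + d by linarith)
  rw [h3] at h5
  linarith

/-- Already one observation carries information ½ log(1 + σ⁻²), which is half the reciprocal of C₁.
-/
theorem half_le_C1_mul {σ g t : ℝ} (hσ : 0 < σ) (ht : 1 ≤ t)
    (hg : 1 / 2 * Real.log (1 + t / σ ^ 2) ≤ g) : 1 / 2 ≤ C1 σ * g := by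
  have hl : 0 < Real.log (1 + (σ ^ 2)⁻¹) := Real.log_pos (by
    have : 0 < (σ ^ 2)⁻¹ := by positivity
    linarith)
  have h2 : Real.log (1 + (σ ^ 2)⁻¹) ≤ Real.log (1 + t / σ ^ 2) := by
    refine Real.log_le_log (by positivity) ?_
    rw [div_eq_mul_inv]
    have : 0 < (σ ^ 2)⁻¹ := by positivity
    nlinarith
  rw [C1, one_div_mul_eq_div, le_div_iff₀ hl]
  linarith

/-- Controls the noise variance, which enters the crude epoch lengths but not the threshold. If t ≥
σ², then g ≥ ½ log 2 and C₁ ≥ σ² suffice. If t < σ², then C₁g ≥ t/4, which contradicts the last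
hypothesis. -/
theorem noise_mul_le {σ g t R : ℝ} (hσ : 0 < σ) (ht : 1 ≤ t)
    (hg : 1 / 2 * Real.log (1 + t / σ ^ 2) ≤ g) (hR : 1 ≤ R) (hle : 6 * (C1 σ * g) * R ≤ t) :
    2 * (σ ^ 2 * R) ≤ t := by
  have hs : 0 < σ ^ 2 := by positivity
  have hu : 0 < (σ ^ 2)⁻¹ := by positivity
  have hl : 0 < Real.log (1 + (σ ^ 2)⁻¹) := Real.log_pos (by linarith)
  have hlu : Real.log (1 + (σ ^ 2)⁻¹) ≤ (σ ^ 2)⁻¹ := by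
    have := Real.log_le_sub_one_of_pos (show 0 < 1 + (σ ^ 2)⁻¹ by positivity)
    linarith
  have hC1 : σ ^ 2 ≤ C1 σ := by
    rw [C1, le_div_iff₀ hl]
    calc σ ^ 2 * Real.log (1 + (σ ^ 2)⁻¹) ≤ σ ^ 2 * (σ ^ 2)⁻¹ := by gcongr
      _ = 1 := mul_inv_cancel₀ hs.ne'
  have hC0 : 0 < C1 σ := hs.trans_le hC1
  have hCg := mul_le_mul_of_nonneg_left hg hC0.le
  by_cases hts : σ ^ 2 ≤ t
  · have h2 : Real.log 2 ≤ Real.log (1 + t / σ ^ 2) := by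
      refine Real.log_le_log two_pos ?_
      have := (one_le_div hs).2 hts
      linarith
    have h3 := Real.log_two_gt_d9
    have h4 : σ ^ 2 * (1 / 3) ≤ C1 σ * g := by
      refine le_trans ?_ hCg
      exact mul_le_mul hC1 (by linarith) (by norm_num) hC0.le
    nlinarith
  · exfalso
    have h2 := Real.one_sub_inv_le_log_of_pos (show 0 < 1 + t / σ ^ 2 by positivity)
    have h3 : t / σ ^ 2 / 2 ≤ 1 - (1 + t / σ ^ 2)⁻¹ := by
      have h4 : t / σ ^ 2 ≤ 1 := (div_le_one hs).2 (not_le.1 hts).le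
      have h5 : 0 < t / σ ^ 2 := by positivity
      rw [le_sub_comm, inv_le_iff_one_le_mul₀ (by positivity)]
      nlinarith
    have h4 : t / 4 ≤ C1 σ * g := by
      refine le_trans ?_ hCg
      have h5 : t / 2 * Real.log (1 + (σ ^ 2)⁻¹) ≤ Real.log (1 + t / σ ^ 2) := by
        calc t / 2 * Real.log (1 + (σ ^ 2)⁻¹) ≤ t / 2 * (σ ^ 2)⁻¹ := by gcongr
          _ = t / σ ^ 2 / 2 := by ring
          _ ≤ _ := h3.trans h2
      rw [C1, one_div_mul_eq_div, le_div_iff₀ hl]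
      linarith
    nlinarith

/-- Exceptional probability for `κ = 3/2`. -/
theorem budget_three_half {n W L T b δ : ℝ} (hn : 1 ≤ n) (hL : 0 < L) (hW : 0 ≤ W) (hT : 7 ≤ T)
    (hδ : 0 < δ) (hδ1 : δ ≤ 1) (hx : n * Real.exp (-(b / 2)) ≤ 2 / 3 * δ / T ^ 2)
    (hWL : 2 * (W * L) ≤ T) (hLT : 28 * L ≤ T)
    (hW' : n = 1 ∧ 24 * W ≤ T ^ 2 ∨ n ≤ 3 ∧ W ≤ 3 / 4 * T ∧ 16 ≤ T) :
    n * ((T - 1) * Real.exp (-(3 / 2 * b / 2))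
      + 4 * ((n * (4 * (3 / 2 * W) + 1) * (L + 2.1) + 1) * Real.exp (-(3 / 2 * b / 2)))) ≤ δ := by
  have hT0 : 0 < T := by linarith
  set r := Real.exp (-(b / 4)) with hr
  have hr0 : 0 < r := Real.exp_pos _
  have hxr : Real.exp (-(b / 2)) = r ^ 2 := by
    rw [hr, ← Real.exp_nat_mul]
    congr 1
    push_cast
    ring
  have hxr3 : Real.exp (-(3 / 2 * b / 2)) = r ^ 2 * r := by
    rw [← hxr, hr, ← Real.exp_add]
    congr 1
    ring
  rw [hxr] at hx
  -- `0.82` bounds √(2/3) from above. Together with the factor `1.8` below it leaves 2/3 · 0.82 ·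
  -- 1.8 < 1.
  have hr1 : r * T ≤ 0.82 := by
    have h2 : r ^ 2 ≤ 2 / 3 * δ / T ^ 2 := le_trans (by nlinarith [sq_nonneg r]) hx
    rw [le_div_iff₀ (by positivity)] at h2
    refine le_of_sq_le_sq ?_ (by norm_num)
    rw [mul_pow]
    nlinarith
  have hstuff : (T - 1) + 4 * (n * (4 * (3 / 2 * W) + 1) * (L + 2.1) + 1) ≤ 1.8 * T ^ 3 := by
    have h1 : (4 * (3 / 2 * W) + 1) * (L + 2.1) ≤ 3 * T + 12.6 * W + T / 28 + 2.1 := by nlinarith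
    have hpos : 0 ≤ (4 * (3 / 2 * W) + 1) * (L + 2.1) := by positivity
    rcases hW' with ⟨rfl, hW2⟩ | ⟨hn3, hW2, hT2⟩
    · nlinarith [mul_nonneg hT0.le (sub_nonneg.2 hT), mul_nonneg (sq_nonneg T) (sub_nonneg.2 hT)]
    · have h2 : n * ((4 * (3 / 2 * W) + 1) * (L + 2.1)) ≤ 3 * (12.6 * T + 2.1) := by
        refine mul_le_mul hn3 (by linarith) hpos (by norm_num)
      nlinarith [mul_nonneg hT0.le (sub_nonneg.2 hT2), mul_nonneg (sq_nonneg T) (sub_nonneg.2 hT2)]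
  rw [hxr3]
  have hx2 : n * r ^ 2 * T ^ 2 ≤ 2 / 3 * δ := (le_div_iff₀ (by positivity)).1 hx
  calc n * ((T - 1) * (r ^ 2 * r)
        + 4 * ((n * (4 * (3 / 2 * W) + 1) * (L + 2.1) + 1) * (r ^ 2 * r)))
      = n * r ^ 2 * r * ((T - 1) + 4 * (n * (4 * (3 / 2 * W) + 1) * (L + 2.1) + 1)) := by ring
    _ ≤ n * r ^ 2 * r * (1.8 * T ^ 3) := by gcongr
    _ = n * r ^ 2 * T ^ 2 * (r * T * 1.8) := by ring
    _ ≤ 2 / 3 * δ * (0.82 * 1.8) := by gcongr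
    _ ≤ δ := by linarith

/-- Exceptional probability for `κ = 2`. -/
theorem budget_two {n W L T b δ : ℝ} (hn : 4 ≤ n) (hL : 0 < L) (hT : 7 ≤ T)
    (hδ : 0 < δ) (hδ1 : δ ≤ 1) (hx : n * Real.exp (-(b / 2)) ≤ 2 / 3 * δ / T ^ 2)
    (hWL : 2 * (W * L) ≤ T) (hLT : 28 * L ≤ T) (hW' : W ≤ T / 2) :
    n * ((T - 1) * Real.exp (-(2 * b / 2))
      + 4 * ((n * (4 * (2 * W) + 1) * (L + 2.1) + 1) * Real.exp (-(2 * b / 2)))) ≤ δ := by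
  have hT0 : 0 < T := by linarith
  set x := Real.exp (-(b / 2)) with hxdef
  have hx0 : 0 < x := Real.exp_pos _
  have hxx : Real.exp (-(2 * b / 2)) = x * x := by
    rw [hxdef, ← Real.exp_add]
    congr 1
    ring
  have hx2 : n * x * T ^ 2 ≤ 2 / 3 * δ := (le_div_iff₀ (by positivity)).1 hx
  have hstuff : (T - 1) + 4 * (n * (4 * (2 * W) + 1) * (L + 2.1) + 1) ≤ n * T ^ 4 := by
    have h1 : (4 * (2 * W) + 1) * (L + 2.1) ≤ 13 * T := by nlinarith
    have h2 := mul_le_mul_of_nonneg_left h1 (show 0 ≤ n by linarith)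
    have h3 : n * (343 * T) ≤ n * T ^ 4 := by
      have : (7 : ℝ) ^ 3 ≤ T ^ 3 := by gcongr
      gcongr
      nlinarith
    nlinarith
  rw [hxx]
  calc n * ((T - 1) * (x * x) + 4 * ((n * (4 * (2 * W) + 1) * (L + 2.1) + 1) * (x * x)))
      = n * x * x * ((T - 1) + 4 * (n * (4 * (2 * W) + 1) * (L + 2.1) + 1)) := by ring
    _ ≤ n * x * x * (n * T ^ 4) := by gcongr
    _ = (n * x * T ^ 2) * (n * x * T ^ 2) := by ring
    _ ≤ (2 / 3 * δ) * (2 / 3 * δ) := by gcongr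
    _ ≤ δ := by nlinarith

end Horizon

/-! ### The first epoch ends before the horizon. -/

section FirstEpoch

variable {D : Type*} [Fintype D] {k : D → D → ℝ} {σ dbar ε δ B E : ℝ} {pb : Problem}
  {x : ℕ → D} {y : ℕ → ℝ}

/-- Design size `m = ⌈2 * B * E * g⌉`, chosen so that the design meets the target of epoch 1.
Monotonicity of γ replaces γ_m by γ_T, whence the requirement `m ≤ T`. The epoch has `T - 1` steps,
since one more step is needed to use its intervals. -/
theorem two_le_epoch_of_gamma [Nonempty D] (hk : (Matrix.of k).PosSemidef)
    (h1 : ∀ a, k a a = 1) (hσ : 0 < σ) (hsub : SubmodularVarReduction k (σ ^ 2)) (hd : 0 < dbar)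
    (hB : 0 < B) (hE : 1 ≤ E)
    (hgr : ∀ t a, acq k ⟨σ ^ 2, 1, 1 / 2, dbar, betaLadder B E⟩ (fun i : Fin t => x i)
        (state pb k ⟨σ ^ 2, 1, 1 / 2, dbar, betaLadder B E⟩ x y t) a
      ≤ acq k ⟨σ ^ 2, 1, 1 / 2, dbar, betaLadder B E⟩ (fun i : Fin t => x i)
        (state pb k ⟨σ ^ 2, 1, 1 / 2, dbar, betaLadder B E⟩ x y t) (x t))
    {T : ℕ} (hT : 2 ≤ T) {Λ : ℝ} (hΛ : 0 ≤ Λ) (hg : 0 < C1 σ * gamma k (σ ^ 2) T)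
    (hC : 0 < C1 σ) (hm : 2 * (B * E) * (C1 σ * gamma k (σ ^ 2) T) + 1 ≤ T)
    (hmΛ : (2 * (B * E) * (C1 σ * gamma k (σ ^ 2) T) + 1) * Λ ≤ T - 1)
    (hexp : Fintype.card D * (B * E) * Real.exp (-Λ) ≤ (1 + dbar) ^ 2 - 1) {t : ℕ}
    (ht : T - 1 ≤ t)
    (hM : (state pb k ⟨σ ^ 2, 1, 1 / 2, dbar, betaLadder B E⟩ x y t).M.Nonempty) :
    2 ≤ (state pb k ⟨σ ^ 2, 1, 1 / 2, dbar, betaLadder B E⟩ x y t).epoch := by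
  set p : Params := ⟨σ ^ 2, 1, 1 / 2, dbar, betaLadder B E⟩ with hpdef
  have hp : p.Regular := regular_halving hσ hd ⟨B, hB, le_betaLadder hB.le⟩
  set g := C1 σ * gamma k (σ ^ 2) T
  have hBE : 0 < B * E := by positivity
  have hm0 : 0 < 2 * (B * E) * g := by positivity
  set m := ⌈2 * (B * E) * g⌉₊
  have hmpos : 0 < m := Nat.ceil_pos.2 hm0
  have hmr : (0 : ℝ) < m := by exact_mod_cast hmpos
  have hmle : 2 * (B * E) * g ≤ m := Nat.le_ceil _
  have hmlt : (m : ℝ) < 2 * (B * E) * g + 1 := Nat.ceil_lt_add_one hm0.le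
  have hmT : m ≤ T := by exact_mod_cast (hmlt.le.trans hm)
  have hη1 : p.eta 1 ^ 2 = 1 := by rw [hpdef, eta_halving_sq]; simp
  have hβ1 : p.beta 1 = B * E := betaLadder_one hE
  obtain ⟨X, hX⟩ := exists_design hk hσ h1 m
  refine epoch_ends (p := p) (e := 1) (n := T - 1) (t := 0) hk h1 hsub hp hgr hmpos X
    (fun a => ?_) ?_ le_rfl (by omega) (by omega) hM
  · rw [hη1, hβ1]
    have h2 : m * postVar k (σ ^ 2) X a ≤ 2 * g :=
      (hX a).trans (by
        have := mul_le_mul_of_nonneg_left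
          (gamma_mono hk (show 0 < σ ^ 2 by positivity) h1 hmT) hC.le
        linarith)
    have h3 := (mul_le_mul_of_nonneg_left h2 hBE.le).trans
      (show B * E * (2 * g) ≤ m by linarith)
    have h4 : B * E * postVar k (σ ^ 2) X a * m ≤ 1 * m := by linarith
    exact le_of_mul_le_mul_right h4 hmr
  · rw [hη1, hβ1, mul_one]
    refine (mul_le_mul_of_nonneg_left (Real.exp_le_exp.2 (neg_le_neg ?_))
      (by positivity)).trans hexp
    rw [le_div_iff₀ hmr, Nat.cast_sub (by omega), Nat.cast_one, mul_comm]
    exact (mul_le_mul_of_nonneg_right hmlt.le hΛ).trans hmΛ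

/-- On a one-point domain every query is the same and the variance is at most `σ ^ 2 / t`. The
greedy estimate is avoided because the logarithmic factor can be small here. -/
theorem two_le_epoch_of_subsingleton [Subsingleton D] (hk : (Matrix.of k).PosSemidef)
    (h1 : ∀ a, k a a = 1) (hσ : 0 < σ) (hd : 0 < dbar) (hB : 0 < B) (hE : 1 ≤ E) {N₀ t : ℕ}
    (hN₀ : 1 ≤ N₀) (hle : B * E * σ ^ 2 ≤ (1 + dbar) ^ 2 * N₀) (ht : N₀ ≤ t)
    (hM : (state pb k ⟨σ ^ 2, 1, 1 / 2, dbar, betaLadder B E⟩ x y t).M.Nonempty) :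
    2 ≤ (state pb k ⟨σ ^ 2, 1, 1 / 2, dbar, betaLadder B E⟩ x y t).epoch := by
  set p : Params := ⟨σ ^ 2, 1, 1 / 2, dbar, betaLadder B E⟩ with hpdef
  have hp : p.Regular := regular_halving hσ hd ⟨B, hB, le_betaLadder hB.le⟩
  have h0 := one_le_state_epoch (pb := pb) (k := k) (p := p) (x := x) (y := y) t
  by_contra hcon
  have he : (state pb k p x y t).epoch = 1 := by omega
  have hnot := not_epochDone_epoch hk h1 hp (hN₀.trans ht) hM
  rw [he] at hnot
  refine hnot fun a _ => ?_
  have hη := hp.eta_pos 1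
  rw [sqrt_mul_sqrt_le_iff (hp.beta_pos _).le (by positivity), mul_pow, hpdef, eta_halving_sq]
  simp only [Nat.sub_self, pow_zero, inv_one, mul_one]
  rw [betaLadder_one hE]
  have hv := postVar_const_le hk hp.s2_pos h1 (hN₀.trans ht) a
  rw [show (fun i : Fin t => x i) = fun _ => a from funext fun _ => Subsingleton.elim _ _]
  have htr : (1 : ℝ) ≤ t := by exact_mod_cast hN₀.trans ht
  have htN : (N₀ : ℝ) ≤ t := by exact_mod_cast ht
  have hBE : 0 < B * E := by positivity
  refine (mul_le_mul_of_nonneg_left hv hBE.le).trans ?_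
  rw [← mul_div_assoc, div_le_iff₀ (by linarith)]
  exact hle.trans (by gcongr)

end FirstEpoch

/-! ### Choice of κ and accuracy for one horizon. -/

section Accuracy

variable {D : Type*} [Fintype D] [Nonempty D] {k : D → D → ℝ} {σ dbar ε δ : ℝ}

theorem one_le_card : 1 ≤ Fintype.card D := Fintype.card_pos

theorem two_le_ceil_logb {w : ℝ} (hw : 2 < w) : (2 : ℝ) ≤ (⌈Real.logb 2 w⌉ : ℝ) := by
  have h : (1 : ℤ) < ⌈Real.logb 2 w⌉ := by
    rw [Int.lt_ceil, Int.cast_one, Real.lt_logb_iff_rpow_lt (by norm_num) (by linarith)]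
    simpa using hw
  exact_mod_cast h

theorem logFactor_eq (n : ℕ) (dbar ε δ : ℝ) (T : ℕ) : logFactor n dbar ε δ T
    = Real.log (n * (16 * (1 + dbar) ^ 2 / ε ^ 2 * betaT n δ T) / dbar ^ 2) := by
  unfold logFactor
  congr 1
  rw [mul_comm (dbar ^ 2), ← div_div]
  ring

theorem C1_pos (hσ : 0 < σ) : 0 < C1 σ := by
  have : 0 < (σ ^ 2)⁻¹ := by positivity
  exact one_div_pos.2 (Real.log_pos (by linarith))

/-- A horizon above the threshold suffices for the ladder parameters with `B = κ β_T`, when these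
pass the first epoch in time and are large enough for the union bound. -/
theorem accurate_of_ladder (hk : (Matrix.of k).PosSemidef) (h1 : ∀ a, k a a = 1)
    (hσ : 0 < σ) (hsub : SubmodularVarReduction k (σ ^ 2)) (hd : 0 < dbar) (hε : 0 < ε)
    (hδ : 0 < δ) {b E κ L : ℝ} {T : ℕ} (hT : 2 ≤ T) (hb : 8 ≤ b) (hE : 1 < E)
    (hEε : 16 * (1 + dbar) ^ 2 = E * ε ^ 2) (hκ1 : 1 ≤ κ) (hκ2 : κ ≤ 2) (hL0 : 0 ≤ L)
    (hL : L = Real.log (Fintype.card D * (E * b) / dbar ^ 2))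
    (hbudget : Fintype.card D * ((T - 1) * Real.exp (-(κ * b / 2))
      + 4 * ((Fintype.card D * (4 * (κ * (σ ^ 2 * (E * b))) + 1) * (L + 2.1) + 1)
        * Real.exp (-(κ * b / 2)))) ≤ δ)
    {Ω : Type*} [MeasurableSpace Ω] {P : Measure Ω} [IsProbabilityMeasure P] {pb : Problem}
    {f : D → Ω → ℝ} {z : ℕ → Ω → ℝ} {x : ℕ → Ω → D} (hmodel : IsModel P k (σ ^ 2) f z)
    (hrun : IsRun pb k ⟨σ ^ 2, 1, 1 / 2, dbar, betaLadder (κ * b) E⟩ f z x)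
    (hfirst : ∀ ω t, T - 1 ≤ t →
      (runState pb k ⟨σ ^ 2, 1, 1 / 2, dbar, betaLadder (κ * b) E⟩ f z x ω t).M.Nonempty →
      2 ≤ (runState pb k ⟨σ ^ 2, 1, 1 / 2, dbar, betaLadder (κ * b) E⟩ f z x ω t).epoch) :
    1 - δ ≤ P.real {ω | ∀ t : ℕ, T ≤ t → Accurate pb ε (fun a => f a ω)
      (runState pb k ⟨σ ^ 2, 1, 1 / 2, dbar, betaLadder (κ * b) E⟩ f z x ω t)} := by
  have hn : (1 : ℝ) ≤ Fintype.card D := by exact_mod_cast one_le_card (D := D)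
  have hb0 : 0 < b := by linarith
  have hE0 : 0 < E := by linarith
  have h := accurate_of_first_epoch (B := κ * b) (E := E) (N₀ := T - 1) (A := L + 2.1) hk h1 hσ
    hsub hd hε hδ (by nlinarith) hE hEε (by omega) (by linarith) ?_ ?_ hmodel hrun hfirst
  · rwa [Nat.sub_add_cancel (by omega : 1 ≤ T)] at h
  -- Origin of the constant 2.1: the factor 8 from κ ≤ 2 and `4 * E` adds 3 log 2 < 2.1 to `L`.
  · have h8 : Fintype.card D * (κ * b) * (4 * E) / ((1 + dbar) ^ 2 - 1)
        ≤ 2 ^ 3 * (Fintype.card D * (E * b) / dbar ^ 2) := by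
      calc Fintype.card D * (κ * b) * (4 * E) / ((1 + dbar) ^ 2 - 1)
          ≤ Fintype.card D * (2 * b) * (4 * E) / dbar ^ 2 := by
            gcongr
            nlinarith
        _ = _ := by ring
    have hq : 0 < (1 + dbar) ^ 2 - 1 := by nlinarith
    refine (Real.log_le_log (by positivity) h8).trans ?_
    rw [Real.log_mul (by positivity) (by positivity), ← hL, Real.log_pow]
    have := Real.log_two_lt_d9
    push_cast
    linarith
  · rw [Nat.cast_sub (by omega), Nat.cast_one]
    refine le_trans (le_of_eq ?_) hbudget
    ring

theorem horizon_consequences {d Y L g c t : ℝ} (hd : 0 < d) (hY : (1 + d) ^ 2 < Y)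
    (hL2 : 2 ≤ L * (1 + d)) (hg : 1 / 2 ≤ g) (hc : 2 ≤ c) (ht : (6 * (g * Y) + 2 * c) * L ≤ t) :
    0 < L ∧ 6 * g * (Y * L) + 4 * L ≤ t ∧ 3 * (Y * L) + 4 * L ≤ t ∧ 2 * (1 + d) ≤ Y * L ∧
      6 < t := by
  have hd1 : 0 < 1 + d := by linarith
  have hL0 : 0 < L := pos_of_mul_pos_left (by linarith) hd1.le
  have hY0 : 0 < Y := hY.trans_le' (by positivity)
  have hYL : 2 * (1 + d) ≤ Y * L := by
    have h1 := mul_le_mul_of_nonneg_right hY.le hL0.le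
    have h2 := mul_le_mul_of_nonneg_left hL2 hd1.le
    linarith
  have h1 := mul_le_mul_of_nonneg_right hc hL0.le
  have h2 := mul_le_mul_of_nonneg_right hg (mul_pos hY0 hL0).le
  refine ⟨hL0, by linarith, by linarith, hYL, by linarith⟩

/-- For κ = 3/2, with `l` = log κ: the additional logarithm is absorbed since `l ≤ L`, which doubles
3 into the 6 of the threshold. -/
theorem design_size_three_half {g Y L l t : ℝ} (h0 : 0 ≤ g * Y) (hL : Real.log 2 ≤ L)
    (hl : l ≤ 1 / 2) (ht : 6 * g * (Y * L) + 4 * L ≤ t) :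
    3 * (g * Y) + 1 ≤ t ∧ (3 * (g * Y) + 1) * (L + l) ≤ t - 1 := by
  have hlog2 := Real.log_two_gt_d9
  have h1 := mul_le_mul_of_nonneg_left (show l ≤ L by linarith) h0
  have h2 := mul_le_mul_of_nonneg_left (show 1 / 2 ≤ L by linarith) h0
  constructor <;> linarith

/-- For κ = 2: 4(L + log 2) ≤ 6L holds exactly when L ≥ 2 log 2. -/
theorem design_size_two {g Y L t : ℝ} (h0 : 0 ≤ g * Y) (hL : 2 * Real.log 2 ≤ L)
    (ht : 6 * g * (Y * L) + 4 * L ≤ t) :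
    4 * (g * Y) + 1 ≤ t ∧ (4 * (g * Y) + 1) * (L + Real.log 2) ≤ t - 1 := by
  have hlog2 := Real.log_two_gt_d9
  have hlog2' := Real.log_two_lt_d9
  have h1 := mul_le_mul_of_nonneg_left (show 2 * Real.log 2 ≤ L from hL) h0
  have h2 := mul_le_mul_of_nonneg_left (show 1 ≤ L by linarith) h0
  constructor <;> linarith

/-- Choice of the factor `κ` by which the ladder parameters exceed `β_T`. -/
theorem exists_ladder_factor (hk : (Matrix.of k).PosSemidef) (h1 : ∀ a, k a a = 1)
    (hσ : 0 < σ) (hsub : SubmodularVarReduction k (σ ^ 2)) (hd : 0 < dbar)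
    (hδ : 0 < δ) (hδ1 : δ < 1) {b E L : ℝ} {T : ℕ} (hT7 : 7 ≤ T) (hb : 8 ≤ b) (hE : 1 < E)
    (hx : Fintype.card D * Real.exp (-(b / 2)) ≤ 2 / 3 * δ / (T : ℝ) ^ 2)
    (hL : L = Real.log (Fintype.card D * (E * b) / dbar ^ 2)) (hL0 : 0 < L)
    (hL2 : 2 ≤ L * (1 + dbar)) (hLn : Real.log (Fintype.card D) ≤ L)
    (hg : 0 < C1 σ * gamma k (σ ^ 2) T)
    (hT : 6 * (C1 σ * gamma k (σ ^ 2) T) * (E * b * L) + 4 * L ≤ T)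
    (hYT : 3 * (E * b * L) + 4 * L ≤ T) (hYL : 2 * (1 + dbar) ≤ E * b * L)
    (hWL : 2 * (σ ^ 2 * (E * b) * L) ≤ T) :
    ∃ κ : ℝ, 1 ≤ κ ∧ κ ≤ 2 ∧
      Fintype.card D * ((T - 1) * Real.exp (-(κ * b / 2))
        + 4 * ((Fintype.card D * (4 * (κ * (σ ^ 2 * (E * b))) + 1) * (L + 2.1) + 1)
          * Real.exp (-(κ * b / 2)))) ≤ δ ∧
      ∀ (pb : Problem) (x : ℕ → D) (y : ℕ → ℝ),
        (∀ t a, acq k ⟨σ ^ 2, 1, 1 / 2, dbar, betaLadder (κ * b) E⟩ (fun i : Fin t => x i)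
            (state pb k ⟨σ ^ 2, 1, 1 / 2, dbar, betaLadder (κ * b) E⟩ x y t) a
          ≤ acq k ⟨σ ^ 2, 1, 1 / 2, dbar, betaLadder (κ * b) E⟩ (fun i : Fin t => x i)
            (state pb k ⟨σ ^ 2, 1, 1 / 2, dbar, betaLadder (κ * b) E⟩ x y t) (x t)) →
        ∀ t, T - 1 ≤ t →
          (state pb k ⟨σ ^ 2, 1, 1 / 2, dbar, betaLadder (κ * b) E⟩ x y t).M.Nonempty →
          2 ≤ (state pb k ⟨σ ^ 2, 1, 1 / 2, dbar, betaLadder (κ * b) E⟩ x y t).epoch := by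
  have hn1 := one_le_card (D := D)
  have hn : (1 : ℝ) ≤ Fintype.card D := by exact_mod_cast hn1
  have hT7r : (7 : ℝ) ≤ T := by exact_mod_cast hT7
  have hb0 : 0 < b := by linarith
  have hC1 := C1_pos hσ
  have hY8 : 8 * L ≤ E * b * L := by
    have h2 := mul_le_mul_of_nonneg_right hE.le hb0.le
    exact mul_le_mul_of_nonneg_right (by linarith) hL0.le
  have hLT : 28 * L ≤ T := by linarith
  have hW0 : 0 ≤ σ ^ 2 * (E * b) := by positivity
  have hgY : 0 ≤ C1 σ * gamma k (σ ^ 2) T * (E * b) := by positivity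
  -- `L` is the logarithm of the initial excess bound over δ̄², up to κ, so decay by `L + log κ`
  -- leaves exactly δ̄².
  have hexp : ∀ κ : ℝ, 0 < κ →
      Fintype.card D * (κ * b * E) * Real.exp (-(L + Real.log κ)) ≤ (1 + dbar) ^ 2 - 1 := by
    intro κ hκ
    rw [hL, ← Real.log_mul (by positivity) (by positivity), Real.exp_neg,
      Real.exp_log (by positivity)]
    refine le_trans (le_of_eq ?_) (show dbar ^ 2 ≤ (1 + dbar) ^ 2 - 1 by nlinarith)
    field_simp
  have hlog2 := Real.log_two_gt_d9
  -- A large domain needs κ = 2, as the later epochs cost an extra factor |D|; |D| ≥ 4 then provides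
  -- L ≥ log 4. For |D| = 2, 3 only L ≥ log 2 is available, and κ = 3/2 suffices.
  rcases lt_or_ge 3 (Fintype.card D) with hn4 | hn3
  · have hn4r : (4 : ℝ) ≤ Fintype.card D := by exact_mod_cast hn4
    have hL4 : 2 * Real.log 2 ≤ L := by
      refine le_trans ?_ hLn
      rw [← Nat.cast_two, ← Real.log_pow]
      exact Real.log_le_log (by positivity) (by norm_num; exact hn4)
    obtain ⟨hm, hmΛ⟩ := design_size_two hgY hL4 hT
    have hW : σ ^ 2 * (E * b) ≤ T / 2 := by
      have := mul_le_mul_of_nonneg_left (show 1 ≤ L by linarith) hW0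
      linarith
    exact ⟨2, by norm_num, le_rfl, budget_two hn4r hL0 hT7r hδ hδ1.le hx hWL hLT hW,
      fun pb x y hgr t ht hM => two_le_epoch_of_gamma (T := T) hk h1 hσ hsub hd (by positivity)
        hE.le hgr (by omega) (show 0 ≤ L + Real.log 2 by linarith) hg hC1 (by linarith)
        (by linarith) (hexp 2 two_pos) ht hM⟩
  have hn3r : (Fintype.card D : ℝ) ≤ 3 := by exact_mod_cast hn3
  rcases hn1.eq_or_lt with hn1 | hn2
  · have hsing : Subsingleton D := Fintype.card_le_one_iff_subsingleton.1 hn1.ge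
    have hWT : 4 * (σ ^ 2 * (E * b)) ≤ T * (1 + dbar) := by
      have h2 := mul_le_mul_of_nonneg_left hL2 hW0
      have h3 := mul_le_mul_of_nonneg_right hWL (show 0 ≤ 1 + dbar by linarith)
      linarith
    have hdT : 6 * (1 + dbar) ≤ T := by linarith
    refine ⟨3 / 2, by norm_num, by norm_num, budget_three_half hn hL0 hW0 hT7r hδ hδ1.le hx hWL
      hLT (Or.inl ⟨by exact_mod_cast hn1.symm, ?_⟩), fun pb x y _ t ht hM =>
      two_le_epoch_of_subsingleton hk h1 hσ hd (by positivity) hE.le (by omega) ?_ ht hM⟩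
    · have := mul_le_mul_of_nonneg_left hdT (show (0 : ℝ) ≤ T by positivity)
      linarith
    · rw [Nat.cast_sub (by omega), Nat.cast_one]
      have h2 := mul_le_mul_of_nonneg_left (show 1 ≤ 1 + dbar by linarith)
        (show 0 ≤ (1 + dbar) * (T - 1) by nlinarith)
      have h3 := mul_le_mul_of_nonneg_left hT7r hd.le
      linarith
  · have hn2r : (2 : ℝ) ≤ Fintype.card D := by exact_mod_cast hn2
    have hL4 : Real.log 2 ≤ L := (Real.log_le_log two_pos hn2r).trans hLn
    have hlog32 : Real.log (3 / 2) ≤ 1 / 2 := by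
      have := Real.log_le_sub_one_of_pos (show (0 : ℝ) < 3 / 2 by norm_num)
      linarith
    have hlog32' : 0 ≤ Real.log (3 / 2) := Real.log_nonneg (by norm_num)
    obtain ⟨hm, hmΛ⟩ := design_size_three_half hgY hL4 hlog32 hT
    have hW : σ ^ 2 * (E * b) ≤ 3 / 4 * T := by
      have := mul_le_mul_of_nonneg_left (show 0.69 ≤ L by linarith) hW0
      linarith
    exact ⟨3 / 2, by norm_num, by norm_num, budget_three_half hn hL0 hW0 hT7r hδ hδ1.le hx hWL
      hLT (Or.inr ⟨hn3r, hW, by linarith⟩),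
      fun pb x y hgr t ht hM => two_le_epoch_of_gamma (T := T) hk h1 hσ hsub hd (by positivity)
        hE.le hgr (by omega) (show 0 ≤ L + Real.log (3 / 2) by linarith) hg hC1 (by linarith)
        (by linarith) (hexp (3 / 2) (by norm_num)) ht hM⟩

/-- Main theorem on accuracy: if `T` satisfies the condition on the horizon, then the parameters
`β` can be chosen such that the algorithm is accurate from time `T` on. -/
theorem exists_beta_of_threshold_le (hk : (Matrix.of k).PosSemidef) (h1 : ∀ a, k a a = 1)
    (hσ : 0 < σ) (hsub : SubmodularVarReduction k (σ ^ 2)) (hd : 0 < dbar)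
    (hε : 0 < ε) (hε' : ε < 4 * (1 + dbar)) (hδ : 0 < δ) (hδ1 : δ < 1) {T : ℕ} (hT1 : 1 ≤ T)
    (hT : threshold k σ dbar ε δ T ≤ T) :
    ∃ β : ℕ → ℝ, (∃ b, 0 < b ∧ ∀ i, b ≤ β i) ∧
      ∀ (pb : Problem) (Ω : Type*) [MeasurableSpace Ω] (P : Measure Ω)
        [IsProbabilityMeasure P] (f : D → Ω → ℝ) (z : ℕ → Ω → ℝ) (x : ℕ → Ω → D),
        IsModel P k (σ ^ 2) f z → IsRun pb k ⟨σ ^ 2, 1, 1 / 2, dbar, β⟩ f z x →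
        1 - δ ≤ P.real {ω | ∀ t : ℕ, T ≤ t → Accurate pb ε (fun a => f a ω)
          (runState pb k ⟨σ ^ 2, 1, 1 / 2, dbar, β⟩ f z x ω t)} := by
  have hn1 := one_le_card (D := D)
  have hn : (1 : ℝ) ≤ Fintype.card D := by exact_mod_cast hn1
  have hTr : (1 : ℝ) ≤ T := by exact_mod_cast hT1
  have hb := betaT_pos hn1 hδ hδ1 hT1
  have hx := exp_neg_betaT hn1 hδ hT1
  have hlogF := logFactor_eq (Fintype.card D) dbar ε δ T
  have h8 := fun h => eight_le_betaT (T := T) hn1 hδ hδ1 h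
  rw [threshold] at hT
  set b := betaT (Fintype.card D) δ T
  obtain ⟨E, hEdef⟩ : ∃ E, E = 16 * (1 + dbar) ^ 2 / ε ^ 2 := ⟨_, rfl⟩
  have hEε : 16 * (1 + dbar) ^ 2 = E * ε ^ 2 := by
    rw [hEdef]
    field_simp
  have hE : 1 < E := by
    rw [hEdef, lt_div_iff₀ (by positivity)]
    nlinarith
  rw [← hEdef] at hlogF
  set L := logFactor (Fintype.card D) dbar ε δ T
  -- This is equivalent to 16b ≤ ε². In the other case the lower bound on `E * b` keeps `L` away
  -- from zero, which makes the horizon at least 7.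
  by_cases hY : E * b ≤ (1 + dbar) ^ 2
  · obtain ⟨β, hβ, h⟩ := exists_beta_of_prior_accurate hk h1 hσ hsub hd hε hε' hδ hb
      (by
        have := mul_le_mul_of_nonneg_right hY (sq_nonneg ε)
        have h16 : E * ε ^ 2 * b ≤ (1 + dbar) ^ 2 * ε ^ 2 := by linarith
        rw [← hEε] at h16
        have hq : 0 < (1 + dbar) ^ 2 := by positivity
        exact le_of_mul_le_mul_left (by linarith) hq)
      (hx.trans (div_le_self (by positivity) (one_le_pow₀ hTr)))
    refine ⟨β, hβ, fun pb Ω _ P _ f z x hmodel hrun => (h pb Ω P f z x hmodel hrun).trans ?_⟩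
    exact measureReal_mono fun ω hω t ht => hω t (hT1.trans ht)
  rw [not_le] at hY
  obtain ⟨hL2, hLn⟩ := horizon_bounds hn hd hY hlogF
  have hγ := half_log_le_gamma (k := k) (s2 := σ ^ 2) h1 T
  have hg := half_le_C1_mul hσ hTr hγ
  have hc := two_le_ceil_logb (w := 8 * (1 + dbar) / ε) (by
    rw [lt_div_iff₀ hε]
    linarith)
  have h96 : C1 σ * gamma k (σ ^ 2) T * b * (96 * (1 + dbar) ^ 2 / ε ^ 2)
      = 6 * (C1 σ * gamma k (σ ^ 2) T * (E * b)) := by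
    rw [hEdef]
    ring
  rw [h96] at hT
  obtain ⟨hL0, hT', hYT, hYL, hT6⟩ := horizon_consequences hd hY hL2 hg hc hT
  have hnoise := noise_mul_le (R := E * b * L) hσ hTr hγ (by linarith) (by linarith)
  have hT7 : 7 ≤ T := by exact_mod_cast hT6
  obtain ⟨κ, hκ1, hκ2, hbudget, hfirst⟩ := exists_ladder_factor hk h1 hσ hsub hd hδ hδ1 hT7
    (h8 hT7) hE hx hlogF hL0 hL2 hLn (by linarith) hT' hYT hYL (by linarith)
  have hκb : 0 < κ * b := by positivity
  exact ⟨betaLadder (κ * b) E, ⟨κ * b, hκb, le_betaLadder hκb.le⟩,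
    fun pb Ω _ P _ f z x hmodel hrun => accurate_of_ladder hk h1 hσ hsub hd hε hδ (by omega)
      (h8 hT7) hE hEε hκ1 hκ2 hL0.le hlogF hbudget hmodel hrun fun ω t ht hM =>
      hfirst pb _ _ (fun t a => hrun.greedy t ω a) t ht hM⟩

end Accuracy

/-! ### Comparison of the threshold with the rate. -/

section Rate

theorem log_le_posLog (w : ℝ) : Real.log w ≤ Real.posLog w := le_max_right _ _

/-- The threshold is the rate up to a constant and squared logarithmic terms. -/
theorem threshold_le_of_bounds {q g c l K₁ K₂ p ℓ r : ℝ} (hq : 1 ≤ q) (hg : 0 ≤ g) (hc : 0 ≤ c)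
    (hp : 0 ≤ p) (hℓ : 0 ≤ ℓ) (hr : 0 ≤ r) (hK₁ : 0 ≤ K₁) (hK₂ : 0 ≤ K₂)
    (hcle : c ≤ K₁ + 2 * p) (hl : l ≤ K₂ + 2 * p + ℓ + r) :
    (96 * q * g + 2 * c) * l
      ≤ (96 * q + 2 * K₁ + 4) * (K₂ + 2) * (g + 1) * (1 + p + ℓ + r) ^ 2 := by
  have h0 : 0 ≤ 96 * q * g + 2 * c := by positivity
  have hS : 1 ≤ 1 + p + ℓ + r := by linarith
  have h1 : l ≤ (K₂ + 2) * (1 + p + ℓ + r) := by nlinarith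
  have h2 : 96 * q * g + 2 * c ≤ (96 * q + 2 * K₁ + 4) * (g + 1) * (1 + p + ℓ + r) := by
    have h3 : 2 * c ≤ (2 * K₁ + 4) * (1 + p + ℓ + r) := by nlinarith
    have h4 : 96 * q * g ≤ 96 * q * (g + 1) * (1 + p + ℓ + r) := by
      have : 96 * q * g * 1 ≤ 96 * q * (g + 1) * (1 + p + ℓ + r) := by gcongr; linarith
      linarith
    have h5 : (2 * K₁ + 4) * 1 * (1 + p + ℓ + r) ≤ (2 * K₁ + 4) * (g + 1) * (1 + p + ℓ + r) := by
      gcongr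
      linarith
    linarith
  calc (96 * q * g + 2 * c) * l
      ≤ (96 * q * g + 2 * c) * ((K₂ + 2) * (1 + p + ℓ + r)) := by gcongr
    _ ≤ (96 * q + 2 * K₁ + 4) * (g + 1) * (1 + p + ℓ + r) * ((K₂ + 2) * (1 + p + ℓ + r)) := by
        gcongr
    _ = _ := by ring

theorem ceil_logb_le {d ε : ℝ} (hd : 0 < d) (hε : 0 < ε) :
    (⌈Real.logb 2 (8 * (1 + d) / ε)⌉ : ℝ)
      ≤ Real.logb 2 (8 * (1 + d)) + 1 + 2 * Real.posLog (1 / ε) := by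
  have hlog2 := Real.log_two_gt_d9
  have h1 : Real.logb 2 (8 * (1 + d) / ε)
      = Real.logb 2 (8 * (1 + d)) + Real.log (1 / ε) / Real.log 2 := by
    rw [← mul_one_div, Real.logb_mul (by positivity) (by positivity)]
    rfl
  -- The factor 2 only uses log 2 ≥ 1/2.
  have h2 : Real.log (1 / ε) / Real.log 2 ≤ 2 * Real.posLog (1 / ε) := by
    rw [div_le_iff₀ (by linarith)]
    have h3 := log_le_posLog (1 / ε)
    have h4 : 0 ≤ Real.posLog (1 / ε) := Real.posLog_nonneg
    nlinarith
  have := (Int.ceil_lt_add_one (Real.logb 2 (8 * (1 + d) / ε))).le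
  linarith

theorem logFactor_le {n : ℕ} (hn : 1 ≤ n) {d ε δ : ℝ} (hd : 0 < d) (hε : 0 < ε) {T : ℕ}
    (hb : 0 < betaT n δ T) : logFactor n d ε δ T ≤ Real.log (16 * (1 + d) ^ 2 / d ^ 2)
      + 2 * Real.posLog (1 / ε) + Real.log n + Real.posLog (betaT n δ T) := by
  have hn' : (0 : ℝ) < n := by exact_mod_cast hn
  have h1 : 16 * (1 + d) ^ 2 * n * betaT n δ T / (d ^ 2 * ε ^ 2)
      = 16 * (1 + d) ^ 2 / d ^ 2 * (1 / ε) ^ 2 * n * betaT n δ T := by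
    field_simp
  rw [logFactor, h1, Real.log_mul (by positivity) hb.ne', Real.log_mul (by positivity) hn'.ne',
    Real.log_mul (by positivity) (by positivity), Real.log_pow]
  have h2 := log_le_posLog (1 / ε)
  have h3 := log_le_posLog (betaT n δ T)
  push_cast
  linarith

variable {D : Type*} [Fintype D] {k : D → D → ℝ} {σ dbar ε δ : ℝ}

theorem threshold_eq (k : D → D → ℝ) (σ dbar ε δ : ℝ) (T : ℕ) :
    threshold k σ dbar ε δ T = (96 * (1 + dbar) ^ 2 * (rate k σ ε δ T - 1)
      + 2 * (⌈Real.logb 2 (8 * (1 + dbar) / ε)⌉ : ℝ)) * logFactor (Fintype.card D) dbar ε δ T := by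
  unfold threshold rate
  ring

variable [Nonempty D]

theorem one_le_rate (h1 : ∀ a, k a a = 1) (hσ : 0 < σ) (hδ : 0 < δ)
    (hδ1 : δ < 1) {T : ℕ} (hT : 1 ≤ T) : 1 ≤ rate k σ ε δ T := by
  have hb := betaT_pos (one_le_card (D := D)) hδ hδ1 hT
  have hg := half_le_C1_mul hσ (by exact_mod_cast hT)
    (half_log_le_gamma (k := k) (s2 := σ ^ 2) h1 T)
  have : 0 ≤ C1 σ * gamma k (σ ^ 2) T * betaT (Fintype.card D) δ T / ε ^ 2 := by
    have : 0 ≤ C1 σ * gamma k (σ ^ 2) T := by linarith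
    positivity
  unfold rate
  linarith

theorem threshold_le_rate (h1 : ∀ a, k a a = 1) (hσ : 0 < σ) (hd : 0 < dbar)
    (hε : 0 < ε) (hε' : ε < 4 * (1 + dbar)) (hδ : 0 < δ) (hδ1 : δ < 1) {T : ℕ} (hT : 1 ≤ T) :
    threshold k σ dbar ε δ T
      ≤ (96 * (1 + dbar) ^ 2 + 2 * (Real.logb 2 (8 * (1 + dbar)) + 1) + 4)
        * (Real.log (16 * (1 + dbar) ^ 2 / dbar ^ 2) + 2) * rate k σ ε δ T *
        (1 + Real.posLog (1 / ε) + Real.log (Fintype.card D)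
          + Real.posLog (betaT (Fintype.card D) δ T)) ^ 2 := by
  have hr := one_le_rate (k := k) (ε := ε) h1 hσ hδ hδ1 hT
  have hn := one_le_card (D := D)
  have hc := two_le_ceil_logb (w := 8 * (1 + dbar) / ε) (by
    rw [lt_div_iff₀ hε]
    linarith)
  have h := threshold_le_of_bounds (q := (1 + dbar) ^ 2) (g := rate k σ ε δ T - 1)
    (one_le_pow₀ (by linarith)) (by linarith) (by linarith) Real.posLog_nonneg
    (Real.log_nonneg (by exact_mod_cast hn)) Real.posLog_nonneg
    (add_nonneg (Real.logb_nonneg (by norm_num) (by linarith)) zero_le_one)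
    (Real.log_nonneg (by
      rw [le_div_iff₀ (by positivity)]
      nlinarith))
    (ceil_logb_le hd hε) (logFactor_le hn hd hε (betaT_pos hn hδ hδ1 hT))
  rw [sub_add_cancel] at h
  rw [threshold_eq]
  exact h

theorem rate_le_threshold (h1 : ∀ a, k a a = 1) (hσ : 0 < σ) (hd : 0 < dbar)
    (hε : 0 < ε) (hε' : ε < 4 * (1 + dbar)) (hδ : 0 < δ) (hδ1 : δ < 1) {T : ℕ} (hT : 1 ≤ T)
    (hl : 1 ≤ logFactor (Fintype.card D) dbar ε δ T) :
    rate k σ ε δ T ≤ threshold k σ dbar ε δ T := by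
  have hr := one_le_rate (k := k) (ε := ε) h1 hσ hδ hδ1 hT
  have hc := two_le_ceil_logb (w := 8 * (1 + dbar) / ε) (by
    rw [lt_div_iff₀ hε]
    linarith)
  have hq : 1 ≤ (1 + dbar) ^ 2 := one_le_pow₀ (by linarith)
  have h2 := mul_le_mul_of_nonneg_right hq (sub_nonneg.2 hr)
  rw [threshold_eq]
  -- The summand 1 of the rate is covered by twice the ceiling, which is at least 4.
  refine le_trans ?_ (le_mul_of_one_le_right (by nlinarith) hl)
  linarith

end Rate

end TruVaR

/-! ### The theorem: one sequence β for all horizons. -/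

theorem corollary4 (dbar : ℝ) (hdbar : 0 < dbar) :
    ∃ K : ℝ, 0 < K ∧
      ∀ (D : Type*) [Fintype D] [Nonempty D] (k : D → D → ℝ) (σ ε δ : ℝ),
        (Matrix.of k).PosSemidef → (∀ a, k a a = 1) → 0 < σ →
        TruVaR.SubmodularVarReduction k (σ ^ 2) →
        0 < ε → ε < 4 * (1 + dbar) → 0 < δ → δ < 1 →
        -- accuracy, with `β` chosen independently of the time horizon
        (∃ β : ℕ → ℝ, (∃ b, 0 < b ∧ ∀ i, b ≤ β i) ∧
          ∀ (pb : TruVaR.Problem) (Ω : Type*) [MeasurableSpace Ω] (P : Measure Ω)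
            [IsProbabilityMeasure P] (f : D → Ω → ℝ) (z : ℕ → Ω → ℝ) (x : ℕ → Ω → D),
            TruVaR.IsModel P k (σ ^ 2) f z →
            TruVaR.IsRun pb k ⟨σ ^ 2, 1, 1 / 2, dbar, β⟩ f z x →
            1 - δ ≤ P.real {ω | ∀ T : ℕ, 1 ≤ T → TruVaR.threshold k σ dbar ε δ T ≤ (T : ℝ) →
              TruVaR.Accurate pb ε (fun a => f a ω)
                (TruVaR.runState pb k ⟨σ ^ 2, 1, 1 / 2, dbar, β⟩ f z x ω T)}) ∧
        -- the threshold is `C₁ γ_T β_T / ε² + 1` up to constants and logarithmic factors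
        (∀ T : ℕ, 1 ≤ T →
          TruVaR.threshold k σ dbar ε δ T ≤ K * TruVaR.rate k σ ε δ T *
            (1 + Real.posLog (1 / ε) + Real.log (Fintype.card D)
              + Real.posLog (TruVaR.betaT (Fintype.card D) δ T)) ^ 2 ∧
          (1 ≤ TruVaR.logFactor (Fintype.card D) dbar ε δ T →
            TruVaR.rate k σ ε δ T ≤ TruVaR.threshold k σ dbar ε δ T)) := by
  have hK₁ : 0 ≤ Real.logb 2 (8 * (1 + dbar)) := Real.logb_nonneg (by norm_num) (by linarith)
  have hK₂ : 0 ≤ Real.log (16 * (1 + dbar) ^ 2 / dbar ^ 2) := Real.log_nonneg (by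
    rw [le_div_iff₀ (by positivity)]
    nlinarith)
  refine ⟨(96 * (1 + dbar) ^ 2 + 2 * (Real.logb 2 (8 * (1 + dbar)) + 1) + 4)
    * (Real.log (16 * (1 + dbar) ^ 2 / dbar ^ 2) + 2), by positivity, ?_⟩
  intro D _ _ k σ ε δ hk h1 hσ hsub hε hε' hδ hδ1
  refine ⟨?_, fun T hT => ⟨TruVaR.threshold_le_rate h1 hσ hdbar hε hε' hδ hδ1 hT,
    TruVaR.rate_le_threshold h1 hσ hdbar hε hε' hδ hδ1 hT⟩⟩
  -- β is built from the least admissible horizon; accuracy from that time on covers every other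
  -- admissible one. This is why β need not depend on `T`.
  by_cases hex : ∃ T : ℕ, 1 ≤ T ∧ TruVaR.threshold k σ dbar ε δ T ≤ T
  · classical
    obtain ⟨hT1, hT⟩ := Nat.find_spec hex
    obtain ⟨β, hβ, h⟩ :=
      TruVaR.exists_beta_of_threshold_le hk h1 hσ hsub hdbar hε hε' hδ hδ1 hT1 hT
    refine ⟨β, hβ, fun pb Ω _ P _ f z x hmodel hrun => (h pb Ω P f z x hmodel hrun).trans ?_⟩
    exact measureReal_mono fun ω hω T h1T hTT => hω T (Nat.find_min' hex ⟨h1T, hTT⟩)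
  · refine ⟨fun _ => 1, ⟨1, one_pos, fun _ => le_rfl⟩, fun pb Ω _ P _ f z x _ _ => ?_⟩
    have huniv : {ω | ∀ T : ℕ, 1 ≤ T → TruVaR.threshold k σ dbar ε δ T ≤ (T : ℝ) →
        TruVaR.Accurate pb ε (fun a => f a ω)
          (TruVaR.runState pb k ⟨σ ^ 2, 1, 1 / 2, dbar, fun _ => 1⟩ f z x ω T)} = Set.univ :=
      Set.eq_univ_of_forall fun ω T h1T hTT => absurd ⟨T, h1T, hTT⟩ hex
    rw [huniv, probReal_univ]
    linarith
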